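/- \textbf{Setting.} Let $d\ge 1$, $\beta\in(1,2]$, and let $W_n\subset\mathbb R^d$ ($n\in\mathbb N$) be measurable windows, $\overline W=\bigcup_n W_n$, $a_n>0$, $h_n>0$, and $x\in\operatorname{int}\big(\bigcap_n W_n\big)$. Let $\lambda:\mathbb R^d\to[0,\infty)$ be bounded and measurable, and of class $C^{1,\beta-1}$ on $\overline W$: differentiable on $\overline W$ with $\sup_{\overline W}\|\nabla\lambda\|<\infty$ and $\|\nabla\lambda(u)-\nabla\lambda(v)\|\le L\|u-v\|^{\beta-1}$ for all $u,v\in\overline W$, for some $L$. Let $X_n$ be a simple locally finite point process on $\mathbb R^d$ with intensity function $a_n\lambda$ and pair correlation function $g_n\ge0$ (that is, $\mathbb E\sum^{\ne}_{u,v\in X_n}\mathbf 1_{u\in B_1,v\in B_2}=\int_{B_1\times B_2}a_n^2\lambda(u)\lambda(v)g_n(u,v)\,du\,dv$ for all Borel $B_1,B_2$), such that for some constant $c$, all $n$ and all measurable $A\subset W_n$, $$a_n\int_{A^2}|g_n(u,v)-1|\,du\,dv\le c\,|A|.$$ A tessellation of $\mathbb R^d$ is a locally finite collection of compact convex polytopes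 with non-empty, pairwise disjoint interiors that covers $\mathbb R^d$; a random tessellation is regarded as a point process of cells, and is assumed to have finitely many cells hitting a given bounded set in the mean. For a stationary random tessellation, the intensity $\gamma$ is the mean number of cells per unit volume (counted by their centroids), the law of the typical cell $Z_\gamma$ is $B\mapsto\gamma^{-1}\,\mathbb E\,\#\{C:\ \operatorname{centroid}(C)\in[0,1)^d,\ C-\operatorname{centroid}(C)\in B\}$, and the tessellation is regular if all moments of the diameter of the cell containing the origin are finite. It has the scaling property (relative to a stationary tessellation of unit intensity with typical cell $Z_1$) if $Z_\gamma\overset d=\gamma^{-1/d}Z_1$. For each $n$ let $\pi_n^{(1)},\pi_n^{(2)},\dots$ be i.i.d. stationary regular random tessellations with intensity $h_n^{-d}$, independent (jointly) of $X_n$, and having the scaling property relative to one and the same unit intensity stationary tessellation. Let $A_n^{(i)}(x)$ be the intersection with $W_n$ of the cell of $\pi_n^{(i)}$ that contains $x$. Assume that for every $i$, as $n\to\infty$, $\operatorname{diam}(A_n^{(i)}(x))\to0$ in probability and $\mathbb E\big[1/(a_n|A_n^{(i)}(x)|)\big]\to0$. Put $$\hat\lambda^{(i)}(x)=\frac{\#(X_n\cap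 A_n^{(i)}(x))}{a_n|A_n^{(i)}(x)|},\qquad \hat\lambda^{(RF,M)}(x)=\frac1M\sum_{i=1}^M\hat\lambda^{(i)}(x),\qquad \mathrm{MSE}_n(M)=\mathbb E\big[(\hat\lambda^{(RF,M)}(x)-\lambda(x))^2\big].$$ \textbf{Statement.} (1) There is $c>0$ such that for all $n$ and all $M\ge1$, $$\mathrm{MSE}_n(M)\le c\Big(\frac1{a_nh_n^d}+\frac{h_n^2}{M}+h_n^{2\beta}\Big).$$ (2) If $a_n\to\infty$ and $h_n$ is of exact order $a_n^{-1/(d+2\beta)}$, then there is $c>0$ such that for all large $n$ and all $M>h_n^{2-2\beta}$, $\mathrm{MSE}_n(M)\le c\,a_n^{-2\beta/(d+2\beta)}$. (3) The rate in (2) is minimax: if $a_n\to\infty$, then for every $L>0$ there is $c>0$ such that for all large $n$ and every estimator $S$ (measurable real function of a point configuration) there is a measurable $f:\mathbb R^d\to[0,L]$, differentiable on $\overline W$ with gradient bounded by $L$ and $(\beta-1)$-Hölder with constant $L$ there, such that $\mathbb E[(S(Y)-f(x))^2]\ge c\,a_n^{-2\beta/(d+2\beta)}$ when $Y$ is a Poisson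 point process on $W_n$ with intensity function $a_nf$. (4) A single tree does not attain this rate: if $\lambda(x)>0$, $\nabla\lambda(x)\ne0$ and $g_n(u,v)\ge1$ for all $n$ and all $u,v\in W_n$ (for instance for Poisson processes, where $g_n=1$), then there is $c>0$ such that for all large $n$ $$\mathrm{MSE}_n(1)\ge c\Big(\frac1{a_nh_n^d}+h_n^2\Big),$$ and, if $a_n\to\infty$, then $\mathrm{MSE}_n(1)\,/\,a_n^{-2\beta/(d+2\beta)}\to\infty$ (whatever the bandwidths $h_n$ are). -/

import Mathlib

open MeasureTheory ProbabilityTheory Filter Topology TopologicalSpace Set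

namespace SpatialForest

noncomputable section

/-- The Euclidean space `ℝ^d`. -/
abbrev E (d : ℕ) : Type := EuclideanSpace ℝ (Fin d)

/-- The counting measure `∑_{s ∈ S} δ_s` of the points of a set `S`. -/
def pointMeasure {α : Type*} [MeasurableSpace α] (S : Set α) : Measure α :=
  Measure.sum (fun s : S => Measure.dirac (s : α))

/-! ### Spatial point processes -/

/-- A (simple, locally finite) point configuration of `ℝ^d`. -/
structure PointConfig (d : ℕ) where
  points : Set (E d)
  locallyFinite : ∀ r : ℝ, (points ∩ Metric.closedBall 0 r).Finite

/-- The number of points of the configuration in `B`, as an element of `[0, ∞]`. -/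
def PointConfig.count {d : ℕ} (ξ : PointConfig d) (B : Set (E d)) : ENNReal :=
  pointMeasure ξ.points B

/-- The usual sigma-algebra on configurations: it is generated by the counts
`ξ ↦ #(ξ ∩ B)`, `B` Borel. A point process is a random variable in this space. -/
instance (d : ℕ) : MeasurableSpace (PointConfig d) :=
  MeasurableSpace.comap (fun ξ => pointMeasure ξ.points) inferInstance

/-- `ρ` is the intensity function of the point process `X`:
`𝔼 #(X ∩ B) = ∫_B ρ` for all Borel sets `B`. -/
def HasIntensity {d : ℕ} {Ω : Type*} [MeasurableSpace Ω] (P : Measure Ω)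
    (X : Ω → PointConfig d) (ρ : E d → ℝ) : Prop :=
  ∀ B : Set (E d), MeasurableSet B →
    ∫⁻ ω, (X ω).count B ∂P = ∫⁻ u in B, ENNReal.ofReal (ρ u)

/-- `g` is a pair correlation function of the point process `X` with intensity `ρ`: the
second order intensity of `X` exists and equals `ρ(u) ρ(v) g(u, v)`, that is
`𝔼 ∑_{u ≠ v ∈ X} 1(u ∈ B₁, v ∈ B₂) = ∫_{B₁ × B₂} ρ(u) ρ(v) g(u, v) du dv`.
The values of `g` where `ρ(u) ρ(v) = 0` may be given by any convention. -/
structure HasPairCorrelation {d : ℕ} {Ω : Type*} [MeasurableSpace Ω] (P : Measure Ω)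
    (X : Ω → PointConfig d) (ρ : E d → ℝ) (g : E d × E d → ℝ) : Prop where
  measurable : Measurable g
  nonneg : ∀ p, 0 ≤ g p
  secondOrder : ∀ B₁ B₂ : Set (E d), MeasurableSet B₁ → MeasurableSet B₂ →
    ∫⁻ ω, (({p : E d × E d | p.1 ∈ (X ω).points ∧ p.2 ∈ (X ω).points ∧ p.1 ≠ p.2 ∧
        p.1 ∈ B₁ ∧ p.2 ∈ B₂}.encard : ℕ∞) : ENNReal) ∂P =
      ∫⁻ p in B₁ ×ˢ B₂, ENNReal.ofReal (ρ p.1 * ρ p.2 * g p)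

/-- `Q` is the law of a Poisson point process on `ℝ^d` with intensity measure `ν`. -/
structure IsPoissonLaw {d : ℕ} (Q : Measure (PointConfig d)) (ν : Measure (E d)) : Prop where
  prob : IsProbabilityMeasure Q
  counts : ∀ B : Set (E d), MeasurableSet B → ν B ≠ ⊤ →
    Q.map (fun ξ => ξ.count B) =
      (poissonMeasure (ν B).toNNReal).map (fun k : ℕ => (k : ENNReal))
  indep : ∀ (m : ℕ) (B : Fin m → Set (E d)), (∀ i, MeasurableSet (B i)) →
    Pairwise (fun i j => Disjoint (B i) (B j)) →
    iIndepFun (fun i ξ => PointConfig.count ξ (B i)) Q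

/-! ### Tessellations -/

/-- Non-empty compact sets carry the Borel sigma-algebra of the Hausdorff metric. -/
instance (d : ℕ) : MeasurableSpace (NonemptyCompacts (E d)) := borel _

/-- A tessellation of `ℝ^d`: a locally finite collection of compact convex polytopes with
non-empty interiors, covering the space, any two of them having disjoint interiors. -/
structure Tessellation (d : ℕ) where
  cells : Set (NonemptyCompacts (E d))
  polytope : ∀ C ∈ cells, ∃ s : Finset (E d), (C : Set (E d)) = convexHull ℝ (s : Set (E d))
  nonempty_interior : ∀ C ∈ cells, (interior (C : Set (E d))).Nonempty
  cover : ∀ u : E d, ∃ C ∈ cells, u ∈ C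
  disjoint_interior : ∀ C ∈ cells, ∀ C' ∈ cells, C ≠ C' →
    Disjoint (interior (C : Set (E d))) (interior (C' : Set (E d)))
  locallyFinite : ∀ r : ℝ,
    {C ∈ cells | ((C : Set (E d)) ∩ Metric.closedBall 0 r).Nonempty}.Finite

/-- A tessellation is identified with the point configuration of its cells; the sigma-algebra
is generated by the numbers of cells in Borel sets of compact sets. -/
instance (d : ℕ) : MeasurableSpace (Tessellation d) :=
  MeasurableSpace.comap (fun T => pointMeasure T.cells) inferInstance

/-- The cell of the tessellation that contains `x`. (If `x` lies on the common boundary of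
several cells, then their union; for a stationary random tessellation this has probability
zero.) For `x = 0` this is the zero cell. -/
def Tessellation.cellAt {d : ℕ} (T : Tessellation d) (x : E d) : Set (E d) :=
  {u | ∃ C ∈ T.cells, x ∈ C ∧ u ∈ C}

/-- The centroid of a compact set. -/
def centroid {d : ℕ} (C : NonemptyCompacts (E d)) : E d := ⨍ u in (C : Set (E d)), u

/-- The translate `C + v`. -/
def translate {d : ℕ} (v : E d) (C : NonemptyCompacts (E d)) : NonemptyCompacts (E d) :=
  C.map (fun u => u + v) (by fun_prop)

/-- The dilate `s C`. -/
def dilate {d : ℕ} (s : ℝ) (C : NonemptyCompacts (E d)) : NonemptyCompacts (E d) :=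
  C.map (fun u => s • u) (by fun_prop)

/-- The cells with centroid in the unit cube `[0,1)^d`. -/
def unitCubeCells (d : ℕ) : Set (NonemptyCompacts (E d)) :=
  {C | ∀ i, centroid C i ∈ Ico (0 : ℝ) 1}

variable {d : ℕ} {Ω : Type*} [MeasurableSpace Ω]

/-- The intensity of a stationary tessellation: the mean number of cells per unit volume. -/
def intensity (P : Measure Ω) (T : Ω → Tessellation d) : ENNReal :=
  ∫⁻ ω, pointMeasure (T ω).cells (unitCubeCells d) ∂P

/-- The law of the typical cell (shifted to have its centroid at the origin) of a stationary
tessellation with intensity `γ`: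
`B ↦ γ⁻¹ 𝔼 #{C : centroid(C) ∈ [0,1)^d, C - centroid(C) ∈ B}`. -/
def typicalCellLaw (P : Measure Ω) (T : Ω → Tessellation d) :
    Measure (NonemptyCompacts (E d)) :=
  (intensity P T)⁻¹ •
    ((P.bind (fun ω => pointMeasure (T ω).cells)).restrict (unitCubeCells d)).map
      (fun C => translate (-centroid C) C)

/-- `T` is a stationary random tessellation with intensity `γ`. As usual for particle
processes, the mean number of cells hitting a bounded set is finite. -/
structure IsStationaryTessellation (P : Measure Ω) (T : Ω → Tessellation d) (γ : ℝ) :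
    Prop where
  measurable : Measurable T
  stationary : ∀ v : E d,
    P.map (fun ω => (pointMeasure (T ω).cells).map (translate v)) =
      P.map (fun ω => pointMeasure (T ω).cells)
  locallyFinite : ∀ r : ℝ,
    ∫⁻ ω, pointMeasure (T ω).cells
      {C | ((C : Set (E d)) ∩ Metric.closedBall 0 r).Nonempty} ∂P ≠ ⊤
  intensity_eq : intensity P T = ENNReal.ofReal γ

/-- Regularity: all moments of the diameter of the zero cell are finite. -/
def IsRegularTessellation (P : Measure Ω) (T : Ω → Tessellation d) : Prop :=
  ∀ k : ℝ, 0 ≤ k →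
    ∫⁻ ω, ENNReal.ofReal (Metric.diam ((T ω).cellAt 0) ^ k) ∂P ≠ ⊤

/-- The scaling property `Z_γ = γ^{-1/d} Z_1` in distribution, where `Z_γ` is the typical
cell of `T` (of intensity `γ`) and `Z_1` is the typical cell of `T₁` (of unit intensity). -/
def HasScaling {Ω₁ : Type*} [MeasurableSpace Ω₁] (P : Measure Ω) (T : Ω → Tessellation d)
    (γ : ℝ) (P₁ : Measure Ω₁) (T₁ : Ω₁ → Tessellation d) : Prop :=
  typicalCellLaw P T = (typicalCellLaw P₁ T₁).map (dilate (γ ^ (-(1 : ℝ) / d)))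

/-! ### The estimators -/

/-- The cell containing `x` of the partition of the window `W` built from `T`. -/
def windowCell (W : Set (E d)) (x : E d) (T : Tessellation d) : Set (E d) :=
  T.cellAt x ∩ W

/-- The tree estimator `#(ξ ∩ A(x)) / (a |A(x)|)`, `A(x)` the cell of `x` in the window. -/
def treeEstimator (a : ℝ) (W : Set (E d)) (x : E d) (ξ : PointConfig d)
    (T : Tessellation d) : ℝ :=
  (ξ.count (windowCell W x T)).toReal / (a * (volume (windowCell W x T)).toReal)

/-- The forest estimator: the average of the tree estimators of the first `M` partitions. -/
def forestEstimator (a : ℝ) (W : Set (E d)) (x : E d) (ξ : PointConfig d)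
    (π : ℕ → Tessellation d) (M : ℕ) : ℝ :=
  (1 / (M : ℝ)) * ∑ i ∈ Finset.range M, treeEstimator a W x ξ (π i)

/-- The mean squared error at `x` of the forest with `M` trees, for the target `lam`. -/
def forestMSE (P : Measure Ω) (a : ℝ) (W : Set (E d)) (x : E d) (lam : E d → ℝ)
    (X : Ω → PointConfig d) (π : ℕ → Ω → Tessellation d) (M : ℕ) : ENNReal :=
  ∫⁻ ω, ENNReal.ofReal
    ((forestEstimator a W x (X ω) (fun i => π i ω) M - lam x) ^ 2) ∂P

/-! ### Smoothness -/

/-- `f` is differentiable on `S`, with gradient bounded by `L` and `(β - 1)`-Hölder with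
constant `L` on `S`. -/
def IsC1Holder (S : Set (E d)) (β L : ℝ) (f : E d → ℝ) : Prop :=
  ∃ G : E d → E d,
    (∀ u ∈ S, HasGradientWithinAt f (G u) S u) ∧
    (∀ u ∈ S, ‖G u‖ ≤ L) ∧
    (∀ u ∈ S, ∀ v ∈ S, ‖G u - G v‖ ≤ L * ‖u - v‖ ^ (β - 1))

end

end SpatialForest

open SpatialForest

namespace SpatialForest

/-! For a fixed cell, the error of a tree is the sum of a centred fluctuation of the count
(`treeDeviation`) and a bias that depends on the cell alone (`treeBias`). Both are controlled
through a single law on compact sets. The intensity measure of the cells of a stationary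
tessellation is translation invariant, so Campbell's formula
(`IsStationaryTessellation.lintegral_typicalCell`) turns scaling of the typical cell into scaling of
the whole intensity measure. Hence the cell of `x` is distributed as `x + h K`, where `K` follows
the zero cell law of the tessellation of unit intensity (`map_cell_eq`).

Upper bound. The condition on the pair correlation bounds the variance given the cell by a constant
over `a |A|`. The inverse volume of `K`, even cut off by a ball, has finite mean
(`IsStationaryTessellation.lintegral_inv_volume`), so this contributes `1 / (a h^d)`. All trees
share the point process, and the bound claims no gain from averaging this part. The biases, however,
are independent across trees and have second moment of order `h²`; averaging leaves `h² / M` plus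
the square of their mean. To first order the bias is `h` times the inner product of the gradient
with the centroid of `K`. The zero cell is a size-biased typical cell seen from a uniform point of
it, so this inner product has mean zero (`IsStationaryTessellation.lintegral_inner_centroid`), and
only the Hölder remainder of order `h^β` survives in the mean.

Lower bound for one tree. The centroid of `K` is not almost surely orthogonal to a non-zero
gradient, since otherwise almost all cells would be flat; so the bias is of order `h` with positive
probability. A pair correlation of at least one keeps the variance at least Poissonian. Whatever `h`
is, the sum of both terms is at least `a^(-2/(d+2))`, which is slower than the forest rate because
`β > 1`.

Minimax bound. Le Cam's two point method compares a constant intensity with the same constant plus a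
bump of height of order `δ^β` and width of order `δ`, with `a δ^(2β+d) = 1`. The chi-square
divergence of the two Poisson laws then stays bounded, since for Poisson variables it is explicit
and it tensorises over disjoint sets (`l2Dominated_poisson`, `L2Dominated.pi`,
`IsPoissonLaw.sq_measure_le`). -/

instance (d : ℕ) : BorelSpace (NonemptyCompacts (E d)) := ⟨rfl⟩

/-! ### Kernels that are finite on a countable cover -/

/-- The total mass is finite at each point but need not be uniformly bounded; cutting the source
space according to the integer part of the mass gives countably many finite kernels. -/
lemma isSFiniteKernel_of_finite {α β : Type*} [MeasurableSpace α] [MeasurableSpace β]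
    (κ : Kernel α β) (h : ∀ a, κ a univ ≠ ⊤) : IsSFiniteKernel κ := by
  classical
  have hm : Measurable fun a => κ a univ := κ.measurable_coe MeasurableSet.univ
  let s : ℕ → Set α := fun m => {a | ⌊(κ a univ).toReal⌋₊ = m}
  have hs : ∀ m, MeasurableSet (s m) := fun m =>
    (Nat.measurable_floor.comp hm.ennreal_toReal) (measurableSet_singleton m)
  have hfin : ∀ m, IsFiniteKernel (Kernel.piecewise (hs m) κ 0) := fun m => by
    refine ⟨(m + 1 : ℕ), ENNReal.natCast_lt_top _, fun a => ?_⟩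
    rw [Kernel.piecewise_apply]
    split_ifs with ha
    · have h1 : (κ a univ).toReal < m + 1 := by
        have := Nat.lt_floor_add_one (κ a univ).toReal
        simp only [s, mem_ofPred_eq] at ha
        rwa [ha] at this
      rw [← ENNReal.ofReal_toReal (h a)]
      refine (ENNReal.ofReal_le_ofReal h1.le).trans_eq ?_
      rw [← Nat.cast_succ, ENNReal.ofReal_natCast]
    · simp
  have : κ = Kernel.sum fun m => Kernel.piecewise (hs m) κ 0 := by
    ext a t ht
    rw [Kernel.sum_apply' _ _ ht, tsum_eq_single ⌊(κ a univ).toReal⌋₊]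
    · rw [Kernel.piecewise_apply, if_pos (by simp [s])]
    · intro m hm
      rw [Kernel.piecewise_apply, if_neg (fun h' => hm (by simpa [s] using h'.symm))]
      simp
  rw [this]
  infer_instance

/-- Meant for locally finite configurations, whose total mass may be infinite. The s-finiteness it
yields is what makes the count in a random cell jointly measurable (`measurable_count_inter`). -/
lemma isSFiniteKernel_of_cover {α β : Type*} [MeasurableSpace α] [MeasurableSpace β]
    (κ : Kernel α β) (B : ℕ → Set β) (hB : ∀ k, MeasurableSet (B k)) (hU : ⋃ k, B k = univ)
    (h : ∀ a k, κ a (B k) ≠ ⊤) : IsSFiniteKernel κ := by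
  have hB' : ∀ k, MeasurableSet (disjointed B k) := fun k => MeasurableSet.disjointed hB k
  have : κ = Kernel.sum fun k => κ.restrict (hB' k) := by
    ext a t ht
    rw [Kernel.sum_apply' _ _ ht]
    have : t = ⋃ k, t ∩ disjointed B k := by
      rw [← inter_iUnion, iUnion_disjointed, hU, inter_univ]
    conv_lhs => rw [this]
    rw [measure_iUnion]
    · exact tsum_congr fun k => by rw [Kernel.restrict_apply' _ _ _ ht]
    · exact fun i j hij => ((disjoint_disjointed B) hij).mono inter_subset_right inter_subset_right
    · exact fun k => ht.inter (hB' k)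
  rw [this]
  have : ∀ k, IsSFiniteKernel (κ.restrict (hB' k)) := fun k => by
    refine isSFiniteKernel_of_finite _ fun a => ?_
    rw [Kernel.restrict_apply, Measure.restrict_apply_univ]
    exact ((measure_mono (disjointed_subset B k)).trans_lt (h a k).lt_top).ne
  infer_instance

/-! ### Point measures -/

lemma pointMeasure_apply {α : Type*} [MeasurableSpace α] (S : Set α) {B : Set α}
    (hB : MeasurableSet B) : pointMeasure S B = ((S ∩ B).encard : ENNReal) := by
  classical
  rw [pointMeasure, Measure.sum_apply _ hB, ← ENNReal.tsum_set_one, tsum_subtype (S ∩ B) (fun _ => 1)]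
  have : ∀ s : S, (Measure.dirac (s : α)) B = (fun u => B.indicator (1 : α → ENNReal) u) (s : α) :=
    fun s => by simp [Measure.dirac_apply' _ hB]
  rw [tsum_congr this, tsum_subtype S (fun u => B.indicator (1 : α → ENNReal) u)]
  refine tsum_congr fun u => ?_
  by_cases h1 : u ∈ S <;> by_cases h2 : u ∈ B <;> simp [h1, h2]

variable {d : ℕ}

lemma measurable_pointMeasure_points :
    Measurable fun ξ : PointConfig d => pointMeasure ξ.points := comap_measurable _

lemma measurable_pointMeasure_cells :
    Measurable fun T : Tessellation d => pointMeasure T.cells := comap_measurable _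

/-- The points of a configuration, as a kernel. -/
noncomputable def pointKernel (d : ℕ) : Kernel (PointConfig d) (E d) :=
  ⟨fun ξ => pointMeasure ξ.points, measurable_pointMeasure_points⟩

lemma pointKernel_apply (ξ : PointConfig d) (B : Set (E d)) : pointKernel d ξ B = ξ.count B := rfl

/-- The cells of a tessellation, as a kernel. -/
noncomputable def cellKernel (d : ℕ) : Kernel (Tessellation d) (NonemptyCompacts (E d)) :=
  ⟨fun T => pointMeasure T.cells, measurable_pointMeasure_cells⟩

lemma PointConfig.count_eq_encard (ξ : PointConfig d) {B : Set (E d)} (hB : MeasurableSet B) :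
    ξ.count B = ((ξ.points ∩ B).encard : ENNReal) := pointMeasure_apply _ hB

lemma PointConfig.finite_inter (ξ : PointConfig d) {B : Set (E d)}
    (hb : Bornology.IsBounded B) : (ξ.points ∩ B).Finite := by
  obtain ⟨r, hr⟩ := hb.subset_closedBall 0
  exact (ξ.locallyFinite r).subset (inter_subset_inter_right _ hr)

lemma PointConfig.count_ne_top (ξ : PointConfig d) {B : Set (E d)} (hB : MeasurableSet B)
    (hb : Bornology.IsBounded B) : ξ.count B ≠ ⊤ := by
  rw [ξ.count_eq_encard hB]
  simpa using ξ.finite_inter hb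

lemma iUnion_closedBall_natCast : ⋃ k : ℕ, Metric.closedBall (0 : E d) k = univ :=
  Metric.iUnion_closedBall_nat 0

instance : IsSFiniteKernel (pointKernel d) :=
  isSFiniteKernel_of_cover _ (fun k : ℕ => Metric.closedBall 0 k)
    (fun _ => Metric.isClosed_closedBall.measurableSet) iUnion_closedBall_natCast
    fun ξ _ => ξ.count_ne_top Metric.isClosed_closedBall.measurableSet Metric.isBounded_closedBall

/-! ### The space of non-empty compact sets -/

lemma isClosed_setOf_mem : IsClosed {p : E d × NonemptyCompacts (E d) | p.1 ∈ p.2} := by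
  have h : {p : E d × NonemptyCompacts (E d) | p.1 ∈ p.2} =
      {p | Metric.infDist p.1 (p.2 : Set (E d)) = 0} := by
    ext p
    exact (p.2.isCompact.isClosed.mem_iff_infDist_zero p.2.nonempty)
  rw [h]
  exact isClosed_eq Metric.lipschitz_infDist.continuous continuous_const

lemma measurableSet_setOf_mem : MeasurableSet {p : E d × NonemptyCompacts (E d) | p.1 ∈ p.2} :=
  isClosed_setOf_mem.measurableSet

lemma isClosed_setOf_mem_right (u : E d) : IsClosed {C : NonemptyCompacts (E d) | u ∈ C} :=
  isClosed_setOf_mem.preimage (f := fun C : NonemptyCompacts (E d) => (u, C)) (by fun_prop)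

lemma measurableSet_setOf_mem_right (u : E d) :
    MeasurableSet {C : NonemptyCompacts (E d) | u ∈ C} :=
  (isClosed_setOf_mem_right u).measurableSet

lemma continuous_translate :
    Continuous fun p : E d × NonemptyCompacts (E d) => translate p.1 p.2 :=
  Continuous.nonemptyCompacts_map' (f := fun p : E d × NonemptyCompacts (E d) => p.2)
    (g := fun p u => u + p.1) (by fun_prop) (by simp only [Function.uncurry_def]; fun_prop)

lemma measurable_translate :
    Measurable fun p : E d × NonemptyCompacts (E d) => translate p.1 p.2 :=
  continuous_translate.measurable

lemma measurable_translate_right (v : E d) : Measurable (translate v) :=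
  measurable_translate.comp (measurable_const.prodMk measurable_id)

lemma measurable_dilate (s : ℝ) : Measurable (dilate (d := d) s) :=
  (Continuous.nonemptyCompacts_map _).measurable

lemma mem_translate {u v : E d} {C : NonemptyCompacts (E d)} : u ∈ translate v C ↔ u - v ∈ C := by
  simp only [translate, ← SetLike.mem_coe, NonemptyCompacts.coe_map, mem_image]
  exact ⟨by rintro ⟨w, hw, rfl⟩; simpa using hw, fun h => ⟨_, h, by simp⟩⟩

lemma coe_translate (v : E d) (C : NonemptyCompacts (E d)) :
    (translate v C : Set (E d)) = (fun u => u + v) '' C := rfl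

lemma coe_dilate (s : ℝ) (C : NonemptyCompacts (E d)) :
    (dilate s C : Set (E d)) = (fun u => s • u) '' C := rfl

lemma translate_translate (v w : E d) (C : NonemptyCompacts (E d)) :
    translate v (translate w C) = translate (w + v) C := by
  refine SetLike.ext fun u => ?_
  simp only [mem_translate, sub_sub]
  rw [add_comm]

lemma dilate_translate (s : ℝ) (v : E d) (C : NonemptyCompacts (E d)) :
    dilate s (translate v C) = translate (s • v) (dilate s C) := by
  refine SetLike.coe_injective ?_
  simp only [coe_dilate, coe_translate, image_image, smul_add]

lemma mem_dilate {s : ℝ} (hs : s ≠ 0) {u : E d} {C : NonemptyCompacts (E d)} :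
    u ∈ dilate s C ↔ s⁻¹ • u ∈ C := by
  rw [← SetLike.mem_coe, coe_dilate]
  exact ⟨by rintro ⟨w, hw, rfl⟩; simpa [smul_smul, hs] using hw, fun h => ⟨_, h, by simp [smul_smul, hs]⟩⟩

/-- The relation of membership is closed in the product, so this is the measurability of sections in
Fubini's theorem. -/
lemma measurable_measure_inter (μ : Measure (E d)) [SFinite μ] {B : Set (E d)}
    (hB : MeasurableSet B) :
    Measurable fun C : NonemptyCompacts (E d) => μ ((C : Set (E d)) ∩ B) := by
  have h : MeasurableSet {p : NonemptyCompacts (E d) × E d | p.2 ∈ p.1 ∧ p.2 ∈ B} :=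
    (measurable_swap measurableSet_setOf_mem).inter (measurable_snd hB)
  exact measurable_measure_prodMk_left h

lemma measurable_volume : Measurable fun C : NonemptyCompacts (E d) => volume (C : Set (E d)) := by
  simpa using measurable_measure_inter (volume : Measure (E d)) MeasurableSet.univ

lemma measurableSet_coe (C : NonemptyCompacts (E d)) : MeasurableSet (C : Set (E d)) :=
  C.isCompact.isClosed.measurableSet

lemma measurable_setIntegral {F : Type*} [NormedAddCommGroup F] [NormedSpace ℝ F]
    [MeasurableSpace F] [BorelSpace F] [SecondCountableTopology F]
    {f : E d → F} (hf : Measurable f) {B : Set (E d)} (hB : MeasurableSet B) :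
    Measurable fun C : NonemptyCompacts (E d) => ∫ u in (C : Set (E d)) ∩ B, f u := by
  have h : MeasurableSet {p : NonemptyCompacts (E d) × E d | p.2 ∈ p.1 ∧ p.2 ∈ B} :=
    (measurable_swap measurableSet_setOf_mem).inter (measurable_snd hB)
  have hm : StronglyMeasurable fun p : NonemptyCompacts (E d) × E d =>
      {p : NonemptyCompacts (E d) × E d | p.2 ∈ p.1 ∧ p.2 ∈ B}.indicator (fun p => f p.2) p :=
    ((hf.comp measurable_snd).indicator h).stronglyMeasurable
  have := hm.integral_prod_right' (ν := (volume : Measure (E d)))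
  convert! this.measurable using 2 with C
  rw [← integral_indicator ((measurableSet_coe C).inter hB)]
  rfl

lemma measurable_centroid : Measurable (centroid (d := d)) := by
  have h1 := measurable_setIntegral (d := d) measurable_id MeasurableSet.univ
  have h2 := (measurable_volume (d := d)).ennreal_toReal.inv
  simp only [inter_univ, id_eq] at h1
  have : centroid (d := d) = fun C : NonemptyCompacts (E d) =>
      (volume (C : Set (E d))).toReal⁻¹ • ∫ u in (C : Set (E d)), u := by
    funext C
    rw [centroid, setAverage_eq]; rfl
  rw [this]
  exact h2.smul h1

lemma measurable_diam : Measurable fun C : NonemptyCompacts (E d) => Metric.diam (C : Set (E d)) := by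
  refine measurable_of_Iic fun r => ?_
  rcases lt_or_ge r 0 with hr | hr
  · convert MeasurableSet.empty using 1
    ext C
    simpa using hr.trans_le Metric.diam_nonneg
  refine IsClosed.measurableSet ?_
  refine isClosed_of_closure_subset fun C hC => ?_
  refine Metric.diam_le_of_forall_dist_le hr fun u hu v hv => ?_
  refine le_of_forall_pos_le_add fun ε hε => ?_
  obtain ⟨C', hC', hd⟩ := Metric.mem_closure_iff.1 hC (ε / 2) (half_pos hε)
  rw [Metric.NonemptyCompacts.dist_eq] at hd
  have hne : Metric.hausdorffEDist (C : Set (E d)) C' ≠ ⊤ := edist_ne_top C C'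
  obtain ⟨u', hu', h1⟩ := Metric.exists_dist_lt_of_hausdorffDist_lt hu hd hne
  obtain ⟨v', hv', h2⟩ := Metric.exists_dist_lt_of_hausdorffDist_lt hv hd hne
  have h3 : dist u' v' ≤ r := (Metric.dist_le_diam_of_mem C'.isCompact.isBounded hu' hv').trans hC'
  have := dist_triangle4 u u' v' v
  rw [dist_comm v' v] at this
  linarith

lemma isClosed_setOf_hits (y : E d) (r : ℝ) :
    IsClosed {C : NonemptyCompacts (E d) | ((C : Set (E d)) ∩ Metric.closedBall y r).Nonempty} := by
  have : {C : NonemptyCompacts (E d) | ((C : Set (E d)) ∩ Metric.closedBall y r).Nonempty} =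
      {C : NonemptyCompacts (E d) | Metric.infDist y (C : Set (E d)) ≤ r} := by
    ext C
    constructor
    · rintro ⟨u, hu, hur⟩
      exact (Metric.infDist_le_dist_of_mem hu).trans (by rwa [dist_comm])
    · intro h
      obtain ⟨u, hu, hd⟩ := C.isCompact.exists_infDist_eq_dist C.nonempty y
      exact ⟨u, hu, by rw [Metric.mem_closedBall, dist_comm, ← hd]; exact h⟩
  rw [this]
  exact isClosed_le (Metric.lipschitz_infDist_set y).continuous continuous_const

/-- Points of a Hausdorff limit are approximated by points of the approximating sets, whose convex
combinations are close to the limit again. Convexity thus serves as a measurable substitute for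
being a polytope. -/
lemma isClosed_setOf_convex : IsClosed {C : NonemptyCompacts (E d) | Convex ℝ (C : Set (E d))} := by
  have : {C : NonemptyCompacts (E d) | Convex ℝ (C : Set (E d))} =
      {C | ∀ t ∈ Icc (0 : ℝ) 1, ∀ u ∈ C, ∀ v ∈ C, (1 - t) • u + t • v ∈ C} := by
    ext C
    constructor
    · intro h t ht u hu v hv
      exact h hu hv (by linarith [ht.2]) ht.1 (by ring)
    · intro h u hu v hv a b ha hb hab
      have := h b ⟨hb, by linarith⟩ u hu v hv
      rwa [show 1 - b = a by linarith] at this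
  rw [this]
  refine isClosed_of_closure_subset fun C hC t ht u hu v hv => ?_
  rw [← SetLike.mem_coe, C.isCompact.isClosed.mem_iff_infDist_zero C.nonempty]
  refine le_antisymm (le_of_forall_pos_le_add fun ε hε => ?_) Metric.infDist_nonneg
  obtain ⟨C', hC', hd⟩ := Metric.mem_closure_iff.1 hC (ε / 2) (half_pos hε)
  rw [Metric.NonemptyCompacts.dist_eq] at hd
  have hne : Metric.hausdorffEDist (C : Set (E d)) C' ≠ ⊤ := edist_ne_top C C'
  obtain ⟨u', hu', h1⟩ := Metric.exists_dist_lt_of_hausdorffDist_lt hu hd hne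
  obtain ⟨v', hv', h2⟩ := Metric.exists_dist_lt_of_hausdorffDist_lt hv hd hne
  obtain ⟨w, hw, h3⟩ := Metric.exists_dist_lt_of_hausdorffDist_lt' (hC' t ht u' hu' v' hv') hd hne
  have h4 : dist ((1 - t) • u + t • v) ((1 - t) • u' + t • v') ≤ ε / 2 := by
    rw [dist_eq_norm] at h1 h2 ⊢
    have : (1 - t) • u + t • v - ((1 - t) • u' + t • v') = (1 - t) • (u - u') + t • (v - v') := by
      module
    rw [this]
    refine (norm_add_le _ _).trans ?_
    rw [norm_smul, norm_smul, Real.norm_of_nonneg ht.1, Real.norm_of_nonneg (by linarith [ht.2])]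
    nlinarith [ht.1, ht.2]
  calc Metric.infDist ((1 - t) • u + t • v) (C : Set (E d))
      ≤ dist ((1 - t) • u + t • v) w := Metric.infDist_le_dist_of_mem hw
    _ ≤ _ := dist_triangle _ ((1 - t) • u' + t • v') _
    _ ≤ 0 + ε := by rw [dist_comm _ w] ; linarith

lemma isClosed_setOf_closedBall_subset (y : E d) (r : ℝ) :
    IsClosed {C : NonemptyCompacts (E d) | Metric.closedBall y r ⊆ C} := by
  have : {C : NonemptyCompacts (E d) | Metric.closedBall y r ⊆ C} =
      ⋂ u ∈ Metric.closedBall y r, {C | u ∈ C} := by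
    ext C; simp [subset_def]
  rw [this]
  exact isClosed_biInter fun u _ => isClosed_setOf_mem_right u

lemma measurableSet_setOf_mem_interior (y : E d) :
    MeasurableSet {C : NonemptyCompacts (E d) | y ∈ interior (C : Set (E d))} := by
  have : {C : NonemptyCompacts (E d) | y ∈ interior (C : Set (E d))} =
      ⋃ k : ℕ, {C : NonemptyCompacts (E d) | Metric.closedBall y (1 / (k + 1)) ⊆ C} := by
    ext C
    simp only [mem_ofPred_eq, mem_iUnion, mem_interior_iff_mem_nhds]
    rw [Metric.nhds_basis_closedBall.mem_iff]
    constructor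
    · rintro ⟨ε, hε, h⟩
      obtain ⟨k, hk⟩ := exists_nat_one_div_lt hε
      exact ⟨k, (Metric.closedBall_subset_closedBall hk.le).trans h⟩
    · rintro ⟨k, h⟩
      exact ⟨_, by positivity, h⟩
  rw [this]
  exact MeasurableSet.iUnion fun k => (isClosed_setOf_closedBall_subset _ _).measurableSet

/-! ### Cells of tessellations -/

section

variable {d : ℕ}

lemma Tessellation.convex (T : Tessellation d) {C : NonemptyCompacts (E d)} (hC : C ∈ T.cells) :
    Convex ℝ (C : Set (E d)) := by
  obtain ⟨s, hs⟩ := T.polytope C hC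
  rw [hs]
  exact convex_convexHull ℝ _

lemma Tessellation.volume_pos (T : Tessellation d) {C : NonemptyCompacts (E d)}
    (hC : C ∈ T.cells) : 0 < volume (C : Set (E d)) :=
  (isOpen_interior.measure_pos volume (T.nonempty_interior C hC)).trans_le
    (measure_mono interior_subset)

lemma volume_coe_ne_top (C : NonemptyCompacts (E d)) : volume (C : Set (E d)) ≠ ⊤ :=
  C.isCompact.measure_lt_top.ne

lemma volume_translate (v : E d) (C : NonemptyCompacts (E d)) :
    volume (translate v C : Set (E d)) = volume (C : Set (E d)) := by
  rw [coe_translate]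
  simp

lemma integrableOn_id (C : NonemptyCompacts (E d)) : IntegrableOn (fun u : E d => u) C :=
  continuous_id.continuousOn.integrableOn_compact C.isCompact

lemma setIntegral_translate {F : Type*} [NormedAddCommGroup F] [NormedSpace ℝ F]
    (f : E d → F) (v : E d) (C : NonemptyCompacts (E d)) :
    ∫ u in (translate v C : Set (E d)), f u = ∫ u in (C : Set (E d)), f (u + v) := by
  have hp := measurePreserving_add_right (volume : Measure (E d)) v
  have he : MeasurableEmbedding fun u : E d => u + v := measurableEmbedding_addRight v
  rw [coe_translate]
  exact hp.setIntegral_image_emb he _ _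

lemma centroid_eq (C : NonemptyCompacts (E d)) :
    centroid C = (volume (C : Set (E d))).toReal⁻¹ • ∫ u in (C : Set (E d)), u := by
  rw [centroid, setAverage_eq]; rfl

/-- Positive volume is essential: the average over a null set is zero by convention, whatever its
position. -/
lemma centroid_translate (v : E d) {C : NonemptyCompacts (E d)}
    (hC : 0 < volume (C : Set (E d))) : centroid (translate v C) = centroid C + v := by
  have h0 : (volume (C : Set (E d))).toReal ≠ 0 :=
    (ENNReal.toReal_pos hC.ne' (volume_coe_ne_top C)).ne'
  rw [centroid_eq, centroid_eq, volume_translate, setIntegral_translate,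
    integral_add (integrableOn_id C) (integrableOn_const (volume_coe_ne_top C)), smul_add]
  congr 1
  rw [setIntegral_const, Measure.real, smul_smul, inv_mul_cancel₀ h0, one_smul]

/-- The unit cube `[0,1)^d`. -/
def unitCube (d : ℕ) : Set (E d) := {u | ∀ i, u i ∈ Ico (0 : ℝ) 1}

lemma measurableSet_unitCube : MeasurableSet (unitCube d) := by
  simp only [unitCube, ofPred_forall]
  refine MeasurableSet.iInter fun i => ?_
  exact measurableSet_Ico.preimage (by fun_prop : Measurable fun u : E d => u i)

lemma volume_unitCube : volume (unitCube d) = 1 := by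
  have h := EuclideanSpace.volume_preserving_symm_measurableEquiv_toLp (Fin d)
  have h2 : unitCube d = (MeasurableEquiv.toLp 2 (Fin d → ℝ)).symm ⁻¹'
      (univ.pi fun _ => Ico (0 : ℝ) 1) := by
    ext u; simp [unitCube]
  rw [h2, h.measure_preimage (MeasurableSet.univ_pi fun _ => measurableSet_Ico).nullMeasurableSet,
    Real.volume_pi_Ico]
  simp

lemma measurableSet_unitCubeCells : MeasurableSet (unitCubeCells d) :=
  measurable_centroid measurableSet_unitCube

end

/-! ### The intensity measure of the cells and Campbell's formula -/

section

variable {d : ℕ} {Ω : Type*} [MeasurableSpace Ω] {P : Measure Ω} {T : Ω → Tessellation d} {γ : ℝ}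

/-- The intensity measure of the cells of a random tessellation. -/
noncomputable def cellMeasure (P : Measure Ω) (T : Ω → Tessellation d) :
    Measure (NonemptyCompacts (E d)) :=
  P.bind (fun ω => pointMeasure (T ω).cells)

lemma IsStationaryTessellation.measurable_pointMeasure (hT : IsStationaryTessellation P T γ) :
    Measurable fun ω => pointMeasure (T ω).cells :=
  measurable_pointMeasure_cells.comp hT.measurable

lemma IsStationaryTessellation.cellMeasure_apply (hT : IsStationaryTessellation P T γ)
    {B : Set (NonemptyCompacts (E d))} (hB : MeasurableSet B) :
    cellMeasure P T B = ∫⁻ ω, pointMeasure (T ω).cells B ∂P :=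
  Measure.bind_apply hB hT.measurable_pointMeasure.aemeasurable

lemma IsStationaryTessellation.ae_cellMeasure (hT : IsStationaryTessellation P T γ) :
    ∀ᵐ C : NonemptyCompacts (E d) ∂(cellMeasure P T), Convex ℝ (C : Set (E d)) ∧ 0 < volume (C : Set (E d)) := by
  have hm : MeasurableSet {C : NonemptyCompacts (E d) |
      Convex ℝ (C : Set (E d)) ∧ 0 < volume (C : Set (E d))} :=
    isClosed_setOf_convex.measurableSet.inter (measurable_volume measurableSet_Ioi)
  rw [ae_iff, ← compl_ofPred, hT.cellMeasure_apply hm.compl]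
  refine lintegral_eq_zero_of_ae_eq_zero (ae_of_all _ fun ω => ?_)
  beta_reduce
  rw [pointMeasure_apply _ hm.compl]
  have : (T ω).cells ∩ {C : NonemptyCompacts (E d) |
      Convex ℝ (C : Set (E d)) ∧ 0 < volume (C : Set (E d))}ᶜ = ∅ :=
    eq_empty_of_forall_notMem fun C hC => hC.2 ⟨(T ω).convex hC.1, (T ω).volume_pos hC.1⟩
  simp [this]

lemma IsStationaryTessellation.cellMeasure_hits (hT : IsStationaryTessellation P T γ) (r : ℝ) :
    cellMeasure P T {C : NonemptyCompacts (E d) | ((C : Set (E d)) ∩ Metric.closedBall 0 r).Nonempty} ≠ ⊤ := by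
  rw [hT.cellMeasure_apply (isClosed_setOf_hits 0 r).measurableSet]
  exact hT.locallyFinite r

lemma IsStationaryTessellation.sigmaFinite (hT : IsStationaryTessellation P T γ) :
    SigmaFinite (cellMeasure P T) := by
  refine ⟨⟨⟨fun k : ℕ => {C : NonemptyCompacts (E d) | ((C : Set (E d)) ∩ Metric.closedBall 0 k).Nonempty},
    fun _ => trivial, fun k => (hT.cellMeasure_hits k).lt_top, ?_⟩⟩⟩
  refine eq_univ_of_forall fun C => mem_iUnion.2 ?_
  obtain ⟨u, hu⟩ := C.nonempty
  obtain ⟨k, hk⟩ := mem_iUnion.1 ((iUnion_closedBall_natCast (d := d)).symm ▸ mem_univ u)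
  exact ⟨k, u, hu, hk⟩

/-- Stationarity concerns the law of the random measure; taking the mean measure is the join of that
law, which commutes with push-forward. -/
lemma IsStationaryTessellation.map_translate (hT : IsStationaryTessellation P T γ) (v : E d) :
    (cellMeasure P T).map (translate v) = cellMeasure P T := by
  have hm := hT.measurable_pointMeasure
  have h := hT.stationary v
  have h2 : P.map (fun ω => (pointMeasure (T ω).cells).map (translate v)) =
      (P.map fun ω => pointMeasure (T ω).cells).map (Measure.map (translate v)) := by
    rw [Measure.map_map (Measure.measurable_map _ (measurable_translate_right v)) hm]
    rfl
  rw [cellMeasure, Measure.bind, ← Measure.join_map_map (measurable_translate_right v), ← h2, h]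

lemma IsStationaryTessellation.lintegral_translate (hT : IsStationaryTessellation P T γ)
    (v : E d) {F : NonemptyCompacts (E d) → ENNReal} (hF : Measurable F) :
    ∫⁻ C, F (translate v C) ∂(cellMeasure P T) = ∫⁻ C, F C ∂(cellMeasure P T) := by
  conv_rhs => rw [← hT.map_translate v]
  rw [lintegral_map hF (measurable_translate_right v)]

lemma measurable_lintegral_translate {F : NonemptyCompacts (E d) → ENNReal} (hF : Measurable F) :
    Measurable fun C => ∫⁻ v : E d, F (translate v C) :=
  Measurable.lintegral_prod_right' (f := fun p : NonemptyCompacts (E d) × E d =>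
    F (translate p.2 p.1)) (hF.comp (measurable_translate.comp measurable_swap))

/-- Each cell is its centred version translated by the centroid, and by invariance the centroids are
spread uniformly. A mass transport argument therefore replaces all cells by those with centroid in
the unit cube, translated by Lebesgue measure. -/
lemma IsStationaryTessellation.lintegral_cellMeasure_eq (hT : IsStationaryTessellation P T γ)
    {F : NonemptyCompacts (E d) → ENNReal} (hF : Measurable F) :
    ∫⁻ C, F C ∂(cellMeasure P T) =
      ∫⁻ C in unitCubeCells d, (∫⁻ v, F (translate v (translate (-centroid C) C)))
        ∂(cellMeasure P T) := by
  have := hT.sigmaFinite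
  -- Since `q (centroid C + v)` integrates to one in `v`, it can be inserted for free; after
  -- exchanging the integrals, invariance moves the translation from the weight to the cell.
  let q : E d → ENNReal := (unitCube d).indicator 1
  have hq : Measurable q := measurable_one.indicator measurableSet_unitCube
  have hq1 : ∫⁻ v, q v = 1 := by
    rw [lintegral_indicator_one measurableSet_unitCube, volume_unitCube]
  calc ∫⁻ C, F C ∂(cellMeasure P T)
      = ∫⁻ C, (∫⁻ v, F C * q (centroid C + v)) ∂(cellMeasure P T) := by
        refine lintegral_congr fun C => ?_
        have h1 : Measurable fun v => q (centroid C + v) := hq.comp (measurable_const_add _)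
        rw [lintegral_const_mul _ h1,
          lintegral_add_left_eq_self q (centroid C), hq1, mul_one]
    _ = ∫⁻ v, ∫⁻ C, F C * q (centroid C + v) ∂(cellMeasure P T) := by
        refine lintegral_lintegral_swap (Measurable.aemeasurable ?_)
        exact (hF.comp measurable_fst).mul
          (hq.comp ((measurable_centroid.comp measurable_fst).add measurable_snd))
    _ = ∫⁻ v, ∫⁻ C, F (translate (-v) C) * q (centroid C) ∂(cellMeasure P T) := by
        refine lintegral_congr fun v => ?_
        have h1 : Measurable fun C => F C * q (centroid C + v) :=
          hF.mul (hq.comp (measurable_centroid.add_const v))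
        rw [← hT.lintegral_translate (-v) h1]
        refine lintegral_congr_ae ?_
        filter_upwards [hT.ae_cellMeasure] with C hC
        rw [centroid_translate _ hC.2, neg_add_cancel_right]
    _ = ∫⁻ C, (∫⁻ v, F (translate (-v) C) * q (centroid C)) ∂(cellMeasure P T) := by
        refine lintegral_lintegral_swap (Measurable.aemeasurable ?_)
        have h1 : Measurable fun p : E d × NonemptyCompacts (E d) => F (translate (-p.1) p.2) :=
          hF.comp (measurable_translate.comp (measurable_fst.neg.prodMk measurable_snd))
        exact h1.mul (hq.comp (measurable_centroid.comp measurable_snd))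
    _ = _ := by
        rw [← lintegral_indicator measurableSet_unitCubeCells]
        refine lintegral_congr fun C => ?_
        by_cases hC : C ∈ unitCubeCells d
        · have h1 : q (centroid C) = 1 := indicator_of_mem (s := unitCube d) hC _
          rw [indicator_of_mem hC]
          simp only [h1, mul_one, translate_translate]
          rw [lintegral_neg_eq_self (fun v => F (translate v C)),
            lintegral_add_left_eq_self (fun v => F (translate v C))]
        · have h1 : q (centroid C) = 0 := indicator_of_notMem (s := unitCube d) hC _
          rw [indicator_of_notMem hC]
          simp [h1]

lemma measurable_center :
    Measurable fun C : NonemptyCompacts (E d) => translate (-centroid C) C :=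
  measurable_translate.comp (measurable_centroid.neg.prodMk measurable_id)

/-- Campbell's formula for the cells of a stationary tessellation. -/
lemma IsStationaryTessellation.lintegral_typicalCell (hT : IsStationaryTessellation P T γ)
    (hγ : 0 < γ) {F : NonemptyCompacts (E d) → ENNReal} (hF : Measurable F) :
    ∫⁻ C, F C ∂(cellMeasure P T) =
      ENNReal.ofReal γ * ∫⁻ Z, (∫⁻ v, F (translate v Z)) ∂(typicalCellLaw P T) := by
  rw [hT.lintegral_cellMeasure_eq hF, typicalCellLaw, hT.intensity_eq, lintegral_smul_measure,
    lintegral_map (measurable_lintegral_translate hF) measurable_center, smul_eq_mul, ← mul_assoc,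
    ENNReal.mul_inv_cancel (by simpa using hγ) ENNReal.ofReal_ne_top, one_mul]
  rfl

lemma lintegral_comp_smul {f : E d → ENNReal} (hf : Measurable f) {h : ℝ} (hh : 0 < h) :
    ∫⁻ v, f v = ENNReal.ofReal (h ^ d) * ∫⁻ v, f (h • v) := by
  have := Measure.map_addHaar_smul (volume : Measure (E d)) hh.ne'
  rw [← lintegral_map hf (measurable_const_smul h), this, lintegral_smul_measure, smul_eq_mul,
    ← mul_assoc, ← ENNReal.ofReal_mul (by positivity)]
  simp [abs_of_pos hh, hh.ne']

/-- Scaling of the typical cell is scaling of the intensity measure of the cells. -/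
lemma cellMeasure_eq_map_dilate {Ω₁ : Type*} [MeasurableSpace Ω₁] {P₁ : Measure Ω₁}
    {T₁ : Ω₁ → Tessellation d} (hd : 1 ≤ d) {h : ℝ} (hh : 0 < h)
    (hT₁ : IsStationaryTessellation P₁ T₁ 1)
    (hT : IsStationaryTessellation P T (h ^ (-(d : ℝ))))
    (hs : HasScaling P T (h ^ (-(d : ℝ))) P₁ T₁) :
    cellMeasure P T = (cellMeasure P₁ T₁).map (dilate h) := by
  refine Measure.ext_of_lintegral _ fun F hF => ?_
  have hd0 : (d : ℝ) ≠ 0 := by positivity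
  -- At intensity `h^(-d)` the scaling property dilates by exactly `h`, and this intensity cancels
  -- the Jacobian `h^d` of the substitution in the translation variable.
  have hexp : (h ^ (-(d : ℝ))) ^ (-(1 : ℝ) / d) = h := by
    rw [← Real.rpow_mul hh.le, show -(d : ℝ) * (-1 / d) = 1 by field_simp, Real.rpow_one]
  have hpow : ENNReal.ofReal (h ^ (-(d : ℝ))) * ENNReal.ofReal (h ^ d) = 1 := by
    rw [← ENNReal.ofReal_mul (by positivity), ← Real.rpow_natCast h d, ← Real.rpow_add hh]
    simp
  have hFd : Measurable fun C => F (dilate h C) := hF.comp (measurable_dilate h)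
  rw [lintegral_map hF (measurable_dilate h), hT.lintegral_typicalCell (by positivity) hF,
    hT₁.lintegral_typicalCell one_pos hFd, hs, hexp,
    lintegral_map (measurable_lintegral_translate hF) (measurable_dilate h),
    ENNReal.ofReal_one, one_mul]
  have : ∀ Z : NonemptyCompacts (E d), ∫⁻ v, F (translate v (dilate h Z)) =
      ENNReal.ofReal (h ^ d) * ∫⁻ v, F (dilate h (translate v Z)) := fun Z => by
    have h1 : Measurable fun v => F (translate v (dilate h Z)) :=
      hF.comp (measurable_translate.comp (measurable_id.prodMk measurable_const))
    rw [lintegral_comp_smul h1 hh]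
    simp only [dilate_translate]
  simp only [this]
  rw [lintegral_const_mul _ (measurable_lintegral_translate hFd), ← mul_assoc, hpow, one_mul]

end

/-! ### The cell of a point -/

section

variable {d : ℕ}

open Classical in
/-- The cell of the tessellation that contains `x`, if there is only one; otherwise `{x}`. -/
noncomputable def Tessellation.cell (x : E d) (T : Tessellation d) : NonemptyCompacts (E d) :=
  if h : ∃! C, C ∈ T.cells ∧ x ∈ C then h.choose else {x}

/-- Expresses uniqueness by a count, which is measurable for the sigma-algebra on tessellations. -/
lemma Tessellation.existsUnique_cell_iff (x : E d) (T : Tessellation d) :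
    (∃! C, C ∈ T.cells ∧ x ∈ C) ↔ pointMeasure T.cells {C | x ∈ C} = 1 := by
  rw [pointMeasure_apply _ (measurableSet_setOf_mem_right x), ← ENat.toENNReal_one,
    ENat.toENNReal_inj, encard_eq_one]
  constructor
  · rintro ⟨C, hC, h⟩
    exact ⟨C, eq_singleton_iff_unique_mem.2 ⟨hC, fun C' h' => h C' h'⟩⟩
  · rintro ⟨C, hC⟩
    obtain ⟨h1, h2⟩ := eq_singleton_iff_unique_mem.1 hC
    exact ⟨C, h1, fun C' h' => h2 C' h'⟩

lemma Tessellation.cell_eq {x : E d} {T : Tessellation d} {C : NonemptyCompacts (E d)}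
    (h : ∃! C, C ∈ T.cells ∧ x ∈ C) (hC : C ∈ T.cells) (hx : x ∈ C) : T.cell x = C := by
  rw [Tessellation.cell, dif_pos h]
  exact h.unique h.choose_spec.1 ⟨hC, hx⟩

lemma Tessellation.pointMeasure_inter {x : E d} {T : Tessellation d}
    (h : ∃! C, C ∈ T.cells ∧ x ∈ C) {B : Set (NonemptyCompacts (E d))} (hB : MeasurableSet B) :
    pointMeasure T.cells ({C | x ∈ C} ∩ B) = B.indicator 1 (T.cell x) := by
  obtain ⟨C, ⟨hC, hx⟩, hu⟩ := id h
  rw [pointMeasure_apply _ ((measurableSet_setOf_mem_right x).inter hB), T.cell_eq h hC hx]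
  by_cases hCB : C ∈ B
  · have : T.cells ∩ ({C | x ∈ C} ∩ B) = {C} :=
      eq_singleton_iff_unique_mem.2 ⟨⟨hC, hx, hCB⟩, fun C' h' => hu C' ⟨h'.1, h'.2.1⟩⟩
    simp [this, hCB]
  · have : T.cells ∩ ({C | x ∈ C} ∩ B) = ∅ :=
      eq_empty_of_forall_notMem fun C' h' => hCB ((hu C' ⟨h'.1, h'.2.1⟩) ▸ h'.2.2)
    simp [this, hCB]

/-- Where the cell is unique, membership of the cell in `B` is again the statement that a count
equals one; elsewhere the value is the constant `{x}`. -/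
lemma measurable_cell (x : E d) : Measurable (Tessellation.cell x) := by
  intro B hB
  have hG : MeasurableSet {T : Tessellation d | ∃! C, C ∈ T.cells ∧ x ∈ C} := by
    simp only [Tessellation.existsUnique_cell_iff]
    exact ((cellKernel d).measurable_coe (measurableSet_setOf_mem_right x))
      (measurableSet_singleton 1)
  have h1 : MeasurableSet {T : Tessellation d | pointMeasure T.cells ({C | x ∈ C} ∩ B) = 1} :=
    ((cellKernel d).measurable_coe ((measurableSet_setOf_mem_right x).inter hB))
      (measurableSet_singleton 1)
  have h2 : Tessellation.cell x ⁻¹' B =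
      ({T : Tessellation d | ∃! C, C ∈ T.cells ∧ x ∈ C} ∩
        {T : Tessellation d | pointMeasure T.cells ({C | x ∈ C} ∩ B) = 1}) ∪
      ({T : Tessellation d | ∃! C, C ∈ T.cells ∧ x ∈ C}ᶜ ∩ {_T | ({x} : NonemptyCompacts (E d)) ∈ B}) := by
    ext T
    by_cases hT : ∃! C, C ∈ T.cells ∧ x ∈ C
    · have h3 := T.pointMeasure_inter hT hB
      by_cases h4 : T.cell x ∈ B
      · simp only [h4, indicator_of_mem, Pi.one_apply] at h3
        simp [hT, h3, h4]
      · simp only [h4, not_false_eq_true, indicator_of_notMem] at h3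
        simp [hT, h3, h4]
    · have h3 : T.cell x = {x} := by rw [Tessellation.cell, dif_neg hT]
      simp [hT, h3]
  rw [h2]
  exact (hG.inter h1).union (hG.compl.inter (MeasurableSet.const _))

/-- The exceptional translations lie in the reflected boundary `x - ∂Z`, which is null because `Z`
is convex. -/
lemma frontier_translate_null {x : E d} {Z : NonemptyCompacts (E d)}
    (hZ : Convex ℝ (Z : Set (E d))) :
    volume {v : E d | x ∈ translate v Z ∧ x ∉ interior (translate v Z : Set (E d))} = 0 := by
  have h1 : {v : E d | x ∈ translate v Z ∧ x ∉ interior (translate v Z : Set (E d))} ⊆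
      (fun v => x - v) ⁻¹' (frontier (Z : Set (E d))) := by
    rintro v ⟨h1, h2⟩
    refine ⟨subset_closure (mem_translate.1 h1), fun h3 => h2 ?_⟩
    have : interior (translate v Z : Set (E d)) = (fun u => u + v) '' interior (Z : Set (E d)) :=
      ((Homeomorph.addRight v).image_interior _).symm
    rw [this]
    exact ⟨x - v, h3, by simp⟩
  refine measure_mono_null h1 ?_
  have hp : MeasurePreserving (fun v : E d => x - v) volume volume :=
    Measure.measurePreserving_sub_left volume x
  rw [hp.measure_preimage isClosed_frontier.measurableSet.nullMeasurableSet]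
  exact hZ.addHaar_frontier volume

end

/-! ### The law of the cell of a point in a stationary tessellation -/

section

variable {d : ℕ} {Ω : Type*} [MeasurableSpace Ω] {P : Measure Ω} {T : Ω → Tessellation d} {γ : ℝ}

/-- By Campbell's formula the position of a cell is uniform given its shape, so a fixed point falls
on the boundary of a convex cell with measure zero. -/
lemma IsStationaryTessellation.ae_mem_interior (hT : IsStationaryTessellation P T γ)
    (hγ : 0 < γ) (x : E d) :
    ∀ᵐ C : NonemptyCompacts (E d) ∂(cellMeasure P T), x ∈ C → x ∈ interior (C : Set (E d)) := by
  let N : Set (NonemptyCompacts (E d)) :=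
    {C | Convex ℝ (C : Set (E d))} ∩ ({C | x ∈ C} ∩ {C | x ∈ interior (C : Set (E d))}ᶜ)
  have hN : MeasurableSet N := isClosed_setOf_convex.measurableSet.inter
    ((measurableSet_setOf_mem_right x).inter (measurableSet_setOf_mem_interior x).compl)
  have h0 : cellMeasure P T N = 0 := by
    rw [← lintegral_indicator_one hN, hT.lintegral_typicalCell hγ (measurable_one.indicator hN)]
    refine mul_eq_zero_of_right _ (lintegral_eq_zero_of_ae_eq_zero (ae_of_all _ fun Z => ?_))
    beta_reduce
    have h1 : MeasurableSet {v : E d | translate v Z ∈ N} :=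
      (measurable_translate.comp (measurable_id.prodMk measurable_const)) hN
    have h2 : (fun v => N.indicator (1 : NonemptyCompacts (E d) → ENNReal) (translate v Z)) =
        {v : E d | translate v Z ∈ N}.indicator 1 := rfl
    rw [h2, lintegral_indicator_one h1]
    by_cases hZ : Convex ℝ (Z : Set (E d))
    · exact measure_mono_null (fun v hv => hv.2) (frontier_translate_null (x := x) hZ)
    · have : {v : E d | translate v Z ∈ N} = ∅ := by
        refine eq_empty_of_forall_notMem fun v hv => hZ ?_
        have h3 : Convex ℝ (translate v Z : Set (E d)) := hv.1
        have h4 : (Z : Set (E d)) = translate (-v) (translate v Z) := by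
          rw [translate_translate, add_neg_cancel]; simp [coe_translate]
        rw [h4, coe_translate, image_add_right]
        exact h3.translate_preimage_left _
      simp [this]
  filter_upwards [hT.ae_cellMeasure, compl_mem_ae_iff.2 h0] with C hC hCN hx
  by_contra h
  exact hCN ⟨hC.1, hx, h⟩

/-- A null set for the intensity measure contains no cell on average, hence almost surely none. -/
lemma IsStationaryTessellation.ae_of_ae_cellMeasure (hT : IsStationaryTessellation P T γ)
    {p : NonemptyCompacts (E d) → Prop} (hp : MeasurableSet {C | p C})
    (h : ∀ᵐ C ∂(cellMeasure P T), p C) : ∀ᵐ ω ∂P, ∀ C ∈ (T ω).cells, p C := by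
  have h0 : cellMeasure P T {C | p C}ᶜ = 0 := h
  rw [hT.cellMeasure_apply hp.compl, lintegral_eq_zero_iff] at h0
  · filter_upwards [h0] with ω hω C hC
    rw [pointMeasure_apply _ hp.compl] at hω
    by_contra hpC
    have : ((T ω).cells ∩ {C | p C}ᶜ).encard = 0 := by simpa using hω
    rw [encard_eq_zero] at this
    exact (this ▸ (⟨hC, hpC⟩ : C ∈ (T ω).cells ∩ {C | p C}ᶜ) : C ∈ (∅ : Set _))
  · exact (Measure.measurable_coe hp.compl).comp hT.measurable_pointMeasure

/-- Almost surely every cell containing `x` has it in its interior, and interiors of distinct cells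
are disjoint. This also identifies the union in `cellAt` with one cell. -/
lemma IsStationaryTessellation.ae_existsUnique (hT : IsStationaryTessellation P T γ)
    (hγ : 0 < γ) (x : E d) :
    ∀ᵐ ω ∂P, (∃! C, C ∈ (T ω).cells ∧ x ∈ C) ∧ (T ω).cellAt x = (T ω).cell x := by
  have hm : MeasurableSet
      {C : NonemptyCompacts (E d) | x ∈ C → x ∈ interior (C : Set (E d))} := by
    have : {C : NonemptyCompacts (E d) | x ∈ C → x ∈ interior (C : Set (E d))} =
        {C : NonemptyCompacts (E d) | x ∈ C}ᶜ ∪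
          {C : NonemptyCompacts (E d) | x ∈ interior (C : Set (E d))} := by
      ext C; simp [imp_iff_not_or]
    rw [this]
    exact (measurableSet_setOf_mem_right x).compl.union (measurableSet_setOf_mem_interior x)
  filter_upwards [hT.ae_of_ae_cellMeasure hm (hT.ae_mem_interior hγ x)] with ω hω
  obtain ⟨C, hC, hx⟩ := (T ω).cover x
  have hu : ∀ C' ∈ (T ω).cells, x ∈ C' → C' = C := fun C' hC' hx' => by
    by_contra hne
    exact disjoint_left.1 ((T ω).disjoint_interior C' hC' C hC hne) (hω C' hC' hx') (hω C hC hx)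
  have h : ∃! C, C ∈ (T ω).cells ∧ x ∈ C := ⟨C, ⟨hC, hx⟩, fun C' h' => hu C' h'.1 h'.2⟩
  refine ⟨h, ?_⟩
  rw [Tessellation.cell_eq h hC hx]
  ext u
  constructor
  · rintro ⟨C', hC', hx', hu'⟩
    exact hu C' hC' hx' ▸ hu'
  · exact fun hu' => ⟨C, hC, hx, hu'⟩

/-- Almost surely exactly one cell contains `x`, so the indicator of an event for this cell is a
number of cells, whose mean is the intensity measure. -/
lemma IsStationaryTessellation.map_cell (hT : IsStationaryTessellation P T γ)
    (hγ : 0 < γ) (x : E d) :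
    P.map (fun ω => (T ω).cell x) = (cellMeasure P T).restrict {C | x ∈ C} := by
  have hm : Measurable fun ω => (T ω).cell x := (measurable_cell x).comp hT.measurable
  ext B hB
  have h1 : B ∩ {C : NonemptyCompacts (E d) | x ∈ C} = {C | x ∈ C} ∩ B := inter_comm _ _
  rw [Measure.map_apply hm hB, Measure.restrict_apply hB, h1,
    hT.cellMeasure_apply ((measurableSet_setOf_mem_right x).inter hB),
    ← lintegral_indicator_one (hm hB)]
  refine lintegral_congr_ae ?_
  filter_upwards [hT.ae_existsUnique hγ x] with ω hω
  rw [(T ω).pointMeasure_inter hω.1 hB]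
  rfl

/-- The law of the cell of the origin. -/
noncomputable def zeroCellLaw (P : Measure Ω) (T : Ω → Tessellation d) :
    Measure (NonemptyCompacts (E d)) :=
  (cellMeasure P T).restrict {C | 0 ∈ C}

lemma IsStationaryTessellation.isProbabilityMeasure [IsProbabilityMeasure P]
    (hT : IsStationaryTessellation P T γ) (hγ : 0 < γ) :
    IsProbabilityMeasure (zeroCellLaw P T) := by
  rw [zeroCellLaw, ← hT.map_cell hγ 0]
  exact Measure.isProbabilityMeasure_map ((measurable_cell 0).comp hT.measurable).aemeasurable

lemma measurable_translate_dilate (x : E d) (h : ℝ) :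
    Measurable fun K : NonemptyCompacts (E d) => translate x (dilate h K) :=
  (measurable_translate_right x).comp (measurable_dilate h)

/-- The law of the cell of `x` is obtained from the one of the zero cell of the tessellation of
unit intensity. -/
lemma map_cell_eq {Ω₁ : Type*} [MeasurableSpace Ω₁] {P₁ : Measure Ω₁}
    {T₁ : Ω₁ → Tessellation d} (hd : 1 ≤ d) {h : ℝ} (hh : 0 < h)
    (hT₁ : IsStationaryTessellation P₁ T₁ 1)
    (hT : IsStationaryTessellation P T (h ^ (-(d : ℝ))))
    (hs : HasScaling P T (h ^ (-(d : ℝ))) P₁ T₁) (x : E d) :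
    P.map (fun ω => (T ω).cell x) =
      (zeroCellLaw P₁ T₁).map (fun K => translate x (dilate h K)) := by
  rw [hT.map_cell (by positivity) x]
  ext B hB
  have h1 : MeasurableSet (B ∩ {C : NonemptyCompacts (E d) | x ∈ C}) :=
    hB.inter (measurableSet_setOf_mem_right x)
  rw [Measure.restrict_apply hB, ← hT.map_translate x,
    Measure.map_apply (measurable_translate_right x) h1, cellMeasure_eq_map_dilate hd hh hT₁ hT hs,
    Measure.map_apply (measurable_dilate h) (measurable_translate_right x h1),
    Measure.map_apply (measurable_translate_dilate x h) hB, zeroCellLaw,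
    Measure.restrict_apply (measurable_translate_dilate x h hB)]
  congr 1
  ext K
  simp [mem_translate, mem_dilate hh.ne']

lemma IsStationaryTessellation.ae_zeroCellLaw (hT : IsStationaryTessellation P T γ)
    (hγ : 0 < γ) :
    ∀ᵐ K : NonemptyCompacts (E d) ∂(zeroCellLaw P T),
      Convex ℝ (K : Set (E d)) ∧ 0 ∈ interior (K : Set (E d)) := by
  rw [zeroCellLaw, ae_restrict_iff' (measurableSet_setOf_mem_right 0)]
  filter_upwards [hT.ae_cellMeasure, hT.ae_mem_interior hγ 0] with C h1 h2 h3
  exact ⟨h1.1, h2 h3⟩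

/-! ### The centroid and the inverse volume of the zero cell -/

lemma IsStationaryTessellation.ae_typicalCellLaw (hT : IsStationaryTessellation P T γ) :
    ∀ᵐ Z : NonemptyCompacts (E d) ∂(typicalCellLaw P T), 0 < volume (Z : Set (E d)) := by
  refine Measure.ae_smul_measure ?_ _
  have hm : MeasurableSet {Z : NonemptyCompacts (E d) | 0 < volume (Z : Set (E d))} :=
    measurable_volume measurableSet_Ioi
  rw [ae_map_iff measurable_center.aemeasurable hm]
  refine ae_restrict_of_ae ?_
  filter_upwards [hT.ae_cellMeasure] with C hC
  rw [volume_translate]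
  exact hC.2

/-- In Campbell's formula the origin lies in `translate (-w) Z` exactly when `w ∈ Z`, and this cell
has centroid `centroid Z - w`. So the zero cell is the size-biased typical cell viewed from a
uniform point. -/
lemma IsStationaryTessellation.lintegral_centroid (hT : IsStationaryTessellation P T γ)
    (hγ : 0 < γ) {f : E d → ENNReal} (hf : Measurable f) :
    ∫⁻ K, f (centroid K) ∂(zeroCellLaw P T) =
      ENNReal.ofReal γ * ∫⁻ Z : NonemptyCompacts (E d), (∫⁻ w in (Z : Set (E d)), f (centroid Z - w))
        ∂(typicalCellLaw P T) := by
  have hfc : Measurable fun K : NonemptyCompacts (E d) => f (centroid K) :=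
    hf.comp measurable_centroid
  rw [zeroCellLaw, ← lintegral_indicator (measurableSet_setOf_mem_right 0),
    hT.lintegral_typicalCell hγ (hfc.indicator (measurableSet_setOf_mem_right 0))]
  congr 1
  refine lintegral_congr_ae ?_
  filter_upwards [hT.ae_typicalCellLaw] with Z hZ
  rw [← lintegral_indicator (measurableSet_coe Z), ← lintegral_neg_eq_self]
  refine lintegral_congr fun w => ?_
  by_cases hw : w ∈ Z
  · have : (0 : E d) ∈ translate (-w) Z := by simpa [mem_translate] using hw
    rw [indicator_of_mem (show translate (-w) Z ∈ {C : NonemptyCompacts (E d) | 0 ∈ C} from this),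
      indicator_of_mem (show w ∈ (Z : Set (E d)) from hw), centroid_translate _ hZ, sub_eq_add_neg]
  · have : ¬ (0 : E d) ∈ translate (-w) Z := by simpa [mem_translate] using hw
    rw [indicator_of_notMem (show translate (-w) Z ∉ {C : NonemptyCompacts (E d) | 0 ∈ C} from this),
      indicator_of_notMem (show w ∉ (Z : Set (E d)) from hw)]

/-- Applied inside each bounded cell, where integrability is clear. Comparing positive and negative
parts then permits integration over all cells before any moment of the zero cell is known. -/
lemma lintegral_ofReal_eq_of_integral_eq_zero {α : Type*} [MeasurableSpace α] {μ : Measure α}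
    {f : α → ℝ} (hf : Integrable f μ) (h0 : ∫ a, f a ∂μ = 0) :
    ∫⁻ a, ENNReal.ofReal (f a) ∂μ = ∫⁻ a, ENNReal.ofReal (-f a) ∂μ := by
  rw [integral_eq_lintegral_pos_part_sub_lintegral_neg_part hf, sub_eq_zero] at h0
  have h1 : ∫⁻ a, ENNReal.ofReal (f a) ∂μ ≠ ⊤ := hf.lintegral_lt_top.ne
  have h2 : ∫⁻ a, ENNReal.ofReal (-f a) ∂μ ≠ ⊤ := hf.neg.lintegral_lt_top.ne
  exact (ENNReal.toReal_eq_toReal_iff' h1 h2).1 h0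

/-- The centroid of the zero cell is symmetric in the mean. -/
lemma IsStationaryTessellation.lintegral_inner_centroid (hT : IsStationaryTessellation P T γ)
    (hγ : 0 < γ) (G : E d) :
    ∫⁻ K, ENNReal.ofReal (inner ℝ G (centroid K)) ∂(zeroCellLaw P T) =
      ∫⁻ K, ENNReal.ofReal (-inner ℝ G (centroid K)) ∂(zeroCellLaw P T) := by
  have h1 : Measurable fun u : E d => ENNReal.ofReal (inner ℝ G u) := by fun_prop
  have h2 : Measurable fun u : E d => ENNReal.ofReal (-inner ℝ G u) := by fun_prop
  rw [hT.lintegral_centroid hγ h1, hT.lintegral_centroid hγ h2]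
  congr 1
  refine lintegral_congr_ae ?_
  filter_upwards [hT.ae_typicalCellLaw] with Z hZ
  have hc : IntegrableOn (fun _ : E d => centroid Z) Z := integrableOn_const (volume_coe_ne_top Z)
  have hi : IntegrableOn (fun w : E d => centroid Z - w) Z := hc.sub (integrableOn_id Z)
  -- The centroid is the mean of a uniform point of the cell; this is the cancellation that removes
  -- the first order bias.
  have h0 : ∫ w in (Z : Set (E d)), (centroid Z - w) = 0 := by
    rw [integral_sub hc (integrableOn_id Z),
      setIntegral_const, centroid_eq, Measure.real, smul_smul,
      mul_inv_cancel₀ (ENNReal.toReal_pos hZ.ne' (volume_coe_ne_top Z)).ne', one_smul, sub_self]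
  refine lintegral_ofReal_eq_of_integral_eq_zero (hi.const_inner G) ?_
  rw [integral_inner hi, h0, inner_zero_right]

/-- The centroid of the zero cell is not confined to a hyperplane. -/
lemma IsStationaryTessellation.not_ae_inner_centroid_eq_zero [IsProbabilityMeasure P]
    (hT : IsStationaryTessellation P T γ) (hγ : 0 < γ) {G : E d} (hG : G ≠ 0) :
    ¬ ∀ᵐ K ∂(zeroCellLaw P T), inner ℝ G (centroid K) = 0 := by
  intro h
  have := hT.isProbabilityMeasure hγ
  have h1 : Measurable fun u : E d => ENNReal.ofReal |inner ℝ G u| := by fun_prop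
  have h2 : ∫⁻ K, ENNReal.ofReal |inner ℝ G (centroid K)| ∂(zeroCellLaw P T) = 0 := by
    refine lintegral_eq_zero_of_ae_eq_zero ?_
    filter_upwards [h] with K hK
    simp [hK]
  have hm : Measurable fun Z : NonemptyCompacts (E d) =>
      ∫⁻ w in (Z : Set (E d)), ENNReal.ofReal |inner ℝ G (centroid Z - w)| := by
    have h3 : Measurable fun p : NonemptyCompacts (E d) × E d =>
        {p : NonemptyCompacts (E d) × E d | p.2 ∈ p.1}.indicator
          (fun p => ENNReal.ofReal |inner ℝ G (centroid p.1 - p.2)|) p :=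
      (h1.comp ((measurable_centroid.comp measurable_fst).sub measurable_snd)).indicator
        (measurable_swap measurableSet_setOf_mem)
    convert! h3.lintegral_prod_right' (ν := (volume : Measure (E d))) using 2 with Z
    rw [← lintegral_indicator (measurableSet_coe Z)]
    rfl
  rw [hT.lintegral_centroid hγ h1, mul_eq_zero, or_iff_right (by simpa using hγ),
    lintegral_eq_zero_iff hm] at h2
  have h4 : ∀ᵐ Z : NonemptyCompacts (E d) ∂(typicalCellLaw P T), volume (Z : Set (E d)) = 0 := by
    filter_upwards [h2] with Z hZ
    have h5 : Measurable fun w : E d => ENNReal.ofReal |inner ℝ G (centroid Z - w)| := by fun_prop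
    simp only [Pi.zero_apply] at hZ
    rw [lintegral_eq_zero_iff h5, Filter.EventuallyEq, ae_restrict_iff' (measurableSet_coe Z)] at hZ
    -- The integrand vanishes only on the hyperplane through the centroid orthogonal to `G`, so
    -- almost all of the cell lies in a null set.
    have h6 : volume {w : E d | inner ℝ G (centroid Z - w) = 0} = 0 := by
      have hp : MeasurePreserving (fun v : E d => centroid Z - v) volume volume :=
        Measure.measurePreserving_sub_left volume _
      have h7 : {w : E d | inner ℝ G (centroid Z - w) = 0} = (fun v : E d => centroid Z - v) ⁻¹'
          (LinearMap.ker (innerSL ℝ G : E d →ₗ[ℝ] ℝ) : Set (E d)) := by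
        ext w; simp
      rw [h7, hp.measure_preimage (Submodule.closed_of_finiteDimensional _).measurableSet.nullMeasurableSet]
      refine Measure.addHaar_submodule _ _ fun htop => hG ?_
      have : G ∈ LinearMap.ker (innerSL ℝ G : E d →ₗ[ℝ] ℝ) := htop ▸ Submodule.mem_top
      simpa using this
    refine measure_mono_null_ae ?_ h6
    filter_upwards [hZ] with w hw hwZ
    have := hw hwZ
    simp only [Pi.zero_apply, ENNReal.ofReal_eq_zero] at this
    exact abs_nonpos_iff.1 this
  -- With `f = 1` the formula reads: the total mass one equals `γ` times the mean volume of the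
  -- typical cell, which would be zero.
  have h8 := hT.lintegral_centroid hγ (measurable_const (a := (1 : ENNReal)))
  simp only [lintegral_const, measure_univ, one_mul, Measure.restrict_apply, MeasurableSet.univ,
    univ_inter] at h8
  rw [lintegral_congr_ae h4] at h8
  simp at h8

/-- Average the base point over a small ball `Q`. Each cell then contributes at most `|C ∩ Q| / |C ∩
Q|`, so the mean is bounded by the expected number of cells hitting `Q`, divided by `|Q|`. The
cut-off by a ball allows for windows that truncate the cell. -/
lemma IsStationaryTessellation.lintegral_inv_volume (hT : IsStationaryTessellation P T γ)
    {r : ℝ} (hr : 0 < r) :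
    ∫⁻ K : NonemptyCompacts (E d), (volume ((K : Set (E d)) ∩ Metric.closedBall 0 r))⁻¹
      ∂(zeroCellLaw P T) ≠ ⊤ := by
  have := hT.sigmaFinite
  let V : E d × NonemptyCompacts (E d) → ENNReal := fun p =>
    {p : E d × NonemptyCompacts (E d) | p.1 ∈ p.2}.indicator
      (fun p => (volume ((p.2 : Set (E d)) ∩ Metric.closedBall p.1 r))⁻¹) p
  have hV : Measurable V := by
    refine Measurable.indicator ?_ measurableSet_setOf_mem
    have h : MeasurableSet {p : (E d × NonemptyCompacts (E d)) × E d |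
        p.2 ∈ p.1.2 ∧ dist p.2 p.1.1 ≤ r} := by
      refine MeasurableSet.inter ?_ ?_
      · exact (measurable_snd.prodMk (measurable_snd.comp measurable_fst)) measurableSet_setOf_mem
      · exact measurableSet_le (measurable_snd.dist (measurable_fst.comp measurable_fst))
          measurable_const
    exact (measurable_measure_prodMk_left h).inv
  have hV' : ∀ y, Measurable fun C => V (y, C) := fun y => hV.comp measurable_prodMk_left
  let I := ∫⁻ C, V (0, C) ∂(cellMeasure P T)
  have hI : ∀ y, ∫⁻ C, V (y, C) ∂(cellMeasure P T) = I := fun y => by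
    rw [← hT.lintegral_translate y (hV' y)]
    refine lintegral_congr fun C => ?_
    simp only [V]
    by_cases h0 : (0 : E d) ∈ C
    · rw [indicator_of_mem (by simpa [mem_translate] using h0), indicator_of_mem (by simpa using h0)]
      have : (translate y C : Set (E d)) ∩ Metric.closedBall y r =
          (fun u => u + y) '' ((C : Set (E d)) ∩ Metric.closedBall 0 r) := by
        rw [image_inter (add_left_injective y), coe_translate]
        congr 1
        simp
      rw [this, image_add_right, measure_preimage_add_right]
    · rw [indicator_of_notMem (by simpa [mem_translate] using h0),
        indicator_of_notMem (by simpa using h0)]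
  -- Half the radius ensures that `Q` is contained in the ball of radius `r` around each of its
  -- points.
  let Q : Set (E d) := Metric.closedBall 0 (r / 2)
  have hQ : MeasurableSet Q := Metric.isClosed_closedBall.measurableSet
  have hmain : volume Q * I ≤ cellMeasure P T
      {C : NonemptyCompacts (E d) | ((C : Set (E d)) ∩ Metric.closedBall 0 (r / 2)).Nonempty} := by
    calc volume Q * I = ∫⁻ y in Q, ∫⁻ C, V (y, C) ∂(cellMeasure P T) := by
          simp only [hI, lintegral_const, Measure.restrict_apply, MeasurableSet.univ, univ_inter]
          rw [mul_comm]
      _ = ∫⁻ C, (∫⁻ y in Q, V (y, C)) ∂(cellMeasure P T) :=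
          lintegral_lintegral_swap hV.aemeasurable
      _ ≤ ∫⁻ C, {C : NonemptyCompacts (E d) |
            ((C : Set (E d)) ∩ Metric.closedBall 0 (r / 2)).Nonempty}.indicator 1 C
            ∂(cellMeasure P T) := by
          refine lintegral_mono fun C => ?_
          have h1 : ∀ y ∈ Q, V (y, C) ≤ (C : Set (E d)).indicator
              (fun _ => (volume ((C : Set (E d)) ∩ Q))⁻¹) y := fun y hy => by
            by_cases hyC : y ∈ C
            · simp only [V]
              rw [indicator_of_mem (by simpa using hyC), indicator_of_mem (by simpa using hyC)]
              refine ENNReal.inv_le_inv.2 (measure_mono (inter_subset_inter_right _ fun u hu => ?_))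
              simp only [Q, Metric.mem_closedBall, dist_zero_right] at hu hy ⊢
              rw [dist_eq_norm]
              linarith [norm_sub_le u y]
            · simp only [V]
              rw [indicator_of_notMem (by simpa using hyC)]
              exact zero_le
          refine (setLIntegral_mono' hQ h1).trans ?_
          rw [lintegral_indicator (measurableSet_coe C), lintegral_const,
            Measure.restrict_restrict (measurableSet_coe C), Measure.restrict_apply_univ]
          by_cases hne : ((C : Set (E d)) ∩ Q).Nonempty
          · rw [indicator_of_mem (show C ∈ {C : NonemptyCompacts (E d) |
              ((C : Set (E d)) ∩ Metric.closedBall 0 (r / 2)).Nonempty} from hne)]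
            exact ENNReal.inv_mul_le_one _
          · rw [not_nonempty_iff_eq_empty.1 hne]
            simp
      _ = _ := lintegral_indicator_one (isClosed_setOf_hits 0 _).measurableSet
  have hQ0 : volume Q ≠ 0 := (Metric.measure_closedBall_pos volume _ (by positivity)).ne'
  have hfin : I ≠ ⊤ := fun h => by
    rw [h, ENNReal.mul_top hQ0, top_le_iff] at hmain
    exact hT.cellMeasure_hits _ hmain
  rw [zeroCellLaw, ← lintegral_indicator (measurableSet_setOf_mem_right 0)]
  exact hfin

end

/-! ### Second moments of the counts of a point process -/

section

variable {d : ℕ}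

lemma measurable_count {B : Set (E d)} (hB : MeasurableSet B) :
    Measurable fun ξ : PointConfig d => ξ.count B :=
  (pointKernel d).measurable_coe hB

/-- `n² = n (n - 1) + n`: the ordered pairs of distinct points are what the pair correlation
function measures. -/
lemma PointConfig.count_sq (ξ : PointConfig d) {A : Set (E d)} (hA : MeasurableSet A)
    (hb : Bornology.IsBounded A) :
    ξ.count A ^ 2 = (({p : E d × E d | p.1 ∈ ξ.points ∧ p.2 ∈ ξ.points ∧ p.1 ≠ p.2 ∧
        p.1 ∈ A ∧ p.2 ∈ A}.encard : ℕ∞) : ENNReal) + ξ.count A := by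
  classical
  obtain ⟨F, hF⟩ := (ξ.finite_inter hb).exists_finset_coe
  have h1 : {p : E d × E d | p.1 ∈ ξ.points ∧ p.2 ∈ ξ.points ∧ p.1 ≠ p.2 ∧
        p.1 ∈ A ∧ p.2 ∈ A} = (F.offDiag : Set (E d × E d)) := by
    ext p
    have h2 : ∀ u, u ∈ F ↔ u ∈ ξ.points ∧ u ∈ A := fun u => by
      rw [← Finset.mem_coe, hF]; rfl
    simp only [mem_ofPred_eq, Finset.mem_coe, Finset.mem_offDiag, h2]
    tauto
  rw [h1, ξ.count_eq_encard hA, ← hF, encard_coe_eq_coe_finsetCard, encard_coe_eq_coe_finsetCard,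
    Finset.offDiag_card]
  simp only [ENat.toENNReal_coe]
  rw [← Nat.cast_pow, ← Nat.cast_add, Nat.cast_inj, sq,
    Nat.sub_add_cancel (Nat.le_mul_self _)]

variable {Ω : Type*} [MeasurableSpace Ω] {P : Measure Ω} {X : Ω → PointConfig d}
  {ρ : E d → ℝ} {g : E d × E d → ℝ}

/-- The expanded second moment, with the cross term kept on the left so that no subtraction in `[0,
∞]` occurs. -/
lemma lintegral_count_sub_sq [IsProbabilityMeasure P] (hX : Measurable X)
    (h1 : HasIntensity P X ρ) (h2 : HasPairCorrelation P X ρ g) {A : Set (E d)}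
    (hA : MeasurableSet A) (hb : Bornology.IsBounded A) {t : ℝ} (ht : 0 ≤ t) :
    ∫⁻ ω, ENNReal.ofReal ((((X ω).count A).toReal - t) ^ 2) ∂P +
        2 * ENNReal.ofReal t * ∫⁻ u in A, ENNReal.ofReal (ρ u) =
      (∫⁻ p in A ×ˢ A, ENNReal.ofReal (ρ p.1 * ρ p.2 * g p)) +
        (∫⁻ u in A, ENNReal.ofReal (ρ u)) + ENNReal.ofReal t ^ 2 := by
  have hm : Measurable fun ω => (X ω).count A := (measurable_count hA).comp hX
  rw [← h1 A hA, ← h2.secondOrder A A hA hA, ← lintegral_const_mul _ hm,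
    ← lintegral_add_right _ (hm.const_mul _), ← lintegral_add_right _ hm]
  have : ENNReal.ofReal t ^ 2 = ∫⁻ _, ENNReal.ofReal t ^ 2 ∂P := by simp
  rw [this, ← lintegral_add_right _ measurable_const]
  refine lintegral_congr fun ω => ?_
  rw [← (X ω).count_sq hA hb]
  have hn := (X ω).count_ne_top hA hb
  rw [← ENNReal.ofReal_toReal hn]
  set n := ((X ω).count A).toReal
  have hn0 : 0 ≤ n := ENNReal.toReal_nonneg
  rw [ENNReal.toReal_ofReal hn0, ← ENNReal.ofReal_pow hn0, ← ENNReal.ofReal_pow ht,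
    ← ENNReal.ofReal_add (by positivity) (by positivity),
    show (2 : ENNReal) = ENNReal.ofReal 2 by simp, ← ENNReal.ofReal_mul (by positivity),
    ← ENNReal.ofReal_mul (by positivity), ← ENNReal.ofReal_add (by positivity) (by positivity)]
  congr 1
  ring

lemma lintegral_intensity_lt_top {R : ℝ} (hR : ∀ u, ρ u ≤ R) {A : Set (E d)}
    (hb : Bornology.IsBounded A) : ∫⁻ u in A, ENNReal.ofReal (ρ u) < ⊤ := by
  refine (lintegral_mono fun u => ENNReal.ofReal_le_ofReal (hR u)).trans_lt ?_
  rw [setLIntegral_const]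
  exact ENNReal.mul_lt_top ENNReal.ofReal_lt_top hb.measure_lt_top

lemma lintegral_prod_intensity (hρ : Measurable ρ) (hρ0 : ∀ u, 0 ≤ ρ u) (A : Set (E d)) :
    ∫⁻ p in A ×ˢ A, ENNReal.ofReal (ρ p.1 * ρ p.2) =
      (∫⁻ u in A, ENNReal.ofReal (ρ u)) ^ 2 := by
  have h : ∀ p : E d × E d, ENNReal.ofReal (ρ p.1 * ρ p.2) =
      ENNReal.ofReal (ρ p.1) * ENNReal.ofReal (ρ p.2) := fun p => ENNReal.ofReal_mul (hρ0 _)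
  simp only [h]
  rw [Measure.volume_eq_prod, ← Measure.prod_restrict, lintegral_prod_mul
    hρ.ennreal_ofReal.aemeasurable hρ.ennreal_ofReal.aemeasurable, sq]

/-- The variance is the Poisson variance plus the integral of `ρ ρ (g - 1)`, which is bounded
through `|g - 1|`. -/
lemma lintegral_count_sub_sq_le [IsProbabilityMeasure P] (hX : Measurable X) {R : ℝ}
    (hR : ∀ u, ρ u ≤ R) (hρ : Measurable ρ) (hρ0 : ∀ u, 0 ≤ ρ u)
    (h1 : HasIntensity P X ρ) (h2 : HasPairCorrelation P X ρ g) {A : Set (E d)}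
    (hA : MeasurableSet A) (hb : Bornology.IsBounded A) :
    ∫⁻ ω, ENNReal.ofReal ((((X ω).count A).toReal -
        (∫⁻ u in A, ENNReal.ofReal (ρ u)).toReal) ^ 2) ∂P ≤
      (∫⁻ u in A, ENNReal.ofReal (ρ u)) +
        ENNReal.ofReal (R ^ 2) * ∫⁻ p in A ×ˢ A, ENNReal.ofReal |g p - 1| := by
  have hμ := lintegral_intensity_lt_top hR hb
  have h := lintegral_count_sub_sq hX h1 h2 hA hb
    (t := (∫⁻ u in A, ENNReal.ofReal (ρ u)).toReal) ENNReal.toReal_nonneg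
  rw [ENNReal.ofReal_toReal hμ.ne] at h
  have hR0 : 0 ≤ R := (hρ0 0).trans (hR 0)
  have h3 : ∫⁻ p in A ×ˢ A, ENNReal.ofReal (ρ p.1 * ρ p.2 * g p) ≤
      (∫⁻ u in A, ENNReal.ofReal (ρ u)) ^ 2 +
        ENNReal.ofReal (R ^ 2) * ∫⁻ p in A ×ˢ A, ENNReal.ofReal |g p - 1| := by
    have hg1 : Measurable fun p => ENNReal.ofReal |g p - 1| :=
      (measurable_norm.comp (h2.measurable.sub_const 1)).ennreal_ofReal
    rw [← lintegral_prod_intensity hρ hρ0, ← lintegral_const_mul _ hg1,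
      ← lintegral_add_right _ (hg1.const_mul _)]
    refine lintegral_mono fun p => ?_
    rw [← ENNReal.ofReal_mul (by positivity), ← ENNReal.ofReal_add
      (mul_nonneg (hρ0 _) (hρ0 _)) (by positivity)]
    refine ENNReal.ofReal_le_ofReal ?_
    have h4 : ρ p.1 * ρ p.2 ≤ R ^ 2 := by
      rw [sq]; exact mul_le_mul (hR _) (hR _) (hρ0 _) hR0
    have h5 : 0 ≤ ρ p.1 * ρ p.2 := mul_nonneg (hρ0 _) (hρ0 _)
    nlinarith [le_abs_self (g p - 1), abs_nonneg (g p - 1)]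
  set μ := ∫⁻ u in A, ENNReal.ofReal (ρ u)
  set V := ∫⁻ ω, ENNReal.ofReal ((((X ω).count A).toReal - μ.toReal) ^ 2) ∂P
  have hμ2 : 2 * μ * μ ≠ ⊤ := ENNReal.mul_ne_top (ENNReal.mul_ne_top (by simp) hμ.ne) hμ.ne
  refine ENNReal.le_of_add_le_add_right hμ2 ?_
  rw [h]
  calc _ ≤ (μ ^ 2 + ENNReal.ofReal (R ^ 2) * ∫⁻ p in A ×ˢ A, ENNReal.ofReal |g p - 1|) + μ + μ ^ 2 := by
        gcongr
    _ = _ := by ring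

/-- With `g ≥ 1` the second factorial moment is at least the square of the mean, so the variance is
at least Poissonian for every centring `t`. -/
lemma le_lintegral_count_sub_sq [IsProbabilityMeasure P] (hX : Measurable X) {R : ℝ}
    (hR : ∀ u, ρ u ≤ R) (hρ : Measurable ρ) (hρ0 : ∀ u, 0 ≤ ρ u)
    (h1 : HasIntensity P X ρ) (h2 : HasPairCorrelation P X ρ g) {A : Set (E d)}
    (hA : MeasurableSet A) (hb : Bornology.IsBounded A) (hg : ∀ p ∈ A ×ˢ A, 1 ≤ g p)
    {t : ℝ} (ht : 0 ≤ t) :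
    ENNReal.ofReal ((∫⁻ u in A, ENNReal.ofReal (ρ u)).toReal +
        ((∫⁻ u in A, ENNReal.ofReal (ρ u)).toReal - t) ^ 2) ≤
      ∫⁻ ω, ENNReal.ofReal ((((X ω).count A).toReal - t) ^ 2) ∂P := by
  have hμ := lintegral_intensity_lt_top hR hb
  have h := lintegral_count_sub_sq hX h1 h2 hA hb ht
  have h3 : (∫⁻ u in A, ENNReal.ofReal (ρ u)) ^ 2 ≤
      ∫⁻ p in A ×ˢ A, ENNReal.ofReal (ρ p.1 * ρ p.2 * g p) := by
    rw [← lintegral_prod_intensity hρ hρ0]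
    refine setLIntegral_mono' (hA.prod hA) fun p hp => ENNReal.ofReal_le_ofReal ?_
    exact le_mul_of_one_le_right (mul_nonneg (hρ0 _) (hρ0 _)) (hg p hp)
  set μ := ∫⁻ u in A, ENNReal.ofReal (ρ u)
  have hm : μ = ENNReal.ofReal μ.toReal := (ENNReal.ofReal_toReal hμ.ne).symm
  set m := μ.toReal
  have hm0 : 0 ≤ m := ENNReal.toReal_nonneg
  refine ENNReal.le_of_add_le_add_right (a := 2 * ENNReal.ofReal t * μ)
    (ENNReal.mul_ne_top (ENNReal.mul_ne_top (by simp) ENNReal.ofReal_ne_top) hμ.ne) ?_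
  rw [h]
  refine le_trans (le_of_eq ?_) (add_le_add_left (add_le_add_left h3 _) _)
  rw [hm, show (2 : ENNReal) = ENNReal.ofReal 2 by simp, ← ENNReal.ofReal_mul (by positivity),
    ← ENNReal.ofReal_mul (by positivity), ← ENNReal.ofReal_add (by positivity) (by positivity),
    ← ENNReal.ofReal_pow (by positivity), ← ENNReal.ofReal_pow (by positivity),
    ← ENNReal.ofReal_add (by positivity) (by positivity),
    ← ENNReal.ofReal_add (by positivity) (by positivity)]
  congr 1
  ring

end

/-! ### Domination of measures in the chi-square sense -/

section

open scoped NNReal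

/-- `(∫ f dp)² ≤ K ∫ f² dq` for all non-negative measurable functions `f`. -/
def L2Dominated {α : Type*} [MeasurableSpace α] (K : ENNReal) (p q : Measure α) : Prop :=
  ∀ f : α → ENNReal, Measurable f → (∫⁻ a, f a ∂p) ^ 2 ≤ K * ∫⁻ a, f a ^ 2 ∂q

lemma sq_lintegral_mul_le {α : Type*} [MeasurableSpace α] {μ : Measure α} {f g : α → ENNReal}
    (hf : Measurable f) (hg : Measurable g) :
    (∫⁻ a, f a * g a ∂μ) ^ 2 ≤ (∫⁻ a, f a ^ 2 ∂μ) * ∫⁻ a, g a ^ 2 ∂μ := by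
  have h := ENNReal.lintegral_mul_le_Lp_mul_Lq μ Real.HolderConjugate.two_two
    hf.aemeasurable hg.aemeasurable
  simp only [ENNReal.rpow_two, Pi.mul_apply] at h
  refine (pow_le_pow_left' h 2).trans_eq ?_
  rw [mul_pow, ← ENNReal.rpow_two, ← ENNReal.rpow_two, ← ENNReal.rpow_mul, ← ENNReal.rpow_mul]
  norm_num

lemma L2Dominated.map {α α' : Type*} [MeasurableSpace α] [MeasurableSpace α'] {K : ENNReal}
    {p q : Measure α} (h : L2Dominated K p q) {ψ : α → α'} (hψ : Measurable ψ) :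
    L2Dominated K (p.map ψ) (q.map ψ) := fun f hf => by
  rw [lintegral_map hf hψ, lintegral_map (hf.pow_const 2) hψ]
  exact h _ (hf.comp hψ)

/-- The domination of the first factor is applied to the inner integral as a function of the first
variable, that of the second factor under the outer integral; the constants multiply. -/
lemma L2Dominated.prod {α α' : Type*} [MeasurableSpace α] [MeasurableSpace α'] {K K' : ENNReal}
    {p q : Measure α} {p' q' : Measure α'} [SFinite p'] [SFinite q']
    (h : L2Dominated K p q) (h' : L2Dominated K' p' q') :
    L2Dominated (K * K') (p.prod p') (q.prod q') := fun f hf => by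
  rw [lintegral_prod _ hf.aemeasurable, lintegral_prod _ (hf.pow_const 2).aemeasurable]
  have hf2 : Measurable fun x => ∫⁻ y, f (x, y) ^ 2 ∂q' := (hf.pow_const 2).lintegral_prod_right'
  refine (h _ hf.lintegral_prod_right').trans ?_
  rw [mul_assoc, ← lintegral_const_mul _ hf2]
  gcongr with x
  exact h' _ (hf.comp measurable_prodMk_left)

lemma L2Dominated.pi {α : Type*} [MeasurableSpace α] : ∀ {m : ℕ} {K : Fin m → ENNReal}
    {p q : Fin m → Measure α} [∀ i, SigmaFinite (p i)] [∀ i, SigmaFinite (q i)],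
    (∀ i, L2Dominated (K i) (p i) (q i)) →
    L2Dominated (∏ i, K i) (Measure.pi p) (Measure.pi q)
  | 0, K, p, q, _, _, _ => fun f hf => by
    rw [Measure.pi_of_empty p, Measure.pi_of_empty q, lintegral_dirac' _ hf,
      lintegral_dirac' _ (hf.pow_const 2)]
    simp
  | m + 1, K, p, q, _, _, h => by
    have hp := (measurePreserving_piFinSuccAbove p 0).symm
    have hq := (measurePreserving_piFinSuccAbove q 0).symm
    rw [Fin.prod_univ_succ, ← hp.map_eq, ← hq.map_eq]
    refine L2Dominated.map ?_ (MeasurableEquiv.measurable _)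
    exact (h 0).prod (L2Dominated.pi fun j => h _)

/-- Cauchy–Schwarz against the likelihood ratio, whose second moment under the Poisson law of mean
`r₀` is exactly `exp ((r₁ - r₀)² / r₀)`. For `r₀ = 0` both laws coincide and, with division by zero
equal to zero, the constant is one. -/
lemma l2Dominated_poisson {r₀ r₁ : ℝ≥0} (h : r₀ = 0 → r₁ = 0) :
    L2Dominated (ENNReal.ofReal (Real.exp (((r₁ : ℝ) - r₀) ^ 2 / r₀)))
      (poissonMeasure r₁) (poissonMeasure r₀) := fun f hf => by
  let ρ : ℕ → ENNReal := fun n =>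
    ENNReal.ofReal (Real.exp (-((r₁ : ℝ) - r₀)) * ((r₁ : ℝ) / r₀) ^ n)
  have hcancel : (r₁ : ℝ) / r₀ * r₀ = r₁ := by
    rcases eq_or_ne r₀ 0 with h0 | h0
    · simp [h h0]
    · exact div_mul_cancel₀ _ (NNReal.coe_ne_zero.2 h0)
  have h1 : ∫⁻ n, f n ∂(poissonMeasure r₁) = ∫⁻ n, f n * ρ n ∂(poissonMeasure r₀) := by
    rw [lintegral_countable', lintegral_countable']
    refine tsum_congr fun n => ?_
    rw [poissonMeasure_singleton, poissonMeasure_singleton, mul_assoc,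
      ← ENNReal.ofReal_mul (by positivity)]
    congr 2
    rw [show Real.exp (-((r₁ : ℝ) - r₀)) * ((r₁ : ℝ) / r₀) ^ n * (Real.exp (-r₀) * (r₀ : ℝ) ^ n / (n.factorial : ℝ)) =
      (Real.exp (-((r₁ : ℝ) - r₀)) * Real.exp (-r₀)) * ((r₁ : ℝ) / r₀ * r₀) ^ n / (n.factorial : ℝ) by
        rw [mul_pow]; ring, hcancel, ← Real.exp_add]
    congr 3
    ring
  have h2 : ∫⁻ n, ρ n ^ 2 ∂(poissonMeasure r₀) =
      ENNReal.ofReal (Real.exp (((r₁ : ℝ) - r₀) ^ 2 / r₀)) := by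
    rw [lintegral_countable']
    have hterm : ∀ n, ρ n ^ 2 * poissonMeasure r₀ {n} =
        ENNReal.ofReal (Real.exp (-2 * ((r₁ : ℝ) - r₀) - r₀) * (((r₁ : ℝ) ^ 2 / r₀) ^ n / (n.factorial : ℝ))) :=
      fun n => by
        rw [poissonMeasure_singleton, ← ENNReal.ofReal_pow (by positivity),
          ← ENNReal.ofReal_mul (by positivity)]
        congr 1
        rw [show (Real.exp (-((r₁ : ℝ) - r₀)) * ((r₁ : ℝ) / r₀) ^ n) ^ 2 *
            (Real.exp (-r₀) * (r₀ : ℝ) ^ n / (n.factorial : ℝ)) =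
          (Real.exp (-((r₁ : ℝ) - r₀)) * Real.exp (-((r₁ : ℝ) - r₀)) * Real.exp (-r₀)) *
            (((r₁ : ℝ) / r₀ * ((r₁ : ℝ) / r₀ * r₀)) ^ n / (n.factorial : ℝ)) by rw [mul_pow, mul_pow]; ring,
          hcancel, ← Real.exp_add, ← Real.exp_add]
        congr 2
        · congr 1; ring
        · congr 1; ring
    rw [tsum_congr hterm]
    have hs := (NormedSpace.expSeries_div_hasSum_exp ((r₁ : ℝ) ^ 2 / r₀)).mul_left
      (Real.exp (-2 * ((r₁ : ℝ) - r₀) - r₀))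
    rw [← ENNReal.ofReal_tsum_of_nonneg (fun n => by positivity) hs.summable, hs.tsum_eq,
      ← Real.exp_eq_exp_ℝ, ← Real.exp_add]
    congr 2
    rcases eq_or_ne r₀ 0 with h0 | h0
    · simp [h0, h h0]
    · have : (r₀ : ℝ) ≠ 0 := NNReal.coe_ne_zero.2 h0
      field_simp
      ring
  rw [h1, ← h2, mul_comm (lintegral _ _)]
  exact sq_lintegral_mul_le hf (measurable_of_countable _)

end

/-! ### Comparison of Poisson laws -/

section

variable {d : ℕ}

/-- The sigma-algebra generated by the counts in a finite family of sets. -/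
@[reducible]
noncomputable def countsSigma (𝓑 : Finset (Set (E d))) : MeasurableSpace (PointConfig d) :=
  ⨆ B ∈ 𝓑, MeasurableSpace.comap (fun ξ => ξ.count B) inferInstance

lemma countsSigma_mono {𝓑 𝓑' : Finset (Set (E d))} (h : 𝓑 ⊆ 𝓑') :
    countsSigma 𝓑 ≤ countsSigma 𝓑' :=
  biSup_mono fun _ hB => h hB

/-- The events that depend on the counts in finitely many bounded Borel sets. -/
def countEvents (d : ℕ) : Set (Set (PointConfig d)) :=
  {A | ∃ 𝓑 : Finset (Set (E d)), (∀ B ∈ 𝓑, MeasurableSet B ∧ Bornology.IsBounded B) ∧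
    MeasurableSet[countsSigma 𝓑] A}

/-- An algebra generating the sigma-algebra approximates every event, so inequalities for finitely
many counts pass to all events. -/
lemma isSetAlgebra_countEvents : IsSetAlgebra (countEvents d) := by
  classical
  refine ⟨⟨∅, by simp, @MeasurableSet.empty _ (countsSigma ∅)⟩, ?_, ?_⟩
  · rintro A ⟨𝓑, h𝓑, hA⟩
    exact ⟨𝓑, h𝓑, @MeasurableSet.compl _ _ (countsSigma 𝓑) hA⟩
  · rintro A A' ⟨𝓑, h𝓑, hA⟩ ⟨𝓑', h𝓑', hA'⟩
    refine ⟨𝓑 ∪ 𝓑', fun B hB => ?_, ?_⟩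
    · rcases Finset.mem_union.1 hB with h | h
      exacts [h𝓑 B h, h𝓑' B h]
    · exact @MeasurableSet.union _ (countsSigma (𝓑 ∪ 𝓑')) _ _
        (countsSigma_mono Finset.subset_union_left A hA)
        (countsSigma_mono Finset.subset_union_right A' hA')

lemma generateFrom_countEvents :
    (inferInstance : MeasurableSpace (PointConfig d)) =
      MeasurableSpace.generateFrom (countEvents d) := by
  refine le_antisymm ?_ ?_
  · change MeasurableSpace.comap (fun ξ : PointConfig d => pointMeasure ξ.points) inferInstance ≤ _
    rw [← measurable_iff_comap_le]
    refine @Measure.measurable_of_measurable_coe _ _ _ (MeasurableSpace.generateFrom (countEvents d))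
      _ fun s hs => ?_
    -- The count in any Borel set is the increasing limit of counts in bounded sets; boundedness
    -- keeps the Poisson means finite later on.
    have h1 : (fun ξ : PointConfig d => pointMeasure ξ.points s) =
        fun ξ => ⨆ k : ℕ, ξ.count (s ∩ Metric.closedBall 0 k) := by
      funext ξ
      have hmono : Monotone fun k : ℕ => s ∩ Metric.closedBall (0 : E d) k := fun i j hij =>
        inter_subset_inter_right _ (Metric.closedBall_subset_closedBall (by exact_mod_cast hij))
      simp only [PointConfig.count]
      rw [← hmono.measure_iUnion, ← inter_iUnion, iUnion_closedBall_natCast, inter_univ]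
    rw [h1]
    let _ : MeasurableSpace (PointConfig d) := MeasurableSpace.generateFrom (countEvents d)
    refine Measurable.iSup fun k => ?_
    intro D hD
    refine MeasurableSpace.measurableSet_generateFrom ⟨{s ∩ Metric.closedBall 0 k}, ?_, ?_⟩
    · intro B hB
      rw [Finset.mem_singleton.1 hB]
      exact ⟨hs.inter Metric.isClosed_closedBall.measurableSet,
        Metric.isBounded_closedBall.subset inter_subset_right⟩
    · have : countsSigma {s ∩ Metric.closedBall (0 : E d) k} =
          MeasurableSpace.comap (fun ξ => ξ.count (s ∩ Metric.closedBall (0 : E d) k))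
            inferInstance := by
        simp [countsSigma]
      rw [this]
      exact ⟨D, hD, rfl⟩
  · refine MeasurableSpace.generateFrom_le ?_
    rintro A ⟨𝓑, h𝓑, hA⟩
    refine (iSup₂_le fun B hB => ?_ : countsSigma 𝓑 ≤ _) A hA
    exact (measurable_count (h𝓑 B hB).1).comap_le

/-- Finitely many bounded sets are unions of finitely many disjoint bounded sets. -/
lemma exists_atoms (𝓑 : Finset (Set (E d)))
    (h𝓑 : ∀ B ∈ 𝓑, MeasurableSet B ∧ Bornology.IsBounded B) :
    ∃ (m : ℕ) (a : Fin m → Set (E d)), (∀ j, MeasurableSet (a j) ∧ Bornology.IsBounded (a j)) ∧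
      Pairwise (fun i j => Disjoint (a i) (a j)) ∧
      ∀ B ∈ 𝓑, ∃ J : Finset (Fin m), B = ⋃ j ∈ J, a j := by
  classical
  let U : Set (E d) := ⋃ B ∈ 𝓑, B
  have hU : MeasurableSet U := 𝓑.measurableSet_biUnion fun B hB => (h𝓑 B hB).1
  have hUb : Bornology.IsBounded U :=
    (Bornology.isBounded_biUnion 𝓑.finite_toSet).2 fun B hB => (h𝓑 B hB).2
  let b : Finset (Set (E d)) → Set (E d) := fun s => {u | u ∈ U ∧ ∀ B ∈ 𝓑, u ∈ B ↔ B ∈ s}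
  have hb : ∀ s, MeasurableSet (b s) := fun s => by
    have : b s = U ∩ ⋂ B ∈ 𝓑, {u | u ∈ B ↔ B ∈ s} := by ext u; simp [b]
    rw [this]
    refine hU.inter (𝓑.measurableSet_biInter fun B hB => ?_)
    by_cases h : B ∈ s
    · simp only [h, iff_true]
      exact (h𝓑 B hB).1
    · simp only [h, iff_false]
      exact (h𝓑 B hB).1.compl
  let e := 𝓑.powerset.equivFin
  refine ⟨_, fun j => b (e.symm j), fun j => ⟨hb _, hUb.subset fun u hu => hu.1⟩, ?_, ?_⟩
  · intro i j hij
    refine disjoint_left.2 fun u hi hj => hij ?_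
    have h1 : ((e.symm i : Finset (Set (E d)))) = (e.symm j : Finset (Set (E d))) := by
      have hsi := Finset.mem_powerset.1 (e.symm i).2
      have hsj := Finset.mem_powerset.1 (e.symm j).2
      ext B
      exact ⟨fun h => (hj.2 B (hsi h)).1 ((hi.2 B (hsi h)).2 h),
        fun h => (hi.2 B (hsj h)).1 ((hj.2 B (hsj h)).2 h)⟩
    exact e.symm.injective (Subtype.ext h1)
  · intro B hB
    refine ⟨Finset.univ.filter fun j => B ∈ (e.symm j : Finset (Set (E d))), ?_⟩
    ext u
    simp only [Finset.mem_filter, Finset.mem_univ, true_and, mem_iUnion, exists_prop]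
    constructor
    · intro hu
      refine ⟨e ⟨𝓑.filter fun B' => u ∈ B', Finset.mem_powerset.2 (Finset.filter_subset _ _)⟩, ?_, ?_⟩
      · simpa [hB] using hu
      · refine ⟨mem_biUnion hB hu, fun B' hB' => ?_⟩
        simp [hB']
    · rintro ⟨j, hj, hu⟩
      exact (hu.2 B hB).2 hj

variable {Q₀ Q₁ : Measure (PointConfig d)} {ν₀ ν₁ : Measure (E d)}

lemma IsPoissonLaw.map_counts {Q : Measure (PointConfig d)} {ν : Measure (E d)}
    (h : IsPoissonLaw Q ν) {m : ℕ} {a : Fin m → Set (E d)} (ha : ∀ j, MeasurableSet (a j))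
    (hν : ∀ j, ν (a j) ≠ ⊤) (hd : Pairwise fun i j => Disjoint (a i) (a j)) :
    Q.map (fun ξ j => ξ.count (a j)) =
      Measure.pi fun j => (poissonMeasure (ν (a j)).toNNReal).map (fun k : ℕ => (k : ENNReal)) := by
  have := h.prob
  rw [(iIndepFun_iff_map_fun_eq_pi_map fun j => (measurable_count (ha j)).aemeasurable).1
    (h.indep m a ha hd)]
  congr 1
  funext j
  exact h.counts _ (ha j) (hν j)

/-- Two Poisson laws with close intensity measures cannot be told apart. -/
lemma IsPoissonLaw.sq_measure_le (h₀ : IsPoissonLaw Q₀ ν₀) (h₁ : IsPoissonLaw Q₁ ν₁)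
    (hν₀ : ∀ B, Bornology.IsBounded B → ν₀ B ≠ ⊤) (hν₁ : ∀ B, Bornology.IsBounded B → ν₁ B ≠ ⊤)
    (hac : ∀ B, ν₀ B = 0 → ν₁ B = 0) {K : ℝ}
    (hK : ∀ (m : ℕ) (a : Fin m → Set (E d)),
      (∀ j, MeasurableSet (a j) ∧ Bornology.IsBounded (a j)) →
      Pairwise (fun i j => Disjoint (a i) (a j)) →
      ∑ j, ((ν₁ (a j)).toReal - (ν₀ (a j)).toReal) ^ 2 / (ν₀ (a j)).toReal ≤ K)
    {A : Set (PointConfig d)} (hA : MeasurableSet A) :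
    Q₁ A ^ 2 ≤ ENNReal.ofReal (Real.exp K) * Q₀ A := by
  classical
  have := h₀.prob
  have := h₁.prob
  have halg : ∀ A ∈ countEvents d, Q₁ A ^ 2 ≤ ENNReal.ofReal (Real.exp K) * Q₀ A := by
    rintro A ⟨𝓑, h𝓑, hA⟩
    obtain ⟨m, a, ha, hdis, hatoms⟩ := exists_atoms 𝓑 h𝓑
    let Φ : PointConfig d → Fin m → ENNReal := fun ξ j => ξ.count (a j)
    have hΦ : Measurable Φ := measurable_pi_lambda _ fun j => measurable_count (ha j).1
    have hle : countsSigma 𝓑 ≤ MeasurableSpace.comap Φ inferInstance := by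
      refine iSup₂_le fun B hB => ?_
      obtain ⟨J, rfl⟩ := hatoms B hB
      have hsum : (fun ξ : PointConfig d => ξ.count (⋃ j ∈ J, a j)) =
          (fun y : Fin m → ENNReal => ∑ j ∈ J, y j) ∘ Φ := by
        funext ξ
        exact measure_biUnion_finset (fun i _ j _ hij => hdis hij) fun j _ => (ha j).1
      rw [hsum, ← MeasurableSpace.comap_comp]
      exact MeasurableSpace.comap_mono (Measurable.comap_le (by fun_prop))
    obtain ⟨D, hD, rfl⟩ := hle A hA
    have hfin₀ := fun j => hν₀ _ (ha j).2
    have hfin₁ := fun j => hν₁ _ (ha j).2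
    -- On disjoint atoms the counts are independent Poisson variables under both laws, so the
    -- constants multiply to the exponential of the sum bounded by `K`.
    have hdom := L2Dominated.pi fun j => L2Dominated.map (l2Dominated_poisson
      (r₀ := (ν₀ (a j)).toNNReal) (r₁ := (ν₁ (a j)).toNNReal) fun h => by
        rw [hac _ (((ENNReal.toNNReal_eq_zero_iff _).1 h).resolve_right (hfin₀ j))]
        simp) (measurable_of_countable (fun k : ℕ => (k : ENNReal)))
    have hD' := hdom (D.indicator 1) (measurable_one.indicator hD)
    rw [← h₁.map_counts (fun j => (ha j).1) hfin₁ hdis,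
      ← h₀.map_counts (fun j => (ha j).1) hfin₀ hdis, lintegral_indicator_one hD] at hD'
    have hsq : (fun y => (D.indicator (1 : (Fin m → ENNReal) → ENNReal) y) ^ 2) = D.indicator 1 := by
      funext y
      by_cases hy : y ∈ D <;> simp [hy]
    rw [hsq, lintegral_indicator_one hD, Measure.map_apply hΦ hD, Measure.map_apply hΦ hD] at hD'
    refine hD'.trans ?_
    gcongr
    rw [← ENNReal.ofReal_prod_of_nonneg fun _ _ => (Real.exp_pos _).le, ← Real.exp_sum]
    exact ENNReal.ofReal_le_ofReal (Real.exp_le_exp.2 (hK m a ha hdis))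
  -- Using the sum of the two laws yields one approximating event that is good for both of them.
  have hdense : (Q₀ + Q₁).MeasureDense (countEvents d) :=
    Measure.MeasureDense.of_generateFrom_isSetAlgebra_finite _ isSetAlgebra_countEvents
      generateFrom_countEvents
  have key : ∀ ε : ℝ, 0 < ε → Q₁.real A ≤ √(Real.exp K * (Q₀.real A + ε)) + ε := by
    intro ε hε
    obtain ⟨t, ht, htA⟩ := hdense.approx A hA (measure_ne_top _ _) ε hε
    have hreal : (Q₁.real t) ^ 2 ≤ Real.exp K * Q₀.real t := by
      have := ENNReal.toReal_mono (ENNReal.mul_ne_top ENNReal.ofReal_ne_top (measure_ne_top _ _))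
        (halg t ht)
      rwa [ENNReal.toReal_pow, ENNReal.toReal_mul, ENNReal.toReal_ofReal (Real.exp_pos K).le] at this
    have hd : ∀ Q : Measure (PointConfig d), Q ≤ Q₀ + Q₁ → IsProbabilityMeasure Q →
        Q.real (symmDiff A t) ≤ ε := fun Q hQ _ =>
      ENNReal.toReal_le_of_le_ofReal hε.le ((hQ _).trans htA.le)
    have hd₀ := hd Q₀ (Measure.le_add_right le_rfl) ‹_›
    have hd₁ := hd Q₁ (Measure.le_add_left le_rfl) ‹_›
    have h1 : Q₁.real A ≤ Q₁.real t + Q₁.real (symmDiff A t) :=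
      (measureReal_mono (by rw [← sdiff_subset_iff]; exact subset_union_left)).trans
        (measureReal_union_le _ _)
    have h0 : Q₀.real t ≤ Q₀.real A + Q₀.real (symmDiff A t) :=
      (measureReal_mono (by rw [← sdiff_subset_iff]; exact subset_union_right)).trans
        (measureReal_union_le _ _)
    have h2 : Q₁.real t ≤ √(Real.exp K * (Q₀.real A + ε)) := by
      refine Real.le_sqrt_of_sq_le (hreal.trans ?_)
      gcongr
      linarith
    linarith
  have hlim : Q₁.real A ≤ √(Real.exp K * Q₀.real A) := by
    have h1 : Tendsto (fun ε : ℝ => √(Real.exp K * (Q₀.real A + ε)) + ε) (𝓝[>] 0)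
        (𝓝 (√(Real.exp K * (Q₀.real A + 0)) + 0)) :=
      (Continuous.tendsto (by fun_prop) 0).mono_left nhdsWithin_le_nhds
    rw [add_zero, add_zero] at h1
    exact ge_of_tendsto h1 (eventually_nhdsWithin_of_forall fun ε hε => key ε hε)
  have hsq : Q₁.real A ^ 2 ≤ Real.exp K * Q₀.real A := by
    have := pow_le_pow_left₀ measureReal_nonneg hlim 2
    rwa [Real.sq_sqrt (by positivity)] at this
  rw [← ENNReal.ofReal_toReal (measure_ne_top Q₁ A), ← ENNReal.ofReal_toReal (measure_ne_top Q₀ A),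
    ← ENNReal.ofReal_pow ENNReal.toReal_nonneg, ← ENNReal.ofReal_mul (Real.exp_pos _).le]
  exact ENNReal.ofReal_le_ofReal hsq

lemma ofReal_mul_measure_le {α : Type*} [MeasurableSpace α] {μ : Measure α} {f : α → ℝ}
    (hf : Measurable f) {s : ℝ} :
    ENNReal.ofReal s * μ {a | s ≤ f a} ≤ ∫⁻ a, ENNReal.ofReal (f a) ∂μ := by
  refine le_trans ?_ (mul_meas_ge_le_lintegral hf.ennreal_ofReal (ENNReal.ofReal s))
  gcongr
  exact ENNReal.ofReal_le_ofReal

/-- Le Cam's two point bound. -/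
lemma le_lintegral_of_sq_measure_le {α : Type*} [MeasurableSpace α] {p q : Measure α}
    [IsProbabilityMeasure q] {C : ℝ} (hC : 1 ≤ C)
    (h : ∀ A, MeasurableSet A → q A ^ 2 ≤ ENNReal.ofReal C * p A)
    {S : α → ℝ} (hS : Measurable S) {t₀ t₁ ε : ℝ} (hε : 0 < ε) (ht : 16 * C * ε ≤ (t₁ - t₀) ^ 2)
    (hp : ∫⁻ a, ENNReal.ofReal ((S a - t₀) ^ 2) ∂p < ENNReal.ofReal ε) :
    ENNReal.ofReal ε ≤ ∫⁻ a, ENNReal.ofReal ((S a - t₁) ^ 2) ∂q := by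
  by_contra hq
  rw [not_le] at hq
  have hm₀ : Measurable fun a => (S a - t₀) ^ 2 := (hS.sub_const _).pow_const 2
  have hm₁ : Measurable fun a => (S a - t₁) ^ 2 := (hS.sub_const _).pow_const 2
  have hbound : ∀ (r : Measure α) (f : α → ℝ), Measurable f →
      ∫⁻ a, ENNReal.ofReal (f a) ∂r < ENNReal.ofReal ε →
      r {a | 4 * C * ε ≤ f a} < ENNReal.ofReal (1 / (4 * C)) := by
    intro r f hf hr
    have h1 := (ofReal_mul_measure_le hf (s := 4 * C * ε)).trans_lt hr
    have h2 : ENNReal.ofReal ε = ENNReal.ofReal (4 * C * ε) * ENNReal.ofReal (1 / (4 * C)) := by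
      rw [← ENNReal.ofReal_mul (by positivity)]
      congr 1
      field_simp
    rw [h2] at h1
    exact lt_of_mul_lt_mul_left' h1
  have h0 := hbound p _ hm₀ hp
  have h1 := hbound q _ hm₁ hq
  -- On `A` the estimate is close to `t₁`, hence far from `t₀` by the separation. If both risks were
  -- below `ε`, Markov's inequality would give `q A ≥ 3/4` and `p A < 1/(4 C)`, so that `9/16 ≤
  -- 1/4`.
  let A : Set α := {a | 4 * C * ε ≤ (S a - t₁) ^ 2}ᶜ
  have hA : MeasurableSet A := (measurableSet_le measurable_const hm₁).compl
  have hA0 : p A < ENNReal.ofReal (1 / (4 * C)) := by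
    refine (measure_mono fun a ha => ?_).trans_lt h0
    simp only [A, mem_compl_iff, mem_ofPred_eq, not_le] at ha ⊢
    by_contra hlt
    rw [not_le] at hlt
    nlinarith [sq_nonneg ((S a - t₁) + (S a - t₀))]
  have hA1 : ENNReal.ofReal (3 / 4) ≤ q A := by
    have h2 : q A = 1 - q {a | 4 * C * ε ≤ (S a - t₁) ^ 2} :=
      prob_compl_eq_one_sub (measurableSet_le measurable_const hm₁)
    rw [h2]
    have h3 : q {a | 4 * C * ε ≤ (S a - t₁) ^ 2} ≤ ENNReal.ofReal (1 / 4) :=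
      h1.le.trans (ENNReal.ofReal_le_ofReal (by
        rw [div_le_div_iff₀ (by positivity) (by positivity)]; linarith))
    refine le_trans (le_of_eq ?_) (tsub_le_tsub_left h3 1)
    rw [← ENNReal.ofReal_one, ← ENNReal.ofReal_sub _ (by norm_num)]
    norm_num
  have h4 := h A hA
  have h5 : ENNReal.ofReal (9 / 16) ≤ ENNReal.ofReal (1 / 4) := by
    calc ENNReal.ofReal (9 / 16) = ENNReal.ofReal (3 / 4) ^ 2 := by
          rw [← ENNReal.ofReal_pow (by norm_num)]; norm_num
      _ ≤ q A ^ 2 := by gcongr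
      _ ≤ ENNReal.ofReal C * p A := h4
      _ ≤ ENNReal.ofReal C * ENNReal.ofReal (1 / (4 * C)) := by gcongr
      _ = ENNReal.ofReal (1 / 4) := by
          rw [← ENNReal.ofReal_mul (by positivity)]
          congr 1
          field_simp
  rw [ENNReal.ofReal_le_ofReal_iff (by norm_num)] at h5
  norm_num at h5

end

/-! ### The minimax lower bound -/

section

variable {d : ℕ}

lemma exists_bump (d : ℕ) : ∃ (f : E d → ℝ) (G : E d → E d) (B : ℝ), 0 < B ∧ Continuous f ∧
    (∀ u, 0 ≤ f u ∧ f u ≤ 1) ∧ f 0 = 1 ∧ (∀ u, 2 < ‖u‖ → f u = 0) ∧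
    (∀ u, HasGradientAt f (G u) u) ∧ (∀ u, ‖G u‖ ≤ B) ∧
    ∀ u v, ‖G u - G v‖ ≤ B * ‖u - v‖ := by
  let f : ContDiffBump (0 : E d) := ⟨1, 2, one_pos, one_lt_two⟩
  have hf : ContDiff ℝ 2 f := f.contDiff
  have hdf : ContDiff ℝ 1 (fderiv ℝ f) := hf.fderiv_right (by norm_num)
  have hcs : HasCompactSupport (fderiv ℝ f) := f.hasCompactSupport.fderiv ℝ
  obtain ⟨C, hC⟩ := hdf.lipschitzWith_of_hasCompactSupport hcs one_ne_zero
  obtain ⟨B, hB⟩ := hcs.exists_bound_of_continuous hdf.continuous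
  refine ⟨f, gradient f, max 1 (max B C), by positivity, f.continuous,
    fun u => ⟨f.nonneg, f.le_one⟩, f.one_of_mem_closedBall (by simp [f]), fun u hu => ?_,
    fun u => ?_, fun u => ?_, fun u v => ?_⟩
  · exact f.zero_of_le_dist (by simpa using hu.le)
  · exact ((hf.differentiable (by norm_num)) u).hasGradientAt
  · rw [gradient, LinearIsometryEquiv.norm_map]
    exact (hB u).trans ((le_max_left _ _).trans (le_max_right _ _))
  · rw [gradient, gradient, ← map_sub, LinearIsometryEquiv.norm_map, ← dist_eq_norm,
      ← dist_eq_norm]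
    refine (hC.dist_le_mul u v).trans ?_
    gcongr
    exact (le_max_right _ _).trans (le_max_right _ _)

lemma isC1Holder_const (S : Set (E d)) (β : ℝ) {L : ℝ} (hL : 0 ≤ L) (c : ℝ) :
    IsC1Holder S β L (fun _ => c) :=
  ⟨fun _ => 0, fun u _ => hasGradientWithinAt_const u S c, fun _ _ => by simpa using hL,
    fun u _ v _ => by simp only [sub_self, norm_zero]; positivity⟩

/-- The gradient of the scaled bump has size `κ δ^(β-1)` and varies on the scale `δ`, so its Hölder
constant of order `β - 1` does not depend on `δ`. -/
lemma isC1Holder_bump (S : Set (E d)) {β : ℝ} (hβ1 : 1 < β) (hβ2 : β ≤ 2) {f : E d → ℝ}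
    {G : E d → E d} {B : ℝ} (hB : 0 < B) (hf : ∀ u, HasGradientAt f (G u) u)
    (hG : ∀ u, ‖G u‖ ≤ B) (hGL : ∀ u v, ‖G u - G v‖ ≤ B * ‖u - v‖)
    {L κ δ : ℝ} (hκ : 0 ≤ κ) (hκL : κ * (2 * B) ≤ L) (hδ : 0 < δ) (hδ1 : δ ≤ 1) (c : ℝ) (x : E d) :
    IsC1Holder S β L (fun u => c + κ * δ ^ β * f (δ⁻¹ • (u - x))) := by
  have hpow : δ ^ β * δ⁻¹ = δ ^ (β - 1) := by rw [Real.rpow_sub_one hδ.ne']; rfl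
  -- A bounded Lipschitz gradient is Hölder: at distances below one `t ≤ t^(β-1)`, which uses `β ≤
  -- 2`, and beyond one the bound on the norm suffices.
  have hHol : ∀ u v, ‖G u - G v‖ ≤ 2 * B * ‖u - v‖ ^ (β - 1) := fun u v => by
    rcases le_total ‖u - v‖ 1 with h | h
    · rcases eq_or_lt_of_le (norm_nonneg (u - v)) with h0 | h0
      · have := hGL u v
        rw [← h0, mul_zero] at this
        exact this.trans (by positivity)
      · have h1 : ‖u - v‖ ≤ ‖u - v‖ ^ (β - 1) := by
          conv_lhs => rw [← Real.rpow_one ‖u - v‖]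
          exact Real.rpow_le_rpow_of_exponent_ge h0 h (by linarith)
        have := hGL u v
        nlinarith [norm_nonneg (u - v)]
    · have h1 : 1 ≤ ‖u - v‖ ^ (β - 1) := Real.one_le_rpow h (by linarith)
      have := norm_sub_le (G u) (G v)
      nlinarith [hG u, hG v]
  refine ⟨fun u => (κ * δ ^ (β - 1)) • G (δ⁻¹ • (u - x)), fun u _ => ?_, fun u _ => ?_,
    fun u _ v _ => ?_⟩
  · have h1 : HasFDerivAt (fun u : E d => δ⁻¹ • (u - x)) (δ⁻¹ • ContinuousLinearMap.id ℝ (E d)) u :=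
      ((hasFDerivAt_id u).sub_const x).const_smul δ⁻¹
    have h2 := ((hf (δ⁻¹ • (u - x))).hasFDerivAt.comp u h1).const_mul (κ * δ ^ β)
    have h3 := h2.const_add c
    rw [hasGradientWithinAt_iff_hasFDerivWithinAt]
    refine (h3.congr_fderiv ?_).hasFDerivWithinAt
    ext w
    simp only [← hpow, smul_apply, ContinuousLinearMap.comp_apply,
      ContinuousLinearMap.id_apply, InnerProductSpace.toDual_apply_apply, smul_eq_mul, map_smul]
    ring
  · rw [norm_smul, Real.norm_of_nonneg (by positivity)]
    have h1 : δ ^ (β - 1) ≤ 1 := Real.rpow_le_one hδ.le hδ1 (by linarith)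
    have h2 := hG (δ⁻¹ • (u - x))
    calc κ * δ ^ (β - 1) * ‖G (δ⁻¹ • (u - x))‖ ≤ κ * 1 * B := by gcongr
      _ ≤ L := by nlinarith
  · rw [← smul_sub, norm_smul, Real.norm_of_nonneg (by positivity)]
    have h1 := hHol (δ⁻¹ • (u - x)) (δ⁻¹ • (v - x))
    rw [← smul_sub, sub_sub_sub_cancel_right, norm_smul, Real.norm_of_nonneg (by positivity),
      Real.mul_rpow (by positivity) (norm_nonneg _), Real.inv_rpow hδ.le] at h1
    have h2 : 0 < δ ^ (β - 1) := by positivity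
    calc κ * δ ^ (β - 1) * ‖G (δ⁻¹ • (u - x)) - G (δ⁻¹ • (v - x))‖
        ≤ κ * δ ^ (β - 1) * (2 * B * ((δ ^ (β - 1))⁻¹ * ‖u - v‖ ^ (β - 1))) := by gcongr
      _ = κ * (2 * B) * ‖u - v‖ ^ (β - 1) := by field_simp
      _ ≤ L * ‖u - v‖ ^ (β - 1) := by gcongr

/-- The intensity measure with density `a f` on the window `W`. -/
noncomputable def windowIntensity (W : Set (E d)) (a : ℝ) (f : E d → ℝ) : Measure (E d) :=
  (volume.restrict W).withDensity (fun u => ENNReal.ofReal (a * f u))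

lemma windowIntensity_ne_top (W : Set (E d)) {a R : ℝ} (f : E d → ℝ) (hR : ∀ u, a * f u ≤ R)
    (B : Set (E d)) (hB : Bornology.IsBounded B) : windowIntensity W a f B ≠ ⊤ := by
  obtain ⟨r, hr⟩ := hB.subset_closedBall 0
  refine ((measure_mono hr).trans_lt ?_).ne
  rw [windowIntensity, withDensity_apply _ Metric.isClosed_closedBall.measurableSet]
  refine (lintegral_mono fun u => ENNReal.ofReal_le_ofReal (hR u)).trans_lt ?_
  rw [setLIntegral_const]
  exact ENNReal.mul_lt_top ENNReal.ofReal_lt_top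
    ((Measure.restrict_apply_le _ _).trans_lt Metric.isBounded_closedBall.measure_lt_top)

lemma windowIntensity_const (W : Set (E d)) (a c : ℝ) :
    windowIntensity W a (fun _ => c) = ENNReal.ofReal (a * c) • volume.restrict W :=
  withDensity_const _

/-- The chi-square distance of two intensities that differ on a set `B` only, by at most `η`. -/
lemma sum_sq_div_le (W : Set (E d)) {a c η : ℝ} (ha : 0 < a) (hc : 0 < c) (hη : 0 ≤ η)
    {f : E d → ℝ} {B : Set (E d)} (hBm : MeasurableSet B) (hBb : Bornology.IsBounded B)
    (hf : ∀ u, c ≤ f u) (hfB : ∀ u, f u ≤ c + B.indicator (fun _ => η) u)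
    (m : ℕ) (s : Fin m → Set (E d)) (hs : ∀ j, MeasurableSet (s j) ∧ Bornology.IsBounded (s j))
    (hd : Pairwise fun i j => Disjoint (s i) (s j)) :
    ∑ j, ((windowIntensity W a f (s j)).toReal -
        (windowIntensity W a (fun _ => c) (s j)).toReal) ^ 2 /
        (windowIntensity W a (fun _ => c) (s j)).toReal ≤ a * η ^ 2 / c * (volume B).toReal := by
  set μ := (volume : Measure (E d)).restrict W with hμ
  have hμfin : ∀ t, Bornology.IsBounded t → μ t ≠ ⊤ := fun t ht =>
    ((Measure.restrict_apply_le _ _).trans_lt ht.measure_lt_top).ne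
  have hterm : ∀ j, ((windowIntensity W a f (s j)).toReal -
        (windowIntensity W a (fun _ => c) (s j)).toReal) ^ 2 /
        (windowIntensity W a (fun _ => c) (s j)).toReal ≤
      a * η ^ 2 / c * (μ (s j ∩ B)).toReal := fun j => by
    have hV := hμfin _ (hs j).2
    have hU := hμfin _ ((hs j).2.subset (inter_subset_left (t := B)))
    have h0 : windowIntensity W a (fun _ => c) (s j) = ENNReal.ofReal (a * c) * μ (s j) := by
      rw [windowIntensity_const]; rfl
    have h1 : windowIntensity W a f (s j) = ∫⁻ u in s j, ENNReal.ofReal (a * f u) ∂μ :=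
      withDensity_apply _ (hs j).1
    have h2 : ENNReal.ofReal (a * c) * μ (s j) ≤ windowIntensity W a f (s j) := by
      rw [h1, ← setLIntegral_const]
      exact lintegral_mono fun u => ENNReal.ofReal_le_ofReal (by have := hf u; gcongr)
    have h3 : windowIntensity W a f (s j) ≤
        ENNReal.ofReal (a * c) * μ (s j) + ENNReal.ofReal (a * η) * μ (s j ∩ B) := by
      rw [h1]
      calc ∫⁻ u in s j, ENNReal.ofReal (a * f u) ∂μ
          ≤ ∫⁻ u in s j, (ENNReal.ofReal (a * c) +
              B.indicator (fun _ => ENNReal.ofReal (a * η)) u) ∂μ := by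
            refine lintegral_mono fun u => ?_
            have h4 := hfB u
            by_cases hu : u ∈ B
            · simp only [hu, indicator_of_mem] at h4 ⊢
              rw [← ENNReal.ofReal_add (by positivity) (by positivity)]
              refine ENNReal.ofReal_le_ofReal ?_
              nlinarith
            · simp only [hu, not_false_eq_true, indicator_of_notMem, add_zero] at h4 ⊢
              exact ENNReal.ofReal_le_ofReal (by gcongr)
        _ = _ := by
            rw [lintegral_add_left measurable_const, setLIntegral_const,
              lintegral_indicator_const hBm, Measure.restrict_apply hBm, inter_comm B]
    have h5 : (windowIntensity W a (fun _ => c) (s j)).toReal = a * c * (μ (s j)).toReal := by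
      rw [h0, ENNReal.toReal_mul, ENNReal.toReal_ofReal (by positivity)]
    have hfin1 : ENNReal.ofReal (a * c) * μ (s j) ≠ ⊤ := ENNReal.mul_ne_top ENNReal.ofReal_ne_top hV
    have hfin2 : ENNReal.ofReal (a * η) * μ (s j ∩ B) ≠ ⊤ :=
      ENNReal.mul_ne_top ENNReal.ofReal_ne_top hU
    have h6 : (windowIntensity W a f (s j)).toReal ≤
        a * c * (μ (s j)).toReal + a * η * (μ (s j ∩ B)).toReal := by
      have := ENNReal.toReal_mono (ENNReal.add_ne_top.2 ⟨hfin1, hfin2⟩) h3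
      rwa [ENNReal.toReal_add hfin1 hfin2, ENNReal.toReal_mul, ENNReal.toReal_mul,
        ENNReal.toReal_ofReal (by positivity), ENNReal.toReal_ofReal (by positivity)] at this
    have h7 : a * c * (μ (s j)).toReal ≤ (windowIntensity W a f (s j)).toReal := by
      have := ENNReal.toReal_mono (h3.trans_lt (ENNReal.add_lt_top.2
        ⟨hfin1.lt_top, hfin2.lt_top⟩)).ne h2
      rwa [ENNReal.toReal_mul, ENNReal.toReal_ofReal (by positivity)] at this
    have h8 : (μ (s j ∩ B)).toReal ≤ (μ (s j)).toReal :=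
      ENNReal.toReal_mono hV (measure_mono inter_subset_left)
    rw [h5]
    set V := (μ (s j)).toReal
    set U := (μ (s j ∩ B)).toReal
    set r := (windowIntensity W a f (s j)).toReal
    have hU0 : 0 ≤ U := ENNReal.toReal_nonneg
    rcases eq_or_lt_of_le (hU0.trans h8) with hV0 | hV0
    · rw [← hV0]
      simp only [mul_zero, div_zero]
      positivity
    -- The difference is at most `a η U`, and one factor `U ≤ V` cancels the denominator; the
    -- remaining `U` is additive over the disjoint sets.
    · rw [div_le_iff₀ (by positivity)]
      calc (r - a * c * V) ^ 2 ≤ (a * η * U) ^ 2 := by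
            refine pow_le_pow_left₀ (by linarith) (by linarith) 2
        _ = a ^ 2 * η ^ 2 * U * U := by ring
        _ ≤ a ^ 2 * η ^ 2 * U * V := by gcongr
        _ = _ := by field_simp
  refine (Finset.sum_le_sum fun j _ => hterm j).trans ?_
  rw [← Finset.mul_sum]
  gcongr
  rw [← ENNReal.toReal_sum fun j _ => hμfin _ ((hs j).2.subset inter_subset_left)]
  refine ENNReal.toReal_mono hBb.measure_lt_top.ne ?_
  rw [← measure_biUnion_finset (fun i _ j _ hij => (hd hij).mono inter_subset_left inter_subset_left)
    fun j _ => (hs j).1.inter hBm]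
  exact (measure_mono (iUnion₂_subset fun j _ => inter_subset_right)).trans
    (Measure.restrict_apply_le _ _)

theorem minimax_lower_bound {β : ℝ} (hβ1 : 1 < β) (hβ2 : β ≤ 2) (W : ℕ → Set (E d))
    (a : ℕ → ℝ) (ha : ∀ n, 0 < a n) (x : E d) (hat : Tendsto a atTop atTop) {L : ℝ} (hL : 0 < L) :
    ∃ c : ℝ, 0 < c ∧ ∀ᶠ n in atTop, ∀ S : PointConfig d → ℝ, Measurable S →
      ∃ f : E d → ℝ, Measurable f ∧ (∀ u, 0 ≤ f u ∧ f u ≤ L) ∧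
        IsC1Holder (⋃ n, W n) β L f ∧
        ∀ Q : Measure (PointConfig d),
          IsPoissonLaw Q ((volume.restrict (W n)).withDensity
            (fun u => ENNReal.ofReal (a n * f u))) →
          ENNReal.ofReal (c * a n ^ (-(2 * β) / (d + 2 * β))) ≤
            ∫⁻ ξ, ENNReal.ofReal ((S ξ - f x) ^ 2) ∂Q := by
  obtain ⟨f, G, B, hB, hfc, hf01, hf0, hfsupp, hfG, hGB, hGL⟩ := exists_bump d
  -- The first bound keeps the perturbed function below `L`, the second keeps its gradient and
  -- Hölder constants below `L`.
  set κ := min (L / 2) (L / (2 * B)) with hκdef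
  have hκ : 0 < κ := by positivity
  have hκ1 : κ ≤ L / 2 := min_le_left _ _
  have hκ2 : κ * (2 * B) ≤ L := (le_div_iff₀ (by positivity)).1 (min_le_right _ _)
  set V := (volume (Metric.closedBall (0 : E d) 2)).toReal
  set C := Real.exp (κ ^ 2 / (L / 2) * V)
  have hC : 1 ≤ C := Real.one_le_exp (by positivity)
  have hCpos : 0 < C := Real.exp_pos _
  -- This makes `16 C ε` equal to the squared separation `(κ δ^β)²` of the two hypotheses at `x`.
  refine ⟨κ ^ 2 / (16 * C), by positivity, ?_⟩
  filter_upwards [hat.eventually_ge_atTop 1] with n hn S hS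
  have hpos : (0 : ℝ) < d + 2 * β := by positivity
  set δ := a n ^ (-1 / (d + 2 * β)) with hδdef
  have hδ : 0 < δ := Real.rpow_pos_of_pos (ha n) _
  have hδ1 : δ ≤ 1 := Real.rpow_le_one_of_one_le_of_nonpos hn
    (div_nonpos_of_nonpos_of_nonneg (by norm_num) hpos.le)
  have hδ2 : a n ^ (-(2 * β) / (d + 2 * β)) = (δ ^ β) ^ 2 := by
    rw [hδdef, ← Real.rpow_natCast, ← Real.rpow_mul (ha n).le, ← Real.rpow_mul (ha n).le]
    congr 1
    push_cast
    field_simp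
  -- The choice of `δ` balances the squared height against the expected number of points in the
  -- bump, so the chi-square exponent is free of `n`.
  have hδ3 : a n * (δ ^ β) ^ 2 * δ ^ d = 1 := by
    rw [← hδ2, hδdef, ← Real.rpow_natCast, ← Real.rpow_mul (ha n).le]
    rw [mul_assoc, ← Real.rpow_add (ha n)]
    nth_rewrite 1 [← Real.rpow_one (a n)]
    rw [← Real.rpow_add (ha n)]
    rw [show 1 + (-(2 * β) / (d + 2 * β) + -1 / (d + 2 * β) * d) = 0 by field_simp; ring,
      Real.rpow_zero]
  let f₁ : E d → ℝ := fun u => L / 2 + κ * δ ^ β * f (δ⁻¹ • (u - x))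
  have hδβ : δ ^ β ≤ 1 := Real.rpow_le_one hδ.le hδ1 (by linarith)
  have hf₁ : ∀ u, L / 2 ≤ f₁ u ∧ f₁ u ≤ L := fun u => by
    have h1 := hf01 (δ⁻¹ • (u - x))
    have h2 : κ * δ ^ β ≤ L / 2 := by nlinarith
    have h3 : 0 ≤ κ * δ ^ β := by positivity
    constructor <;> simp only [f₁] <;> nlinarith
  have hf₁m : Measurable f₁ := Continuous.measurable (by simp only [f₁]; fun_prop)
  -- Either the constant `L / 2` is already a bad case for `S`, or the negation supplies a Poisson
  -- law `Q₀` under which `S` is accurate, and then `S` must fail at the bump.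
  by_cases h0 : ∀ Q : Measure (PointConfig d), IsPoissonLaw Q (windowIntensity (W n) (a n) fun _ => L / 2) →
      ENNReal.ofReal (κ ^ 2 / (16 * C) * a n ^ (-(2 * β) / (d + 2 * β))) ≤
        ∫⁻ ξ, ENNReal.ofReal ((S ξ - L / 2) ^ 2) ∂Q
  · exact ⟨fun _ => L / 2, measurable_const, fun _ => ⟨by positivity, by linarith⟩,
      isC1Holder_const _ _ hL.le _, h0⟩
  push Not at h0
  obtain ⟨Q₀, hQ₀, hlt⟩ := h0
  refine ⟨f₁, hf₁m, fun u => ⟨(by positivity : (0 : ℝ) ≤ L / 2).trans (hf₁ u).1, (hf₁ u).2⟩,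
    isC1Holder_bump _ hβ1 hβ2 hB hfG hGB hGL hκ.le hκ2 hδ hδ1 _ _, fun Q₁ hQ₁ => ?_⟩
  have hprob := hQ₁.prob
  have hac : windowIntensity (W n) (a n) f₁ ≪ windowIntensity (W n) (a n) fun _ => L / 2 := by
    refine (withDensity_absolutelyContinuous _ _).trans ?_
    rw [windowIntensity_const]
    refine Measure.absolutelyContinuous_smul ?_
    have := ha n
    simp only [ne_eq, ENNReal.ofReal_eq_zero, not_le]
    positivity
  have hKle := sum_sq_div_le (W n) (ha n) (half_pos hL) (η := κ * δ ^ β) (by positivity)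
    (f := f₁) (B := Metric.closedBall x (2 * δ)) Metric.isClosed_closedBall.measurableSet
    Metric.isBounded_closedBall (fun u => (hf₁ u).1) fun u => by
      by_cases hu : u ∈ Metric.closedBall x (2 * δ)
      · rw [indicator_of_mem hu]
        have := (hf01 (δ⁻¹ • (u - x))).2
        have h3 : 0 ≤ κ * δ ^ β := by positivity
        simp only [f₁]
        nlinarith
      · rw [indicator_of_notMem hu]
        have : f (δ⁻¹ • (u - x)) = 0 := by
          refine hfsupp _ ?_
          rw [norm_smul, Real.norm_of_nonneg (by positivity), ← div_eq_inv_mul, lt_div_iff₀ hδ]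
          simpa [dist_eq_norm] using hu
        simp [f₁, this]
  have hvol : (volume (Metric.closedBall x (2 * δ))).toReal = δ ^ d * V := by
    have h1 := Measure.addHaar_closedBall_mul (volume : Measure (E d)) x hδ.le
      (zero_le_two : (0 : ℝ) ≤ 2)
    rw [mul_comm 2 δ, h1, ENNReal.toReal_mul, ENNReal.toReal_ofReal (by positivity)]
    simp [V]
  have hKeq : a n * (κ * δ ^ β) ^ 2 / (L / 2) * (volume (Metric.closedBall x (2 * δ))).toReal =
      κ ^ 2 / (L / 2) * V := by
    rw [hvol]
    calc _ = (a n * (δ ^ β) ^ 2 * δ ^ d) * (κ ^ 2 / (L / 2) * V) := by ring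
      _ = _ := by rw [hδ3, one_mul]
  rw [hKeq] at hKle
  have hdom := fun A (hA : MeasurableSet A) => hQ₀.sq_measure_le hQ₁
    (windowIntensity_ne_top _ _ fun u => le_rfl)
    (windowIntensity_ne_top _ _ (R := a n * L) fun u => by have := ha n; gcongr; exact (hf₁ u).2)
    (fun B hB => hac hB) hKle hA
  rw [hδ2] at hlt ⊢
  refine le_lintegral_of_sq_measure_le hC hdom hS (t₀ := L / 2) (t₁ := f₁ x) (by positivity) ?_ hlt
  have : f₁ x - L / 2 = κ * δ ^ β := by simp [f₁, hf0]
  rw [this]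
  refine le_of_eq ?_
  field_simp

end

/-! ### The bias of the tree estimator -/

section

variable {d : ℕ}

lemma exists_taylor_bounds {S : Set (E d)} {β L Λ r : ℝ} {lam : E d → ℝ} {x : E d} (hβ : 1 < β)
    (hr : 0 < r) (hS : Metric.closedBall x r ⊆ S) (hlam : IsC1Holder S β L lam)
    (h0 : ∀ u, 0 ≤ lam u) (hΛ : ∀ u, lam u ≤ Λ) :
    ∃ (G : E d) (C₁ C₂ : ℝ), 0 < C₁ ∧ 0 < C₂ ∧ HasGradientAt lam G x ∧
      (∀ u, |lam u - lam x| ≤ C₁ * ‖u - x‖) ∧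
      ∀ u, ‖u - x‖ ≤ r → |lam u - lam x - inner ℝ G (u - x)| ≤ C₂ * ‖u - x‖ ^ β := by
  obtain ⟨G, hG, hGL, hGH⟩ := hlam
  have hxS : x ∈ S := hS (Metric.mem_closedBall_self hr.le)
  have hL : 0 ≤ L := (norm_nonneg _).trans (hGL x hxS)
  have hgrad : HasGradientAt lam (G x) x := by
    rw [hasGradientAt_iff_hasFDerivAt]
    exact (hG x hxS).hasFDerivWithinAt.hasFDerivAt
      (mem_of_superset (Metric.closedBall_mem_nhds x hr) hS)
  have htaylor : ∀ u, ‖u - x‖ ≤ r →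
      |lam u - lam x - inner ℝ (G x) (u - x)| ≤ L * ‖u - x‖ ^ β := fun u hu => by
    rcases eq_or_lt_of_le (norm_nonneg (u - x)) with hux | hux
    · have : u = x := by rw [← sub_eq_zero, ← norm_eq_zero, ← hux]
      rw [this]
      simp only [sub_self, inner_zero_right, abs_zero, norm_zero]
      positivity
    have hsub : Metric.closedBall x ‖u - x‖ ⊆ S := (Metric.closedBall_subset_closedBall hu).trans hS
    have h1 := (convex_closedBall x ‖u - x‖).norm_image_sub_le_of_norm_hasFDerivWithin_le'
      (f := lam) (f' := fun y => InnerProductSpace.toDual ℝ (E d) (G y))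
      (φ := InnerProductSpace.toDual ℝ (E d) (G x)) (C := L * ‖u - x‖ ^ (β - 1))
      (fun y hy => (hG y (hsub hy)).hasFDerivWithinAt.mono hsub) (fun y hy => ?_)
      (Metric.mem_closedBall_self (norm_nonneg _))
      (show u ∈ Metric.closedBall x ‖u - x‖ by rw [Metric.mem_closedBall, dist_eq_norm])
    · rw [Real.norm_eq_abs, InnerProductSpace.toDual_apply_apply] at h1
      refine h1.trans_eq ?_
      rw [mul_assoc, ← Real.rpow_add_one hux.ne', sub_add_cancel]
    · rw [← map_sub, LinearIsometryEquiv.norm_map]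
      refine (hGH y (hsub hy) x hxS).trans ?_
      gcongr
      rw [← dist_eq_norm]
      exact hy
  -- The linear bound must hold on the whole space, as large cells occur: within distance `r` it
  -- follows from the Taylor expansion, beyond it from boundedness, since `Λ ≤ (Λ / r) ‖u - x‖`.
  refine ⟨G x, (L + L * r ^ (β - 1)) + Λ / r + 1, L + 1, ?_, by positivity, hgrad, fun u => ?_,
    fun u hu => (htaylor u hu).trans ?_⟩
  · have : 0 ≤ Λ := (h0 x).trans (hΛ x)
    positivity
  · have hΛ0 : 0 ≤ Λ := (h0 x).trans (hΛ x)
    have hn := norm_nonneg (u - x)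
    rcases le_total ‖u - x‖ r with hu | hu
    · have h1 := htaylor u hu
      have h2 : |inner ℝ (G x) (u - x)| ≤ L * ‖u - x‖ :=
        (abs_real_inner_le_norm _ _).trans (by gcongr; exact hGL x hxS)
      have h3 : ‖u - x‖ ^ β ≤ r ^ (β - 1) * ‖u - x‖ := by
        rcases eq_or_lt_of_le hn with h | h
        · rw [← h, Real.zero_rpow (by linarith), mul_zero]
        · calc ‖u - x‖ ^ β = ‖u - x‖ ^ (β - 1) * ‖u - x‖ := by
                rw [← Real.rpow_add_one h.ne', sub_add_cancel]
            _ ≤ _ := by gcongr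
      have h4 : |lam u - lam x| ≤
          |lam u - lam x - inner ℝ (G x) (u - x)| + |inner ℝ (G x) (u - x)| := by
        have := abs_add_le (lam u - lam x - inner ℝ (G x) (u - x)) (inner ℝ (G x) (u - x))
        simpa using this
      have h5 : L * ‖u - x‖ ^ β ≤ L * (r ^ (β - 1) * ‖u - x‖) := by gcongr
      have h6 : 0 ≤ Λ / r * ‖u - x‖ := by positivity
      nlinarith
    · have h1 : |lam u - lam x| ≤ Λ :=
        abs_sub_le_iff.2 ⟨by linarith [hΛ u, h0 x], by linarith [hΛ x, h0 u]⟩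
      have h2 : Λ ≤ Λ / r * ‖u - x‖ := by
        calc Λ = Λ / r * r := by field_simp
          _ ≤ _ := by gcongr
      have h3 : 0 ≤ (L + L * r ^ (β - 1) + 1) * ‖u - x‖ := by positivity
      nlinarith
  · gcongr
    linarith

/-- The bias of the tree estimator with cell `C`. -/
noncomputable def treeBias (W : Set (E d)) (x : E d) (lam : E d → ℝ)
    (C : NonemptyCompacts (E d)) : ℝ :=
  (∫ u in (C : Set (E d)) ∩ W, lam u) / (volume ((C : Set (E d)) ∩ W)).toReal - lam x

lemma measurable_treeBias {W : Set (E d)} (hW : MeasurableSet W) (x : E d) {lam : E d → ℝ}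
    (hlam : Measurable lam) : Measurable (treeBias W x lam) :=
  ((measurable_setIntegral hlam hW).div (measurable_measure_inter volume hW).ennreal_toReal).sub_const
    _

lemma volume_inter_window_pos {W : Set (E d)} {x : E d} {r : ℝ} (hr : 0 < r)
    (hW : Metric.closedBall x r ⊆ W) {C : NonemptyCompacts (E d)}
    (hC : x ∈ interior (C : Set (E d))) : 0 < volume ((C : Set (E d)) ∩ W) :=
  Measure.measure_pos_of_mem_nhds _ (inter_mem (mem_interior_iff_mem_nhds.1 hC)
    (mem_of_superset (Metric.closedBall_mem_nhds x hr) hW))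

lemma isBounded_inter_window (C : NonemptyCompacts (E d)) (W : Set (E d)) :
    Bornology.IsBounded ((C : Set (E d)) ∩ W) :=
  C.isCompact.isBounded.subset inter_subset_left

lemma integrableOn_of_bounded {lam : E d → ℝ} (hm : Measurable lam) {Λ : ℝ}
    (h0 : ∀ u, 0 ≤ lam u) (hΛ : ∀ u, lam u ≤ Λ) {A : Set (E d)} (hA : Bornology.IsBounded A) :
    IntegrableOn lam A := by
  refine Measure.integrableOn_of_bounded (M := Λ) hA.measure_lt_top.ne hm.aestronglyMeasurable ?_
  exact ae_of_all _ fun u => by rw [Real.norm_of_nonneg (h0 u)]; exact hΛ u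

/-- The average over a set of a function bounded by `c` is bounded by `c`. -/
lemma abs_setIntegral_div_le {A : Set (E d)} (hb : Bornology.IsBounded A)
    (hpos : 0 < volume A) {f : E d → ℝ} {c : ℝ} (hf : ∀ u ∈ A, |f u| ≤ c) :
    |(∫ u in A, f u) / (volume A).toReal| ≤ c := by
  have h0 : 0 < (volume A).toReal := ENNReal.toReal_pos hpos.ne' hb.measure_lt_top.ne
  rw [abs_div, abs_of_pos h0, div_le_iff₀ h0]
  exact norm_setIntegral_le_of_norm_le_const (f := f) hb.measure_lt_top hf

lemma setIntegral_sub_const_div {A : Set (E d)} (hb : Bornology.IsBounded A)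
    (hpos : 0 < volume A) {f : E d → ℝ} (hf : IntegrableOn f A) (c : ℝ) :
    (∫ u in A, (f u - c)) / (volume A).toReal = (∫ u in A, f u) / (volume A).toReal - c := by
  have h0 : 0 < (volume A).toReal := ENNReal.toReal_pos hpos.ne' hb.measure_lt_top.ne
  have hc : IntegrableOn (fun _ : E d => c) A := integrableOn_const hb.measure_lt_top.ne
  rw [integral_sub hf hc, setIntegral_const, Measure.real, smul_eq_mul]
  field_simp

lemma norm_centroid_sub_le {x : E d} {C : NonemptyCompacts (E d)}
    (hC : x ∈ interior (C : Set (E d))) : ‖centroid C - x‖ ≤ Metric.diam (C : Set (E d)) := by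
  have hpos : 0 < volume (C : Set (E d)) :=
    Measure.measure_pos_of_mem_nhds _ (mem_interior_iff_mem_nhds.1 hC)
  have h0 : 0 < (volume (C : Set (E d))).toReal :=
    ENNReal.toReal_pos hpos.ne' (volume_coe_ne_top C)
  have hc : IntegrableOn (fun _ : E d => x) C := integrableOn_const (volume_coe_ne_top C)
  have h1 : centroid C - x = (volume (C : Set (E d))).toReal⁻¹ • ∫ u in (C : Set (E d)), (u - x) := by
    rw [integral_sub (integrableOn_id C) hc, setIntegral_const, smul_sub, Measure.real, smul_smul,
      inv_mul_cancel₀ h0.ne', one_smul, centroid_eq]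
  rw [h1, norm_smul, norm_inv, Real.norm_of_nonneg h0.le, ← div_eq_inv_mul, div_le_iff₀ h0]
  refine norm_setIntegral_le_of_norm_le_const (volume_coe_ne_top C).lt_top fun u hu => ?_
  rw [← dist_eq_norm]
  exact Metric.dist_le_diam_of_mem C.isCompact.isBounded hu (interior_subset hC)

section Bounds

variable {W : Set (E d)} {x G : E d} {lam : E d → ℝ} {Λ r C₁ C₂ β : ℝ} {C : NonemptyCompacts (E d)}

lemma abs_treeBias_le (hr : 0 < r) (hWr : Metric.closedBall x r ⊆ W)
    (hm : Measurable lam) (h0 : ∀ u, 0 ≤ lam u) (hΛ : ∀ u, lam u ≤ Λ)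
    (hC₁ : 0 < C₁) (h1 : ∀ u, |lam u - lam x| ≤ C₁ * ‖u - x‖)
    (hC : x ∈ interior (C : Set (E d))) :
    |treeBias W x lam C| ≤ C₁ * Metric.diam (C : Set (E d)) := by
  have hb := isBounded_inter_window C W
  have hpos := volume_inter_window_pos hr hWr hC
  rw [treeBias, ← setIntegral_sub_const_div hb hpos (integrableOn_of_bounded hm h0 hΛ hb)]
  refine abs_setIntegral_div_le hb hpos fun u hu => ?_
  refine (h1 u).trans ?_
  gcongr
  rw [← dist_eq_norm]
  exact Metric.dist_le_diam_of_mem C.isCompact.isBounded hu.1 (interior_subset hC)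

lemma inter_window_eq (hWr : Metric.closedBall x r ⊆ W) (hC : x ∈ interior (C : Set (E d)))
    (hd : Metric.diam (C : Set (E d)) ≤ r) : (C : Set (E d)) ∩ W = C := by
  refine inter_eq_left.2 fun u hu => hWr ?_
  exact (Metric.dist_le_diam_of_mem C.isCompact.isBounded hu (interior_subset hC)).trans hd

/-- A small cell is not cut by the window, so the linear part of the intensity averages to its value
at the centroid, and only the Taylor remainder is left. -/
lemma abs_treeBias_sub_le_of_diam_le (hr : 0 < r)
    (hWr : Metric.closedBall x r ⊆ W) (hm : Measurable lam) (h0 : ∀ u, 0 ≤ lam u)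
    (hΛ : ∀ u, lam u ≤ Λ) (hC₂ : 0 < C₂) (hβ : 1 < β)
    (h2 : ∀ u, ‖u - x‖ ≤ r → |lam u - lam x - inner ℝ G (u - x)| ≤ C₂ * ‖u - x‖ ^ β)
    (hC : x ∈ interior (C : Set (E d))) (hd : Metric.diam (C : Set (E d)) ≤ r) :
    |treeBias W x lam C - inner ℝ G (centroid C - x)| ≤ C₂ * Metric.diam (C : Set (E d)) ^ β := by
  have hb := C.isCompact.isBounded
  have hpos := volume_inter_window_pos hr hWr hC
  have hA := inter_window_eq hWr hC hd
  rw [treeBias]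
  rw [hA] at hpos ⊢
  have hi := integrableOn_of_bounded hm h0 hΛ hb
  have hi1 : IntegrableOn (fun u => lam u - lam x) C :=
    hi.sub (integrableOn_const (volume_coe_ne_top C))
  have hc : IntegrableOn (fun _ : E d => x) C := integrableOn_const (volume_coe_ne_top C)
  have hi2 : IntegrableOn (fun u : E d => u - x) C := (integrableOn_id C).sub hc
  have h3 : (0 : ℝ) < (volume (C : Set (E d))).toReal :=
    ENNReal.toReal_pos hpos.ne' (volume_coe_ne_top C)
  have h4 : (∫ u in (C : Set (E d)), inner ℝ G (u - x)) / (volume (C : Set (E d))).toReal =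
      inner ℝ G (centroid C - x) := by
    rw [integral_inner hi2, integral_sub (integrableOn_id C) hc, setIntegral_const, Measure.real,
      centroid_eq, inner_sub_right, inner_sub_right, inner_smul_right, inner_smul_right]
    field_simp
  have h5 : (∫ u in (C : Set (E d)), lam u) / (volume (C : Set (E d))).toReal - lam x -
      inner ℝ G (centroid C - x) =
      (∫ u in (C : Set (E d)), (lam u - lam x - inner ℝ G (u - x))) /
        (volume (C : Set (E d))).toReal := by
    rw [integral_sub hi1 (hi2.const_inner G), sub_div, h4, setIntegral_sub_const_div hb hpos hi]
  rw [h5]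
  refine abs_setIntegral_div_le hb hpos fun u hu => ?_
  have h6 : ‖u - x‖ ≤ Metric.diam (C : Set (E d)) := by
    rw [← dist_eq_norm]
    exact Metric.dist_le_diam_of_mem hb hu (interior_subset hC)
  refine (h2 u (h6.trans hd)).trans ?_
  gcongr

/-- Cells of diameter above `r`, possibly truncated by the window, satisfy only a linear bound; for
them the diameter is at most its power `β` divided by `r^(β-1)`. -/
lemma abs_treeBias_sub_le (hr : 0 < r)
    (hWr : Metric.closedBall x r ⊆ W) (hm : Measurable lam) (h0 : ∀ u, 0 ≤ lam u)
    (hΛ : ∀ u, lam u ≤ Λ) (hC₁ : 0 < C₁) (hC₂ : 0 < C₂) (hβ : 1 < β)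
    (h1 : ∀ u, |lam u - lam x| ≤ C₁ * ‖u - x‖)
    (h2 : ∀ u, ‖u - x‖ ≤ r → |lam u - lam x - inner ℝ G (u - x)| ≤ C₂ * ‖u - x‖ ^ β)
    (hC : x ∈ interior (C : Set (E d))) :
    |treeBias W x lam C - inner ℝ G (centroid C - x)| ≤
      (C₂ + (C₁ + ‖G‖) / r ^ (β - 1)) * Metric.diam (C : Set (E d)) ^ β := by
  have hpow : 0 ≤ Metric.diam (C : Set (E d)) ^ β := by positivity
  rcases le_total (Metric.diam (C : Set (E d))) r with hd | hd
  · refine (abs_treeBias_sub_le_of_diam_le hr hWr hm h0 hΛ hC₂ hβ h2 hC hd).trans ?_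
    gcongr
    have : 0 ≤ (C₁ + ‖G‖) / r ^ (β - 1) := by positivity
    linarith
  · have h3 := abs_treeBias_le hr hWr hm h0 hΛ hC₁ h1 hC
    have h4 : |inner ℝ G (centroid C - x)| ≤ ‖G‖ * Metric.diam (C : Set (E d)) :=
      (abs_real_inner_le_norm _ _).trans (by gcongr; exact norm_centroid_sub_le hC)
    have hd0 : 0 < Metric.diam (C : Set (E d)) := hr.trans_le hd
    have h5 : Metric.diam (C : Set (E d)) ≤ Metric.diam (C : Set (E d)) ^ β / r ^ (β - 1) := by
      rw [le_div_iff₀ (by positivity)]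
      calc _ ≤ Metric.diam (C : Set (E d)) * Metric.diam (C : Set (E d)) ^ (β - 1) := by
            gcongr
        _ = _ := by rw [mul_comm, ← Real.rpow_add_one hd0.ne', sub_add_cancel]
    calc |treeBias W x lam C - inner ℝ G (centroid C - x)|
        ≤ |treeBias W x lam C| + |inner ℝ G (centroid C - x)| := abs_sub _ _
      _ ≤ (C₁ + ‖G‖) * Metric.diam (C : Set (E d)) := by linarith
      _ ≤ (C₁ + ‖G‖) * (Metric.diam (C : Set (E d)) ^ β / r ^ (β - 1)) := by gcongr
      _ ≤ _ := by
        have : 0 ≤ C₂ * Metric.diam (C : Set (E d)) ^ β := by positivity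
        rw [add_mul]
        have h6 : (C₁ + ‖G‖) * (Metric.diam (C : Set (E d)) ^ β / r ^ (β - 1)) =
          (C₁ + ‖G‖) / r ^ (β - 1) * Metric.diam (C : Set (E d)) ^ β := by ring
        linarith

end Bounds

end

/-! ### Scaled cells -/

section

open scoped Pointwise

variable {d : ℕ}

/-- The cell `x + h K`. -/
noncomputable def scaledCell (x : E d) (h : ℝ) (K : NonemptyCompacts (E d)) :
    NonemptyCompacts (E d) :=
  translate x (dilate h K)

lemma measurable_scaledCell (x : E d) (h : ℝ) : Measurable (scaledCell x h) :=
  measurable_translate_dilate x h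

variable {x : E d} {h : ℝ} {K : NonemptyCompacts (E d)}

lemma coe_scaledCell : (scaledCell x h K : Set (E d)) = (fun u => h • u + x) '' K := by
  rw [scaledCell, coe_translate, coe_dilate, image_image]

lemma mem_interior_scaledCell (hh : 0 < h) (hK : 0 ∈ interior (K : Set (E d))) :
    x ∈ interior (scaledCell x h K : Set (E d)) := by
  have h1 : (scaledCell x h K : Set (E d)) =
      ((Homeomorph.smulOfNeZero h hh.ne').trans (Homeomorph.addRight x)) '' K := by
    rw [coe_scaledCell]; rfl
  rw [h1, ← Homeomorph.image_interior]
  exact ⟨0, hK, by simp⟩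

lemma diam_scaledCell (hh : 0 < h) :
    Metric.diam (scaledCell x h K : Set (E d)) = h * Metric.diam (K : Set (E d)) := by
  have h1 : (scaledCell x h K : Set (E d)) = (fun u => u + x) '' (h • (K : Set (E d))) := by
    rw [coe_scaledCell, ← image_smul, image_image]
  have h2 : Isometry fun u : E d => u + x := (IsometryEquiv.addRight x).isometry
  rw [h1, h2.diam_image, diam_smul₀, Real.norm_of_nonneg hh.le]

lemma volume_image_affine (hh : 0 < h) (x : E d) (B : Set (E d)) :
    volume ((fun u => h • u + x) '' B) = ENNReal.ofReal (h ^ d) * volume B := by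
  have h1 : (fun u => h • u + x) '' B = (fun u => u + x) '' (h • B) := by
    rw [← image_smul, image_image]
  rw [h1, image_add_right, measure_preimage_add_right, Measure.addHaar_smul]
  simp [abs_of_pos hh]

lemma centroid_dilate (hh : 0 < h) : centroid (dilate h K) = h • centroid K := by
  have h1 : (dilate h K : Set (E d)) = h • (K : Set (E d)) := by rw [coe_dilate, image_smul]
  have h2 := Measure.setIntegral_comp_smul_of_pos (volume : Measure (E d)) (fun u : E d => u)
    (K : Set (E d)) hh
  have h3 : volume (h • (K : Set (E d))) = ENNReal.ofReal (h ^ d) * volume (K : Set (E d)) := by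
    rw [Measure.addHaar_smul]
    simp [abs_of_pos hh]
  have hd : Module.finrank ℝ (E d) = d := by simp
  rw [hd] at h2
  have h4 : ∫ u in h • (K : Set (E d)), u = (h ^ d) • h • ∫ u in (K : Set (E d)), u := by
    rw [← integral_smul, h2, smul_smul, mul_inv_cancel₀ (by positivity), one_smul]
  rw [centroid_eq, centroid_eq, h1, h3, h4, ENNReal.toReal_mul,
    ENNReal.toReal_ofReal (by positivity), mul_inv, smul_smul, smul_smul, smul_smul]
  congr 1
  field_simp

lemma volume_pos_of_mem_interior (hK : x ∈ interior (K : Set (E d))) :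
    0 < volume (K : Set (E d)) :=
  Measure.measure_pos_of_mem_nhds _ (mem_interior_iff_mem_nhds.1 hK)

lemma centroid_scaledCell_sub (hh : 0 < h) (hK : 0 ∈ interior (K : Set (E d))) :
    centroid (scaledCell x h K) - x = h • centroid K := by
  have hpos : 0 < volume (dilate h K : Set (E d)) := by
    rw [coe_dilate]
    have := volume_image_affine hh 0 (K : Set (E d))
    simp only [add_zero] at this
    rw [this]
    exact ENNReal.mul_pos (by simp; positivity) (volume_pos_of_mem_interior hK).ne'
  rw [scaledCell, centroid_translate _ hpos, add_sub_cancel_right, centroid_dilate hh]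

/-- The affine image of `K ∩ B(0, ρ)` stays inside the ball around `x` contained in the window,
which bounds the truncated volume from below. -/
lemma inv_volume_scaledCell_le {W : Set (E d)} {r ρ : ℝ} (hh : 0 < h)
    (hW : Metric.closedBall x r ⊆ W) (hρ : h * ρ ≤ r) :
    (volume ((scaledCell x h K : Set (E d)) ∩ W))⁻¹ ≤
      ENNReal.ofReal (1 / h ^ d) * (volume ((K : Set (E d)) ∩ Metric.closedBall 0 ρ))⁻¹ := by
  have h1 : (fun u => h • u + x) '' ((K : Set (E d)) ∩ Metric.closedBall 0 ρ) ⊆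
      (scaledCell x h K : Set (E d)) ∩ W := by
    rintro _ ⟨u, ⟨hu, hur⟩, rfl⟩
    refine ⟨by rw [coe_scaledCell]; exact ⟨u, hu, rfl⟩, hW ?_⟩
    simp only [Metric.mem_closedBall, dist_zero_right] at hur
    rw [Metric.mem_closedBall, dist_eq_norm, add_sub_cancel_right, norm_smul,
      Real.norm_of_nonneg hh.le]
    exact (mul_le_mul_of_nonneg_left hur hh.le).trans hρ
  have h2 := measure_mono (μ := volume) h1
  rw [volume_image_affine hh] at h2
  refine (ENNReal.inv_le_inv.2 h2).trans_eq ?_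
  have h3 : ENNReal.ofReal (h ^ d) ≠ 0 := by simp; positivity
  rw [ENNReal.mul_inv (Or.inl h3) (Or.inl ENNReal.ofReal_ne_top),
    ← ENNReal.ofReal_inv_of_pos (by positivity), one_div]

end

/-! ### Averages of independent variables -/

section

variable {Ω : Type*} [MeasurableSpace Ω] {P : Measure Ω}

lemma lintegral_of_indepFun [IsProbabilityMeasure P] {α α' : Type*} [MeasurableSpace α] [MeasurableSpace α'] {X : Ω → α}
    {Y : Ω → α'} (h : IndepFun X Y P) (hX : Measurable X) (hY : Measurable Y)
    {F : α × α' → ENNReal} (hF : Measurable F) :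
    ∫⁻ ω, F (X ω, Y ω) ∂P = ∫⁻ ω', ∫⁻ ω, F (X ω, Y ω') ∂P ∂P := by
  have h1 := (indepFun_iff_map_prod_eq_prod_map_map hX.aemeasurable hY.aemeasurable).1 h
  have : IsProbabilityMeasure (P.map X) := Measure.isProbabilityMeasure_map hX.aemeasurable
  have : IsProbabilityMeasure (P.map Y) := Measure.isProbabilityMeasure_map hY.aemeasurable
  rw [← lintegral_map (f := F) hF (hX.prodMk hY), h1, lintegral_prod_symm' _ hF,
    lintegral_map hF.lintegral_prod_left' hY]
  refine lintegral_congr fun ω' => ?_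
  have h2 : Measurable fun x => F (x, Y ω') := hF.comp measurable_prodMk_right
  rw [lintegral_map h2 hX]

lemma memLp_two_of_lintegral_sq_le {Y : Ω → ℝ} (hY : Measurable Y) {s : ℝ}
    (hs : ∫⁻ ω, ENNReal.ofReal (Y ω ^ 2) ∂P ≤ ENNReal.ofReal s) : MemLp Y 2 P := by
  rw [memLp_two_iff_integrable_sq hY.aestronglyMeasurable]
  refine ⟨(hY.pow_const 2).aestronglyMeasurable, ?_⟩
  rw [hasFiniteIntegral_iff_ofReal (ae_of_all _ fun ω => sq_nonneg _)]
  exact hs.trans_lt ENNReal.ofReal_lt_top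

/-- The second moment is variance plus squared mean; independence divides only the variance by `M`.
-/
lemma lintegral_mean_sq_le [IsProbabilityMeasure P] {Y : ℕ → Ω → ℝ} (hY : ∀ i, Measurable (Y i)) (hind : iIndepFun Y P)
    {s m : ℝ} (hs0 : 0 ≤ s) (hs : ∀ i, ∫⁻ ω, ENNReal.ofReal (Y i ω ^ 2) ∂P ≤ ENNReal.ofReal s)
    (hm : ∀ i, |∫ ω, Y i ω ∂P| ≤ m) {M : ℕ} (hM : 1 ≤ M) :
    ∫⁻ ω, ENNReal.ofReal (((1 / (M : ℝ)) * ∑ i ∈ Finset.range M, Y i ω) ^ 2) ∂P ≤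
      ENNReal.ofReal (s / M + m ^ 2) := by
  have hMpos : (0 : ℝ) < M := by exact_mod_cast hM
  have hL2 : ∀ i, MemLp (Y i) 2 P := fun i => memLp_two_of_lintegral_sq_le (hY i) (hs i)
  have hvar : ∀ i, Var[Y i; P] ≤ s := fun i => by
    refine (variance_le_expectation_sq (hY i).aestronglyMeasurable).trans ?_
    simp only [Pi.pow_apply]
    rw [integral_eq_lintegral_of_nonneg_ae (ae_of_all _ fun ω => sq_nonneg _)
      ((hY i).pow_const 2).aestronglyMeasurable]
    exact ENNReal.toReal_le_of_le_ofReal hs0 (hs i)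
  have hsum : MemLp (∑ i ∈ Finset.range M, Y i) 2 P := memLp_finsetSum' _ fun i _ => hL2 i
  have hvsum : Var[∑ i ∈ Finset.range M, Y i; P] ≤ M * s := by
    rw [IndepFun.variance_sum (fun i _ => hL2 i) fun i _ j _ hij => hind.indepFun hij]
    refine (Finset.sum_le_sum fun i _ => hvar i).trans ?_
    simp
  have hmean : |∫ ω, (∑ i ∈ Finset.range M, Y i) ω ∂P| ≤ M * m := by
    simp only [Finset.sum_apply]
    rw [integral_finsetSum _ fun i _ => (hL2 i).integrable one_le_two]
    refine (Finset.abs_sum_le_sum_abs _ _).trans ((Finset.sum_le_sum fun i _ => hm i).trans ?_)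
    simp
  have hsq : ∫ ω, ((∑ i ∈ Finset.range M, Y i) ω) ^ 2 ∂P ≤ M * s + (M * m) ^ 2 := by
    have h1 := variance_eq_sub hsum
    simp only [Pi.pow_apply] at h1
    have h2 : (∫ ω, (∑ i ∈ Finset.range M, Y i) ω ∂P) ^ 2 ≤ (M * m) ^ 2 :=
      sq_le_sq' (abs_le.1 hmean).1 (abs_le.1 hmean).2
    linarith
  have hint : Integrable (fun ω => ((1 / (M : ℝ)) * ∑ i ∈ Finset.range M, Y i ω) ^ 2) P := by
    have := (hsum.integrable_sq).const_mul ((1 / (M : ℝ)) ^ 2)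
    simpa only [mul_pow, Finset.sum_apply] using this
  rw [← ofReal_integral_eq_lintegral_ofReal hint (ae_of_all _ fun ω => sq_nonneg _)]
  refine ENNReal.ofReal_le_ofReal ?_
  simp only [mul_pow]
  rw [integral_const_mul]
  simp only [Finset.sum_apply] at hsq
  calc (1 / (M : ℝ)) ^ 2 * ∫ ω, (∑ i ∈ Finset.range M, Y i ω) ^ 2 ∂P
      ≤ (1 / (M : ℝ)) ^ 2 * (M * s + (M * m) ^ 2) := by gcongr
    _ = _ := by field_simp

end

/-! ### The fluctuations of the tree estimator -/

section

variable {d : ℕ}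

/-- The set in which points are counted varies with the cell, so joint measurability needs sections
of an s-finite kernel. -/
lemma measurable_count_inter {W : Set (E d)} (hW : MeasurableSet W) :
    Measurable fun p : PointConfig d × NonemptyCompacts (E d) =>
      p.1.count ((p.2 : Set (E d)) ∩ W) := by
  have ht : MeasurableSet {q : (PointConfig d × NonemptyCompacts (E d)) × E d |
      q.2 ∈ q.1.2 ∧ q.2 ∈ W} :=
    ((measurable_snd.prodMk (measurable_snd.comp measurable_fst)) measurableSet_setOf_mem).inter
      (measurable_snd hW)
  let κ : Kernel (PointConfig d × NonemptyCompacts (E d)) (E d) :=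
    (pointKernel d).comap Prod.fst measurable_fst
  have h1 : (fun p : PointConfig d × NonemptyCompacts (E d) => p.1.count ((p.2 : Set (E d)) ∩ W)) =
      fun p => κ p (Prod.mk p ⁻¹' {q : (PointConfig d × NonemptyCompacts (E d)) × E d |
        q.2 ∈ q.1.2 ∧ q.2 ∈ W}) := by
    funext p
    rw [Kernel.comap_apply, pointKernel_apply]
    rfl
  rw [h1]
  exact Kernel.measurable_kernel_prodMk_left ht

/-- The difference between the tree estimator with cell `C` and its expectation. -/
noncomputable def treeDeviation (a : ℝ) (W : Set (E d)) (lam : E d → ℝ) (ξ : PointConfig d)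
    (C : NonemptyCompacts (E d)) : ℝ :=
  (ξ.count ((C : Set (E d)) ∩ W)).toReal / (a * (volume ((C : Set (E d)) ∩ W)).toReal) -
    (∫ u in (C : Set (E d)) ∩ W, lam u) / (volume ((C : Set (E d)) ∩ W)).toReal

lemma measurable_treeDeviation (a : ℝ) {W : Set (E d)} (hW : MeasurableSet W) {lam : E d → ℝ}
    (hlam : Measurable lam) :
    Measurable fun p : PointConfig d × NonemptyCompacts (E d) =>
      treeDeviation a W lam p.1 p.2 := by
  have h1 := (measurable_count_inter hW).ennreal_toReal
  have h2 := (measurable_measure_inter (volume : Measure (E d)) hW).ennreal_toReal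
  have h3 := measurable_setIntegral hlam hW
  exact (h1.div ((h2.comp measurable_snd).const_mul a)).sub
    ((h3.comp measurable_snd).div (h2.comp measurable_snd))

lemma toReal_lintegral_intensity {lam : E d → ℝ} (hlam : Measurable lam) (h0 : ∀ u, 0 ≤ lam u)
    {a : ℝ} (ha : 0 < a) (A : Set (E d)) :
    (∫⁻ u in A, ENNReal.ofReal (a * lam u)).toReal = a * ∫ u in A, lam u := by
  rw [← integral_const_mul, integral_eq_lintegral_of_nonneg_ae
    (ae_of_all _ fun u => mul_nonneg ha.le (h0 u)) (hlam.const_mul a).aestronglyMeasurable]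

variable {Ω : Type*} [MeasurableSpace Ω] {P : Measure Ω} [IsProbabilityMeasure P]
  {W : Set (E d)} {x : E d} {lam : E d → ℝ} {Λ r c a : ℝ} {X : Ω → PointConfig d}
  {g : E d × E d → ℝ} {C : NonemptyCompacts (E d)}

/-- The variance of the count is at most of order `a |A|`, by boundedness of the intensity and the
condition on `g`; it is divided by `(a |A|)²`. -/
lemma lintegral_treeDeviation_sq_le (hW : MeasurableSet W) (hr : 0 < r)
    (hWr : Metric.closedBall x r ⊆ W) (hm : Measurable lam) (h0 : ∀ u, 0 ≤ lam u)
    (hΛ : ∀ u, lam u ≤ Λ) (ha : 0 < a) (hc : 0 < c) (hX : Measurable X)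
    (hX1 : HasIntensity P X (fun u => a * lam u))
    (hX2 : HasPairCorrelation P X (fun u => a * lam u) g)
    (hg : ∀ A ⊆ W, MeasurableSet A →
      ENNReal.ofReal a * ∫⁻ p in A ×ˢ A, ENNReal.ofReal |g p - 1| ≤ ENNReal.ofReal c * volume A)
    (hC : x ∈ interior (C : Set (E d))) :
    ∫⁻ ω, ENNReal.ofReal (treeDeviation a W lam (X ω) C ^ 2) ∂P ≤
      ENNReal.ofReal ((Λ + Λ ^ 2 * c) / a) * (volume ((C : Set (E d)) ∩ W))⁻¹ := by
  have hb := isBounded_inter_window C W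
  have hpos := volume_inter_window_pos hr hWr hC
  have hA := (measurableSet_coe C).inter hW
  have hfin := hb.measure_lt_top (μ := (volume : Measure (E d))) |>.ne
  simp only [treeDeviation]
  set A := (C : Set (E d)) ∩ W with hAdef
  have hgA := hg A inter_subset_right hA
  have hvol : volume A = ENNReal.ofReal (volume A).toReal := (ENNReal.ofReal_toReal hfin).symm
  set v := (volume A).toReal with hv
  have hv0 : 0 < v := ENNReal.toReal_pos hpos.ne' hfin
  have hΛ0 : 0 ≤ Λ := (h0 x).trans (hΛ x)
  have hV := lintegral_count_sub_sq_le hX (R := a * Λ)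
    (fun u => mul_le_mul_of_nonneg_left (hΛ u) ha.le) (hm.const_mul a)
    (fun u => mul_nonneg ha.le (h0 u)) hX1 hX2 hA hb
  rw [toReal_lintegral_intensity hm h0 ha] at hV
  have h1 : ∫⁻ u in A, ENNReal.ofReal (a * lam u) ≤ ENNReal.ofReal (a * Λ * v) := by
    calc ∫⁻ u in A, ENNReal.ofReal (a * lam u) ≤ ∫⁻ u in A, ENNReal.ofReal (a * Λ) :=
          lintegral_mono fun u => ENNReal.ofReal_le_ofReal
            (mul_le_mul_of_nonneg_left (hΛ u) ha.le)
      _ = ENNReal.ofReal (a * Λ * v) := by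
          rw [setLIntegral_const, hvol, ← ENNReal.ofReal_mul (by positivity)]
  have h2 : ENNReal.ofReal ((a * Λ) ^ 2) * ∫⁻ p in A ×ˢ A, ENNReal.ofReal |g p - 1| ≤
      ENNReal.ofReal (a * Λ ^ 2 * (c * v)) := by
    rw [hvol, ← ENNReal.ofReal_mul hc.le] at hgA
    calc _ = ENNReal.ofReal (a * Λ ^ 2) *
          (ENNReal.ofReal a * ∫⁻ p in A ×ˢ A, ENNReal.ofReal |g p - 1|) := by
          rw [← mul_assoc, ← ENNReal.ofReal_mul (by positivity)]
          congr 2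
          ring
      _ ≤ ENNReal.ofReal (a * Λ ^ 2) * ENNReal.ofReal (c * v) := by gcongr
      _ = _ := by rw [← ENNReal.ofReal_mul (by positivity)]
  have h3 : ∀ ω, ENNReal.ofReal ((((X ω).count A).toReal / (a * v) - (∫ u in A, lam u) / v) ^ 2) =
      ENNReal.ofReal (1 / (a * v) ^ 2) *
        ENNReal.ofReal ((((X ω).count A).toReal - a * ∫ u in A, lam u) ^ 2) := fun ω => by
    rw [← ENNReal.ofReal_mul (by positivity)]
    congr 1
    field_simp
  simp only [h3]
  have hmeas : Measurable fun ω =>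
      ENNReal.ofReal ((((X ω).count A).toReal - a * ∫ u in A, lam u) ^ 2) :=
    (((((measurable_count hA).comp hX).ennreal_toReal).sub_const _).pow_const 2).ennreal_ofReal
  rw [lintegral_const_mul _ hmeas]
  calc _ ≤ ENNReal.ofReal (1 / (a * v) ^ 2) *
        (ENNReal.ofReal (a * Λ * v) + ENNReal.ofReal (a * Λ ^ 2 * (c * v))) := by
        gcongr
        exact hV.trans (add_le_add h1 h2)
    _ = ENNReal.ofReal ((Λ + Λ ^ 2 * c) / a) * (volume A)⁻¹ := by
        rw [hvol, ← ENNReal.ofReal_add (by positivity) (by positivity),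
          ← ENNReal.ofReal_mul (by positivity), ← ENNReal.ofReal_inv_of_pos hv0,
          ← ENNReal.ofReal_mul (by positivity)]
        congr 1
        field_simp

lemma treeDeviation_add_treeBias (a : ℝ) (W : Set (E d)) (x : E d) (lam : E d → ℝ)
    (ξ : PointConfig d) (C : NonemptyCompacts (E d)) :
    treeDeviation a W lam ξ C + treeBias W x lam C =
      (ξ.count ((C : Set (E d)) ∩ W)).toReal / (a * (volume ((C : Set (E d)) ∩ W)).toReal) -
        lam x := by
  rw [treeDeviation, treeBias]; ring

/-- Without repulsion the mean squared error of a tree with a given cell is at least the one for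
a Poisson process. -/
lemma le_lintegral_tree_sq (hW : MeasurableSet W) (hr : 0 < r)
    (hWr : Metric.closedBall x r ⊆ W) (hm : Measurable lam) (h0 : ∀ u, 0 ≤ lam u)
    (hΛ : ∀ u, lam u ≤ Λ) (ha : 0 < a) (hX : Measurable X)
    (hX1 : HasIntensity P X (fun u => a * lam u))
    (hX2 : HasPairCorrelation P X (fun u => a * lam u) g)
    (hg : ∀ u ∈ W, ∀ v ∈ W, 1 ≤ g (u, v))
    (hC : x ∈ interior (C : Set (E d))) :
    ENNReal.ofReal ((∫ u in (C : Set (E d)) ∩ W, lam u) /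
        (a * (volume ((C : Set (E d)) ∩ W)).toReal ^ 2) + treeBias W x lam C ^ 2) ≤
      ∫⁻ ω, ENNReal.ofReal ((treeDeviation a W lam (X ω) C + treeBias W x lam C) ^ 2) ∂P := by
  have hb := isBounded_inter_window C W
  have hpos := volume_inter_window_pos hr hWr hC
  have hA := (measurableSet_coe C).inter hW
  have hfin := hb.measure_lt_top (μ := (volume : Measure (E d))) |>.ne
  simp only [treeDeviation_add_treeBias]
  rw [treeBias]
  set A := (C : Set (E d)) ∩ W with hAdef
  set v := (volume A).toReal with hv
  have hv0 : 0 < v := ENNReal.toReal_pos hpos.ne' hfin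
  have hV := le_lintegral_count_sub_sq hX (R := a * Λ)
    (fun u => mul_le_mul_of_nonneg_left (hΛ u) ha.le) (hm.const_mul a)
    (fun u => mul_nonneg ha.le (h0 u)) hX1 hX2 hA hb
    (fun p hp => hg p.1 hp.1.2 p.2 hp.2.2) (t := lam x * (a * v)) (mul_nonneg (h0 x) (by positivity))
  rw [toReal_lintegral_intensity hm h0 ha] at hV
  have h3 : ∀ ω, ENNReal.ofReal ((((X ω).count A).toReal / (a * v) - lam x) ^ 2) =
      ENNReal.ofReal (1 / (a * v) ^ 2) *
        ENNReal.ofReal ((((X ω).count A).toReal - lam x * (a * v)) ^ 2) := fun ω => by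
    rw [← ENNReal.ofReal_mul (by positivity)]
    congr 1
    field_simp
  simp only [h3]
  have hmeas : Measurable fun ω =>
      ENNReal.ofReal ((((X ω).count A).toReal - lam x * (a * v)) ^ 2) :=
    (((((measurable_count hA).comp hX).ennreal_toReal).sub_const _).pow_const 2).ennreal_ofReal
  rw [lintegral_const_mul _ hmeas]
  refine le_trans (le_of_eq ?_) (mul_le_mul_right hV _)
  rw [← ENNReal.ofReal_mul (by positivity)]
  congr 1
  field_simp

end

/-! ### The mean squared error for a given bandwidth -/

section

variable {d : ℕ} {Ω : Type*} [MeasurableSpace Ω] {P : Measure Ω} [IsProbabilityMeasure P]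
  {ν : Measure (NonemptyCompacts (E d))} {x : E d} {h : ℝ}

omit [IsProbabilityMeasure P] in
lemma lintegral_cell {Z : Ω → NonemptyCompacts (E d)} (hZ : Measurable Z)
    (hlaw : P.map Z = ν.map (scaledCell x h)) {F : NonemptyCompacts (E d) → ENNReal}
    (hF : Measurable F) : ∫⁻ ω, F (Z ω) ∂P = ∫⁻ K, F (scaledCell x h K) ∂ν := by
  rw [← lintegral_map hF hZ, hlaw, lintegral_map hF (measurable_scaledCell x h)]

omit [IsProbabilityMeasure P] in
lemma ae_mem_interior_cell {Z : Ω → NonemptyCompacts (E d)} (hZ : Measurable Z)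
    (hlaw : P.map Z = ν.map (scaledCell x h)) (hh : 0 < h)
    (hν0 : ∀ᵐ K : NonemptyCompacts (E d) ∂ν, 0 ∈ interior (K : Set (E d))) :
    ∀ᵐ ω ∂P, x ∈ interior (Z ω : Set (E d)) := by
  have h1 : ∀ᵐ C : NonemptyCompacts (E d) ∂(P.map Z), x ∈ interior (C : Set (E d)) := by
    rw [hlaw, ae_map_iff (measurable_scaledCell x h).aemeasurable (measurableSet_setOf_mem_interior x)]
    filter_upwards [hν0] with K hK
    exact mem_interior_scaledCell hh hK
  rwa [ae_map_iff hZ.aemeasurable (measurableSet_setOf_mem_interior x)] at h1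

variable {W : Set (E d)} {lam : E d → ℝ} {Λ r c a ρ I m₂ mβ C₁ C₂ β : ℝ} {X : Ω → PointConfig d}
  {g : E d × E d → ℝ} {G : E d}

/-- Independence freezes the cell, the bound for a fixed cell applies, and the mean inverse volume
scales like `h^(-d)`. -/
lemma lintegral_treeDeviation_cell_le (hW : MeasurableSet W) (hr : 0 < r)
    (hWr : Metric.closedBall x r ⊆ W) (hm : Measurable lam) (h0 : ∀ u, 0 ≤ lam u)
    (hΛ : ∀ u, lam u ≤ Λ) (ha : 0 < a) (hc : 0 < c) (hX : Measurable X)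
    (hX1 : HasIntensity P X (fun u => a * lam u))
    (hX2 : HasPairCorrelation P X (fun u => a * lam u) g)
    (hg : ∀ A ⊆ W, MeasurableSet A →
      ENNReal.ofReal a * ∫⁻ p in A ×ˢ A, ENNReal.ofReal |g p - 1| ≤ ENNReal.ofReal c * volume A)
    (hh : 0 < h) (hρ : h * ρ ≤ r)
    (hν0 : ∀ᵐ K : NonemptyCompacts (E d) ∂ν, 0 ∈ interior (K : Set (E d)))
    (hI : ∫⁻ K : NonemptyCompacts (E d), (volume ((K : Set (E d)) ∩ Metric.closedBall 0 ρ))⁻¹ ∂ν ≤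
      ENNReal.ofReal I)
    {Z : Ω → NonemptyCompacts (E d)} (hZ : Measurable Z)
    (hlaw : P.map Z = ν.map (scaledCell x h)) (hind : IndepFun X Z P) :
    ∫⁻ ω, ENNReal.ofReal (treeDeviation a W lam (X ω) (Z ω) ^ 2) ∂P ≤
      ENNReal.ofReal ((Λ + Λ ^ 2 * c) / a * (1 / h ^ d * I)) := by
  have hΛ0 : 0 ≤ Λ := (h0 x).trans (hΛ x)
  have hmeas : Measurable fun p : PointConfig d × NonemptyCompacts (E d) =>
      ENNReal.ofReal (treeDeviation a W lam p.1 p.2 ^ 2) :=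
    ((measurable_treeDeviation a hW hm).pow_const 2).ennreal_ofReal
  have hvm : Measurable fun C : NonemptyCompacts (E d) => (volume ((C : Set (E d)) ∩ W))⁻¹ :=
    (measurable_measure_inter volume hW).inv
  have hvmρ : Measurable fun C : NonemptyCompacts (E d) =>
      (volume ((C : Set (E d)) ∩ Metric.closedBall 0 ρ))⁻¹ :=
    (measurable_measure_inter volume Metric.isClosed_closedBall.measurableSet).inv
  rw [lintegral_of_indepFun hind hX hZ hmeas]
  calc _ ≤ ∫⁻ ω', ENNReal.ofReal ((Λ + Λ ^ 2 * c) / a) *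
        (volume ((Z ω' : Set (E d)) ∩ W))⁻¹ ∂P := by
        refine lintegral_mono_ae ?_
        filter_upwards [ae_mem_interior_cell hZ hlaw hh hν0] with ω' hω'
        exact lintegral_treeDeviation_sq_le hW hr hWr hm h0 hΛ ha hc hX hX1 hX2 hg hω'
    _ = ENNReal.ofReal ((Λ + Λ ^ 2 * c) / a) *
        ∫⁻ K, (volume ((scaledCell x h K : Set (E d)) ∩ W))⁻¹ ∂ν := by
        have h1 : Measurable fun ω' => (volume ((Z ω' : Set (E d)) ∩ W))⁻¹ := hvm.comp hZ
        rw [lintegral_const_mul _ h1, lintegral_cell hZ hlaw hvm]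
    _ ≤ ENNReal.ofReal ((Λ + Λ ^ 2 * c) / a) * ∫⁻ K : NonemptyCompacts (E d),
        ENNReal.ofReal (1 / h ^ d) * (volume ((K : Set (E d)) ∩ Metric.closedBall 0 ρ))⁻¹ ∂ν := by
        gcongr with K
        exact inv_volume_scaledCell_le hh hWr hρ
    _ ≤ ENNReal.ofReal ((Λ + Λ ^ 2 * c) / a) * (ENNReal.ofReal (1 / h ^ d) * ENNReal.ofReal I) := by
        rw [lintegral_const_mul _ hvmρ]
        gcongr
    _ = _ := by
        rw [← ENNReal.ofReal_mul (by positivity), ← ENNReal.ofReal_mul (by positivity)]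

omit [IsProbabilityMeasure P] in
lemma lintegral_treeBias_sq_le (hW : MeasurableSet W) (hr : 0 < r)
    (hWr : Metric.closedBall x r ⊆ W) (hm : Measurable lam) (h0 : ∀ u, 0 ≤ lam u)
    (hΛ : ∀ u, lam u ≤ Λ) (hC₁ : 0 < C₁) (h1 : ∀ u, |lam u - lam x| ≤ C₁ * ‖u - x‖)
    (hh : 0 < h) (hν0 : ∀ᵐ K : NonemptyCompacts (E d) ∂ν, 0 ∈ interior (K : Set (E d)))
    (hm₂ : ∫⁻ K : NonemptyCompacts (E d), ENNReal.ofReal (Metric.diam (K : Set (E d)) ^ 2) ∂ν ≤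
      ENNReal.ofReal m₂)
    {Z : Ω → NonemptyCompacts (E d)} (hZ : Measurable Z)
    (hlaw : P.map Z = ν.map (scaledCell x h)) :
    ∫⁻ ω, ENNReal.ofReal (treeBias W x lam (Z ω) ^ 2) ∂P ≤
      ENNReal.ofReal (C₁ ^ 2 * h ^ 2 * m₂) := by
  have hbm : Measurable fun C => ENNReal.ofReal (treeBias W x lam C ^ 2) :=
    ((measurable_treeBias hW x hm).pow_const 2).ennreal_ofReal
  have hdm : Measurable fun K : NonemptyCompacts (E d) =>
      ENNReal.ofReal (Metric.diam (K : Set (E d)) ^ 2) :=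
    (measurable_diam.pow_const 2).ennreal_ofReal
  rw [lintegral_cell hZ hlaw hbm]
  calc _ ≤ ∫⁻ K : NonemptyCompacts (E d), ENNReal.ofReal (C₁ ^ 2 * h ^ 2) *
        ENNReal.ofReal (Metric.diam (K : Set (E d)) ^ 2) ∂ν := by
        refine lintegral_mono_ae ?_
        filter_upwards [hν0] with K hK
        rw [← ENNReal.ofReal_mul (by positivity)]
        refine ENNReal.ofReal_le_ofReal ?_
        have h2 := abs_treeBias_le hr hWr hm h0 hΛ hC₁ h1 (mem_interior_scaledCell hh hK)
        rw [diam_scaledCell hh] at h2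
        rw [← sq_abs]
        calc _ ≤ (C₁ * (h * Metric.diam (K : Set (E d)))) ^ 2 := by gcongr
          _ = _ := by ring
    _ ≤ ENNReal.ofReal (C₁ ^ 2 * h ^ 2) * ENNReal.ofReal m₂ := by
        rw [lintegral_const_mul _ hdm]
        gcongr
    _ = _ := by rw [← ENNReal.ofReal_mul (by positivity)]

lemma integrable_diam_rpow {k m : ℝ}
    (hm : ∫⁻ K : NonemptyCompacts (E d), ENNReal.ofReal (Metric.diam (K : Set (E d)) ^ k) ∂ν ≤
      ENNReal.ofReal m) :
    Integrable (fun K : NonemptyCompacts (E d) => Metric.diam (K : Set (E d)) ^ k) ν := by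
  refine ⟨(measurable_diam.pow_const k).aestronglyMeasurable, ?_⟩
  rw [hasFiniteIntegral_iff_ofReal (ae_of_all _ fun K => Real.rpow_nonneg Metric.diam_nonneg _)]
  exact hm.trans_lt ENNReal.ofReal_lt_top

-- The linear part of the bias integrates to zero because the centroid is balanced in the direction
-- `G`; it can be subtracted before taking absolute values.
omit [IsProbabilityMeasure P] in
lemma abs_integral_treeBias_le (hW : MeasurableSet W) (hr : 0 < r)
    (hWr : Metric.closedBall x r ⊆ W) (hm : Measurable lam) (h0 : ∀ u, 0 ≤ lam u)
    (hΛ : ∀ u, lam u ≤ Λ) (hC₁ : 0 < C₁) (hC₂ : 0 < C₂) (hβ : 1 < β)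
    (h1 : ∀ u, |lam u - lam x| ≤ C₁ * ‖u - x‖)
    (h2 : ∀ u, ‖u - x‖ ≤ r → |lam u - lam x - inner ℝ G (u - x)| ≤ C₂ * ‖u - x‖ ^ β)
    (hh : 0 < h) (hν0 : ∀ᵐ K : NonemptyCompacts (E d) ∂ν, 0 ∈ interior (K : Set (E d)))
    (hcent : ∫⁻ K, ENNReal.ofReal (inner ℝ G (centroid K)) ∂ν =
      ∫⁻ K, ENNReal.ofReal (-inner ℝ G (centroid K)) ∂ν)
    {m₁ : ℝ}
    (hm₁ : ∫⁻ K : NonemptyCompacts (E d), ENNReal.ofReal (Metric.diam (K : Set (E d)) ^ (1 : ℝ)) ∂ν ≤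
      ENNReal.ofReal m₁)
    (hmβ0 : 0 ≤ mβ)
    (hmβ : ∫⁻ K : NonemptyCompacts (E d), ENNReal.ofReal (Metric.diam (K : Set (E d)) ^ β) ∂ν ≤
      ENNReal.ofReal mβ)
    {Z : Ω → NonemptyCompacts (E d)} (hZ : Measurable Z)
    (hlaw : P.map Z = ν.map (scaledCell x h)) :
    |∫ ω, treeBias W x lam (Z ω) ∂P| ≤ (C₂ + (C₁ + ‖G‖) / r ^ (β - 1)) * h ^ β * mβ := by
  have hbm := measurable_treeBias hW x hm
  have hI1 := integrable_diam_rpow hm₁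
  have hIβ := integrable_diam_rpow hmβ
  simp only [Real.rpow_one] at hI1
  have hcm : Measurable fun K : NonemptyCompacts (E d) => inner ℝ G (centroid K) :=
    measurable_const.inner measurable_centroid
  have hIG : Integrable (fun K : NonemptyCompacts (E d) => inner ℝ G (centroid K)) ν := by
    refine (hI1.const_mul ‖G‖).mono' hcm.aestronglyMeasurable ?_
    filter_upwards [hν0] with K hK
    have := norm_centroid_sub_le hK
    rw [sub_zero] at this
    exact (norm_inner_le_norm _ _).trans (by gcongr)
  have hG0 : ∫ K, inner ℝ G (centroid K) ∂ν = 0 := by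
    rw [integral_eq_lintegral_pos_part_sub_lintegral_neg_part hIG, hcent, sub_self]
  have hdiff : ∀ᵐ K : NonemptyCompacts (E d) ∂ν,
      ‖treeBias W x lam (scaledCell x h K) - h * inner ℝ G (centroid K)‖ ≤
      (C₂ + (C₁ + ‖G‖) / r ^ (β - 1)) * h ^ β * Metric.diam (K : Set (E d)) ^ β := by
    filter_upwards [hν0] with K hK
    have h3 := abs_treeBias_sub_le hr hWr hm h0 hΛ hC₁ hC₂ hβ h1 h2
      (mem_interior_scaledCell hh hK)
    rwa [centroid_scaledCell_sub hh hK, inner_smul_right, diam_scaledCell hh,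
      Real.mul_rpow hh.le Metric.diam_nonneg, ← mul_assoc] at h3
  have hbm' : Measurable fun K => treeBias W x lam (scaledCell x h K) :=
    hbm.comp (measurable_scaledCell x h)
  have hIdiff : Integrable (fun K : NonemptyCompacts (E d) =>
      treeBias W x lam (scaledCell x h K) - h * inner ℝ G (centroid K)) ν :=
    (hIβ.const_mul _).mono' (hbm'.sub (hcm.const_mul h)).aestronglyMeasurable hdiff
  have hint : ∫ ω, treeBias W x lam (Z ω) ∂P =
      ∫ K, (treeBias W x lam (scaledCell x h K) - h * inner ℝ G (centroid K)) ∂ν := by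
    have h3 : ∫ ω, treeBias W x lam (Z ω) ∂P = ∫ K, treeBias W x lam (scaledCell x h K) ∂ν := by
      rw [← integral_map hZ.aemeasurable hbm.aestronglyMeasurable, hlaw,
        integral_map (measurable_scaledCell x h).aemeasurable hbm.aestronglyMeasurable]
    have h4 : ∫ K, treeBias W x lam (scaledCell x h K) ∂ν =
        ∫ K, ((treeBias W x lam (scaledCell x h K) - h * inner ℝ G (centroid K)) +
          h * inner ℝ G (centroid K)) ∂ν := by simp
    rw [h3, h4, integral_add hIdiff (hIG.const_mul h), integral_const_mul, hG0, mul_zero, add_zero]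
  rw [hint]
  refine (norm_integral_le_of_norm_le (hIβ.const_mul _) hdiff).trans ?_
  rw [integral_const_mul]
  gcongr
  rw [integral_eq_lintegral_of_nonneg_ae (ae_of_all _ fun K => Real.rpow_nonneg Metric.diam_nonneg _)
    (measurable_diam.pow_const β).aestronglyMeasurable]
  exact ENNReal.toReal_le_of_le_ofReal hmβ0 hmβ

/-- The fluctuations share one point process, so they are averaged by Cauchy–Schwarz without gain;
the average of the biases stays inside the square, where independence is exploited. -/
lemma ofReal_sq_mean_add_le {M : ℕ} (hM : 1 ≤ M) (D b : ℕ → ℝ) :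
    ENNReal.ofReal (((1 / (M : ℝ)) * ∑ i ∈ Finset.range M, (D i + b i)) ^ 2) ≤
      ENNReal.ofReal (2 / M) * ∑ i ∈ Finset.range M, ENNReal.ofReal (D i ^ 2) +
      2 * ENNReal.ofReal (((1 / (M : ℝ)) * ∑ i ∈ Finset.range M, b i) ^ 2) := by
  have hMpos : (0 : ℝ) < M := by exact_mod_cast hM
  rw [← ENNReal.ofReal_sum_of_nonneg fun i _ => sq_nonneg _, ← ENNReal.ofReal_mul (by positivity),
    show (2 : ENNReal) = ENNReal.ofReal 2 by simp, ← ENNReal.ofReal_mul (by positivity),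
    ← ENNReal.ofReal_add (mul_nonneg (by positivity) (Finset.sum_nonneg fun i _ => sq_nonneg _))
      (by positivity)]
  refine ENNReal.ofReal_le_ofReal ?_
  rw [Finset.sum_add_distrib, mul_add]
  have h1 := sq_sum_le_card_mul_sum_sq (s := Finset.range M) (f := D)
  rw [Finset.card_range] at h1
  set SD := ∑ i ∈ Finset.range M, D i
  set Sb := ∑ i ∈ Finset.range M, b i
  set SQ := ∑ i ∈ Finset.range M, D i ^ 2
  have h2 : (1 / (M : ℝ) * SD) ^ 2 ≤ 1 / M * SQ := by
    rw [mul_pow]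
    calc (1 / (M : ℝ)) ^ 2 * SD ^ 2 ≤ (1 / (M : ℝ)) ^ 2 * (M * SQ) := by gcongr
      _ = _ := by field_simp
  have h3 : 2 / (M : ℝ) * SQ = 2 * (1 / M * SQ) := by ring
  nlinarith [sq_nonneg (1 / (M : ℝ) * SD - 1 / M * Sb)]

lemma lintegral_forest_sq_le {Y : ℕ → Ω → ℝ} {D : ℕ → Ω → ℝ} (hD : ∀ i, Measurable (D i))
    (hY : ∀ i, Measurable (Y i)) (hind : iIndepFun Y P) {s m t : ℝ} (hs0 : 0 ≤ s) (ht0 : 0 ≤ t)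
    (ht : ∀ i, ∫⁻ ω, ENNReal.ofReal (D i ω ^ 2) ∂P ≤ ENNReal.ofReal t)
    (hs : ∀ i, ∫⁻ ω, ENNReal.ofReal (Y i ω ^ 2) ∂P ≤ ENNReal.ofReal s)
    (hm : ∀ i, |∫ ω, Y i ω ∂P| ≤ m) {M : ℕ} (hM : 1 ≤ M) :
    ∫⁻ ω, ENNReal.ofReal (((1 / (M : ℝ)) * ∑ i ∈ Finset.range M, (D i ω + Y i ω)) ^ 2) ∂P ≤
      ENNReal.ofReal (2 * (t + s / M + m ^ 2)) := by
  have hMpos : (0 : ℝ) < M := by exact_mod_cast hM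
  have hDm : ∀ i, Measurable fun ω => ENNReal.ofReal (D i ω ^ 2) := fun i =>
    ((hD i).pow_const 2).ennreal_ofReal
  have hsum : Measurable fun ω => ∑ i ∈ Finset.range M, ENNReal.ofReal (D i ω ^ 2) :=
    Finset.measurable_fun_sum _ fun i _ => hDm i
  have hYm : Measurable fun ω =>
      ENNReal.ofReal (((1 / (M : ℝ)) * ∑ i ∈ Finset.range M, Y i ω) ^ 2) :=
    (((Finset.measurable_fun_sum _ fun i _ => hY i).const_mul _).pow_const 2).ennreal_ofReal
  refine (lintegral_mono fun ω => ofReal_sq_mean_add_le hM (fun i => D i ω) fun i => Y i ω).trans ?_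
  rw [lintegral_add_left (hsum.const_mul _), lintegral_const_mul _ hsum,
    lintegral_const_mul _ hYm, lintegral_finsetSum _ fun i _ => hDm i]
  calc _ ≤ ENNReal.ofReal (2 / M) * ∑ i ∈ Finset.range M, ENNReal.ofReal t +
        2 * ENNReal.ofReal (s / M + m ^ 2) := by
        gcongr with i
        · exact ht i
        · exact lintegral_mean_sq_le hY hind hs0 hs hm hM
    _ = _ := by
        rw [Finset.sum_const, Finset.card_range, nsmul_eq_mul, ← ENNReal.ofReal_natCast,
          show (2 : ENNReal) = ENNReal.ofReal 2 by simp, ← ENNReal.ofReal_mul (by positivity),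
          ← ENNReal.ofReal_mul (by positivity), ← ENNReal.ofReal_mul (by positivity),
          ← ENNReal.ofReal_add (by positivity) (by positivity)]
        congr 1
        field_simp
        ring

/-- The mean squared error of a single tree, from below. -/
lemma le_lintegral_tree_cell_sq (hW : MeasurableSet W) (hr : 0 < r)
    (hWr : Metric.closedBall x r ⊆ W) (hm : Measurable lam) (h0 : ∀ u, 0 ≤ lam u)
    (hΛ : ∀ u, lam u ≤ Λ) (ha : 0 < a) (hC₂ : 0 < C₂) (hβ : 1 < β)
    (h2 : ∀ u, ‖u - x‖ ≤ r → |lam u - lam x - inner ℝ G (u - x)| ≤ C₂ * ‖u - x‖ ^ β)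
    (hlow : ∀ u, ‖u - x‖ ≤ r → lam x / 2 ≤ lam u)
    (hX : Measurable X) (hX1 : HasIntensity P X (fun u => a * lam u))
    (hX2 : HasPairCorrelation P X (fun u => a * lam u) g)
    (hg : ∀ u ∈ W, ∀ v ∈ W, 1 ≤ g (u, v)) (hh : 0 < h)
    (hν0 : ∀ᵐ K : NonemptyCompacts (E d) ∂ν, 0 ∈ interior (K : Set (E d)))
    {R : ℝ} (hR : 0 < R) (hRr : h * R ≤ r)
    (hRh : C₂ ^ 2 * (h * R) ^ (2 * β) ≤ h ^ 2 / (4 * R))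
    {Z : Ω → NonemptyCompacts (E d)} (hZ : Measurable Z)
    (hlaw : P.map Z = ν.map (scaledCell x h)) (hind : IndepFun X Z P) :
    ENNReal.ofReal (lam x / (2 * R) * (1 / (a * h ^ d)) + 1 / (4 * R) * h ^ 2) *
      ν {K : NonemptyCompacts (E d) | Metric.diam (K : Set (E d)) ≤ R ∧
        volume (K : Set (E d)) ≤ ENNReal.ofReal R ∧ 1 / R ≤ inner ℝ G (centroid K) ^ 2} ≤
    ∫⁻ ω, ENNReal.ofReal ((treeDeviation a W lam (X ω) (Z ω) + treeBias W x lam (Z ω)) ^ 2) ∂P := by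
  set N : Set (NonemptyCompacts (E d)) := {K | Metric.diam (K : Set (E d)) ≤ R ∧
    volume (K : Set (E d)) ≤ ENNReal.ofReal R ∧ 1 / R ≤ inner ℝ G (centroid K) ^ 2}
  have hN : MeasurableSet N := by
    refine (measurable_diam measurableSet_Iic).inter ((measurable_volume measurableSet_Iic).inter ?_)
    have h3 : Measurable fun K : NonemptyCompacts (E d) => inner ℝ G (centroid K) ^ 2 :=
      (measurable_const.inner measurable_centroid).pow_const 2
    exact h3 measurableSet_Ici
  have hmeas : Measurable fun p : PointConfig d × NonemptyCompacts (E d) =>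
      ENNReal.ofReal ((treeDeviation a W lam p.1 p.2 + treeBias W x lam p.2) ^ 2) :=
    (((measurable_treeDeviation a hW hm).add
      ((measurable_treeBias hW x hm).comp measurable_snd)).pow_const 2).ennreal_ofReal
  let F : NonemptyCompacts (E d) → ENNReal := fun C =>
    ENNReal.ofReal ((∫ u in (C : Set (E d)) ∩ W, lam u) /
      (a * (volume ((C : Set (E d)) ∩ W)).toReal ^ 2) + treeBias W x lam C ^ 2)
  have hF : Measurable F :=
    (((measurable_setIntegral hm hW).div
      (((measurable_measure_inter volume hW).ennreal_toReal.pow_const 2).const_mul a)).add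
      ((measurable_treeBias hW x hm).pow_const 2)).ennreal_ofReal
  rw [lintegral_of_indepFun hind hX hZ hmeas]
  calc _ = ∫⁻ K, N.indicator (fun _ =>
        ENNReal.ofReal (lam x / (2 * R) * (1 / (a * h ^ d)) + 1 / (4 * R) * h ^ 2)) K ∂ν := by
        rw [lintegral_indicator_const hN]
    _ ≤ ∫⁻ K, F (scaledCell x h K) ∂ν := by
        refine lintegral_mono_ae ?_
        filter_upwards [hν0] with K hK
        by_cases hKN : K ∈ N
        swap
        · rw [indicator_of_notMem hKN]; exact zero_le
        rw [indicator_of_mem hKN]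
        refine ENNReal.ofReal_le_ofReal ?_
        obtain ⟨hd, hv, hGc⟩ := hKN
        have hint := mem_interior_scaledCell (x := x) hh hK
        have hdr : Metric.diam (scaledCell x h K : Set (E d)) ≤ r := by
          rw [diam_scaledCell hh]
          exact (mul_le_mul_of_nonneg_left hd hh.le).trans hRr
        have hbias := abs_treeBias_sub_le_of_diam_le hr hWr hm h0 hΛ hC₂ hβ h2 hint hdr
        rw [centroid_scaledCell_sub hh hK, inner_smul_right, diam_scaledCell hh] at hbias
        have hbias2 : |treeBias W x lam (scaledCell x h K) - h * inner ℝ G (centroid K)| ≤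
            C₂ * (h * R) ^ β := hbias.trans (by
          have : 0 ≤ h * Metric.diam (K : Set (E d)) := mul_nonneg hh.le Metric.diam_nonneg
          gcongr)
        have hpos := volume_pos_of_mem_interior hint
        have hC := inter_window_eq hWr hint hdr
        have hvol : volume (scaledCell x h K : Set (E d)) =
            ENNReal.ofReal (h ^ d) * volume (K : Set (E d)) := by
          rw [coe_scaledCell, volume_image_affine hh]
        rw [hC]
        set b := treeBias W x lam (scaledCell x h K)
        set v := (volume (scaledCell x h K : Set (E d))).toReal with hvdef
        have hv0 : 0 < v := ENNReal.toReal_pos hpos.ne' (volume_coe_ne_top _)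
        have hvR : v ≤ h ^ d * R := by
          rw [hvdef, hvol, ENNReal.toReal_mul, ENNReal.toReal_ofReal (by positivity)]
          gcongr
          exact ENNReal.toReal_le_of_le_ofReal hR.le hv
        have hlamint : lam x / 2 * v ≤ ∫ u in (scaledCell x h K : Set (E d)), lam u := by
          have h4 : ∫ u in (scaledCell x h K : Set (E d)), lam x / 2 = lam x / 2 * v := by
            rw [setIntegral_const, smul_eq_mul, mul_comm]; rfl
          rw [← h4]
          refine setIntegral_mono_on (integrableOn_const (volume_coe_ne_top _))
            (integrableOn_of_bounded hm h0 hΛ (scaledCell x h K).isCompact.isBounded)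
            (measurableSet_coe _) fun u hu => hlow u ?_
          rw [← dist_eq_norm]
          exact (Metric.dist_le_diam_of_mem (scaledCell x h K).isCompact.isBounded hu
            (interior_subset hint)).trans hdr
        have hx0 := h0 x
        have hfirst : lam x / (2 * R) * (1 / (a * h ^ d)) ≤
            (∫ u in (scaledCell x h K : Set (E d)), lam u) / (a * v ^ 2) := by
          calc lam x / (2 * R) * (1 / (a * h ^ d)) = lam x / 2 / (a * (h ^ d * R)) := by field_simp
            _ ≤ lam x / 2 / (a * v) := by gcongr
            _ = lam x / 2 * v / (a * v ^ 2) := by field_simp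
            _ ≤ _ := by gcongr
        have hsecond : 1 / (4 * R) * h ^ 2 ≤ b ^ 2 := by
          have h5 : (C₂ * (h * R) ^ β) ^ 2 ≤ h ^ 2 / (4 * R) := by
            rw [mul_pow, ← Real.rpow_natCast ((h * R) ^ β), ← Real.rpow_mul (by positivity)]
            refine le_trans (le_of_eq ?_) hRh
            congr 2
            push_cast
            ring
          set y := h * inner ℝ G (centroid K) with hy
          have h6 : h ^ 2 * (1 / R) ≤ y ^ 2 := by
            rw [hy, mul_pow]
            gcongr
          have h7 : (b - y) ^ 2 ≤ h ^ 2 / (4 * R) := by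
            rw [← sq_abs]
            exact (pow_le_pow_left₀ (abs_nonneg _) hbias2 2).trans h5
          -- Here `y` is the linear part of the bias, with `y² ≥ h² / R`; a remainder with square at
          -- most `h² / (4 R)` leaves `b² ≥ h² / (4 R)`.
          have h8 : y ^ 2 ≤ 2 * b ^ 2 + 2 * (b - y) ^ 2 := by
            nlinarith [sq_nonneg (b + (b - y))]
          have h9 : h ^ 2 / (4 * R) = h ^ 2 * (1 / R) / 4 := by field_simp
          have h10 : 1 / (4 * R) * h ^ 2 = h ^ 2 * (1 / R) / 4 := by field_simp
          rw [h9] at h7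
          rw [h10]
          linarith
        exact add_le_add hfirst hsecond
    _ = ∫⁻ ω', F (Z ω') ∂P := (lintegral_cell hZ hlaw hF).symm
    _ ≤ _ := by
        refine lintegral_mono_ae ?_
        filter_upwards [ae_mem_interior_cell hZ hlaw hh hν0] with ω' hω'
        exact le_lintegral_tree_sq hW hr hWr hm h0 hΛ ha hX hX1 hX2 hg hω'

end

/-! ### The forest in terms of the cells of `x` -/

section

variable {d : ℕ} {Ω Ω₁ : Type*} [MeasurableSpace Ω] [MeasurableSpace Ω₁] {P : Measure Ω} {P₁ : Measure Ω₁}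

lemma forestMSE_eq {γ : ℝ} (hγ : 0 < γ) {π : ℕ → Ω → Tessellation d}
    (hπ : ∀ i, IsStationaryTessellation P (π i) γ) (a : ℝ) (W : Set (E d)) (x : E d)
    (lam : E d → ℝ) (X : Ω → PointConfig d) {M : ℕ} (hM : 1 ≤ M) :
    forestMSE P a W x lam X π M = ∫⁻ ω, ENNReal.ofReal (((1 / (M : ℝ)) * ∑ i ∈ Finset.range M,
      (treeDeviation a W lam (X ω) ((π i ω).cell x) +
        treeBias W x lam ((π i ω).cell x))) ^ 2) ∂P := by
  have hM0 : (M : ℝ) ≠ 0 := by positivity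
  refine lintegral_congr_ae ?_
  filter_upwards [ae_all_iff.2 fun i => (hπ i).ae_existsUnique hγ x] with ω hω
  simp only [treeDeviation_add_treeBias, forestEstimator, treeEstimator, windowCell, (hω _).2,
    Finset.sum_sub_distrib, Finset.sum_const, Finset.card_range, nsmul_eq_mul]
  congr 2
  field_simp

/-- The zero cell inherits the moments of its diameter from the rescaled tessellation. -/
lemma lintegral_diam_rpow_ne_top (hd : 1 ≤ d) {h : ℝ} (hh : 0 < h) {T : Ω → Tessellation d}
    {T₁ : Ω₁ → Tessellation d} (hT₁ : IsStationaryTessellation P₁ T₁ 1)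
    (hT : IsStationaryTessellation P T (h ^ (-(d : ℝ)))) (hreg : IsRegularTessellation P T)
    (hs : HasScaling P T (h ^ (-(d : ℝ))) P₁ T₁) {k : ℝ} (hk : 0 ≤ k) :
    ∫⁻ K : NonemptyCompacts (E d), ENNReal.ofReal (Metric.diam (K : Set (E d)) ^ k)
      ∂(zeroCellLaw P₁ T₁) ≠ ⊤ := by
  have hm : Measurable fun K : NonemptyCompacts (E d) =>
      ENNReal.ofReal (Metric.diam (K : Set (E d)) ^ k) :=
    (measurable_diam.pow_const k).ennreal_ofReal
  have h1 : ∫⁻ ω, ENNReal.ofReal (Metric.diam ((T ω).cellAt 0) ^ k) ∂P =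
      ENNReal.ofReal (h ^ k) * ∫⁻ K : NonemptyCompacts (E d),
        ENNReal.ofReal (Metric.diam (K : Set (E d)) ^ k) ∂(zeroCellLaw P₁ T₁) := by
    rw [← lintegral_const_mul _ hm]
    calc _ = ∫⁻ ω, ENNReal.ofReal (Metric.diam ((T ω).cell 0 : Set (E d)) ^ k) ∂P := by
          refine lintegral_congr_ae ?_
          filter_upwards [hT.ae_existsUnique (by positivity) 0] with ω hω
          rw [hω.2]
      _ = ∫⁻ K, ENNReal.ofReal (Metric.diam (scaledCell 0 h K : Set (E d)) ^ k)
            ∂(zeroCellLaw P₁ T₁) :=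
          lintegral_cell ((measurable_cell 0).comp hT.measurable)
            (map_cell_eq hd hh hT₁ hT hs 0) hm
      _ = _ := by
          refine lintegral_congr fun K => ?_
          rw [diam_scaledCell hh, Real.mul_rpow hh.le Metric.diam_nonneg,
            ENNReal.ofReal_mul (by positivity)]
  have h2 := hreg k hk
  rw [h1] at h2
  intro h3
  rw [h3, ENNReal.mul_top (by simpa using by positivity)] at h2
  exact h2 rfl

lemma le_diam_of_closedBall_subset (hd : 1 ≤ d) {x : E d} {s : ℝ} (hs : 0 ≤ s) {A : Set (E d)}
    (hA : Bornology.IsBounded A) (hsA : Metric.closedBall x s ⊆ A) : s ≤ Metric.diam A := by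
  have h1 : dist (x + EuclideanSpace.single ⟨0, hd⟩ s) x = s := by
    simp [dist_eq_norm, abs_of_nonneg hs]
  refine h1.symm.le.trans (Metric.dist_le_diam_of_mem hA (hsA ?_)
    (hsA (Metric.mem_closedBall_self hs)))
  exact h1.le

/-- If the diameter of the cell of `x` tends to zero in probability, so does the bandwidth. -/
lemma tendsto_bandwidth (hd : 1 ≤ d) {ν : Measure (NonemptyCompacts (E d))} [IsProbabilityMeasure ν]
    (hν0 : ∀ᵐ K : NonemptyCompacts (E d) ∂ν, 0 ∈ interior (K : Set (E d)))
    {W : ℕ → Set (E d)} {x : E d} {r : ℝ} (hr : 0 < r) (hWr : ∀ n, Metric.closedBall x r ⊆ W n)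
    {h : ℕ → ℝ} (hh : ∀ n, 0 < h n) {Z : ℕ → Ω → NonemptyCompacts (E d)}
    (hZ : ∀ n, Measurable (Z n)) (hlaw : ∀ n, P.map (Z n) = ν.map (scaledCell x (h n)))
    (hdiam : TendstoInMeasure P (fun n ω => Metric.diam ((Z n ω : Set (E d)) ∩ W n)) atTop
      (fun _ => (0 : ℝ))) : Tendsto h atTop (𝓝 0) := by
  -- The origin is almost surely interior to the zero cell, so some fixed ball lies in it with
  -- positive probability; otherwise all radii `1 / (k + 1)` would be excluded at once.
  obtain ⟨ρ, hρ, hpos⟩ : ∃ ρ : ℝ, 0 < ρ ∧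
      ν {K : NonemptyCompacts (E d) | Metric.closedBall 0 ρ ⊆ (K : Set (E d))} ≠ 0 := by
    by_contra! hcon
    have h1 : ∀ᵐ K : NonemptyCompacts (E d) ∂ν, ∀ k : ℕ,
        ¬ Metric.closedBall 0 (1 / ((k : ℝ) + 1)) ⊆ (K : Set (E d)) := by
      refine ae_all_iff.2 fun k => ?_
      rw [ae_iff]
      simpa using hcon (1 / ((k : ℝ) + 1)) (by positivity)
    obtain ⟨K, hK1, hK0⟩ := (h1.and hν0).exists
    obtain ⟨ε, hε, hεK⟩ := Metric.mem_nhds_iff.1 (mem_interior_iff_mem_nhds.1 hK0)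
    obtain ⟨k, hk⟩ := exists_nat_one_div_lt hε
    exact hK1 k ((Metric.closedBall_subset_ball hk).trans hεK)
  rw [Metric.tendsto_atTop']
  intro ε hε
  -- If `h n ≥ ε`, then with at least that fixed probability the cell contains a ball of radius `ε
  -- ρ`, of which the part within distance `r` of `x` survives in the window.
  have hmin : 0 < min (ε * ρ) r := by positivity
  have h2 := (tendstoInMeasure_iff_dist.1 hdiam) _ hmin
  obtain ⟨N, hN⟩ := eventually_atTop.1 (h2.eventually_lt_const (pos_iff_ne_zero.2 hpos))
  refine ⟨N, fun n hn => ?_⟩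
  rw [Real.dist_eq, sub_zero, abs_of_pos (hh n)]
  by_contra! hcon
  refine (hN n hn.le).not_ge ?_
  have hms : MeasurableSet {C : NonemptyCompacts (E d) | Metric.closedBall x (h n * ρ) ⊆ C} :=
    (isClosed_setOf_closedBall_subset x (h n * ρ)).measurableSet
  calc ν {K : NonemptyCompacts (E d) | Metric.closedBall 0 ρ ⊆ (K : Set (E d))}
      ≤ ν (scaledCell x (h n) ⁻¹' {C | Metric.closedBall x (h n * ρ) ⊆ C}) := by
        refine measure_mono fun K (hK : Metric.closedBall 0 ρ ⊆ (K : Set (E d))) u hu => ?_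
        rw [coe_scaledCell]
        refine ⟨(h n)⁻¹ • (u - x), hK ?_, by simp [smul_smul, (hh n).ne']⟩
        rw [mem_closedBall_zero_iff, norm_smul, norm_inv, Real.norm_of_nonneg (hh n).le,
          inv_mul_le_iff₀ (hh n), ← dist_eq_norm]
        exact hu
    _ = P (Z n ⁻¹' {C | Metric.closedBall x (h n * ρ) ⊆ C}) := by
        rw [← Measure.map_apply (measurable_scaledCell x (h n)) hms, ← hlaw n,
          Measure.map_apply (hZ n) hms]
    _ ≤ _ := by
        refine measure_mono fun ω (hω : Metric.closedBall x (h n * ρ) ⊆ (Z n ω : Set (E d))) => ?_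
        rw [mem_ofPred_eq, Real.dist_eq, sub_zero, abs_of_nonneg Metric.diam_nonneg]
        refine le_diam_of_closedBall_subset (x := x) hd hmin.le (isBounded_inter_window _ _)
          (subset_inter ?_ ?_)
        · refine (Metric.closedBall_subset_closedBall ?_).trans hω
          exact (min_le_left _ _).trans (by gcongr)
        · exact (Metric.closedBall_subset_closedBall (min_le_right _ _)).trans (hWr n)

lemma exists_bound_of_tendsto_zero {h : ℕ → ℝ} (hh : ∀ n, 0 < h n)
    (h0 : Tendsto h atTop (𝓝 0)) : ∃ H : ℝ, 0 < H ∧ ∀ n, h n ≤ H := by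
  obtain ⟨H, hH⟩ := h0.bddAbove_range
  exact ⟨H, (hh 0).trans_le (hH ⟨0, rfl⟩), fun n => hH ⟨n, rfl⟩⟩

end

/-! ### Rates -/

section

variable {d : ℕ} {β : ℝ} {a h : ℕ → ℝ}

lemma exists_forest_rate_le (hβ1 : 1 < β) (ha : ∀ n, 0 < a n) (hh : ∀ n, 0 < h n)
    (hΘ : h =Θ[atTop] fun n => a n ^ (-1 / (d + 2 * β))) :
    ∃ c : ℝ, 0 < c ∧ ∀ᶠ n in atTop, ∀ M : ℕ, h n ^ (2 - 2 * β) < M →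
      1 / (a n * h n ^ d) + h n ^ 2 / M + h n ^ (2 * β) ≤ c * a n ^ (-(2 * β) / (d + 2 * β)) := by
  -- The upper comparison controls the bias term, the lower one the variance term.
  obtain ⟨K, hK, hKb⟩ := hΘ.1.exists_pos
  obtain ⟨K', hK', hKb'⟩ := hΘ.2.exists_pos
  refine ⟨K' ^ d + 2 * K ^ (2 * β), by positivity, ?_⟩
  filter_upwards [hKb.bound, hKb'.bound] with n h1 h2 M hM
  have han := ha n
  have hhn := hh n
  have hD : (0 : ℝ) < d + 2 * β := by positivity
  set q := a n ^ (-1 / (d + 2 * β)) with hq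
  have hq0 : 0 < q := Real.rpow_pos_of_pos han _
  rw [Real.norm_of_nonneg hhn.le, Real.norm_of_nonneg hq0.le] at h1 h2
  have e1 : q ^ (2 * β) = a n ^ (-(2 * β) / (d + 2 * β)) := by
    rw [hq, ← Real.rpow_mul han.le]; congr 1; ring
  have e2 : 1 / (a n * q ^ d) = a n ^ (-(2 * β) / (d + 2 * β)) := by
    rw [hq, ← Real.rpow_mul_natCast han.le, one_div, ← Real.rpow_one_add' han.le,
      ← Real.rpow_neg han.le]
    · congr 1; field_simp; ring
    · rw [show (1 : ℝ) + -1 / (d + 2 * β) * d = 2 * β / (d + 2 * β) by field_simp; ring]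
      positivity
  rw [← e1]
  have b1 : 1 / (a n * h n ^ d) ≤ K' ^ d * q ^ (2 * β) := by
    rw [e1, ← e2, mul_one_div, div_le_div_iff₀ (by positivity) (by positivity), one_mul]
    calc a n * q ^ d ≤ a n * (K' * h n) ^ d := by gcongr
      _ = _ := by ring
  have b2 : h n ^ (2 * β) ≤ K ^ (2 * β) * q ^ (2 * β) := by
    rw [← Real.mul_rpow hK.le hq0.le]
    gcongr
  have hM0 : (0 : ℝ) < M := (Real.rpow_pos_of_pos hhn _).trans hM
  -- The threshold on `M` is exactly where the averaged bias variance falls below the squared mean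
  -- bias.
  have b3 : h n ^ 2 / M ≤ h n ^ (2 * β) := by
    rw [div_le_iff₀ hM0]
    calc h n ^ 2 = h n ^ (2 * β) * h n ^ (2 - 2 * β) := by
          rw [← Real.rpow_add hhn, ← Real.rpow_natCast]; congr 1; push_cast; ring
      _ ≤ _ := by gcongr
  linarith

lemma two_mul_error_terms_le {a h M C₁ C V I m₂ mβ : ℝ} (hV : 0 ≤ V) (hm₂ : 0 ≤ m₂)
    (hI : 0 ≤ I) (ha : 0 < a) (hh : 0 < h) (hM : 0 < M) :
    2 * (V / a * (1 / h ^ d * I) + C₁ ^ 2 * h ^ 2 * m₂ / M + (C * h ^ β * mβ) ^ 2) ≤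
      (2 * (V * I + C₁ ^ 2 * m₂ + (C * mβ) ^ 2) + 1) *
        (1 / (a * h ^ d) + h ^ 2 / M + h ^ (2 * β)) := by
  have e : h ^ (2 * β) = (h ^ β) ^ 2 := by
    rw [← Real.rpow_mul_natCast hh.le]; congr 1; push_cast; ring
  have u₁ : 0 ≤ 1 / (a * h ^ d) := by positivity
  have u₂ : 0 ≤ h ^ 2 / M := by positivity
  have u₃ : 0 ≤ h ^ (2 * β) := by positivity
  have hA₁ : 0 ≤ V * I := by positivity
  have hA₂ : 0 ≤ C₁ ^ 2 * m₂ := by positivity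
  have hA₃ : 0 ≤ (C * mβ) ^ 2 := by positivity
  have e1 : 2 * (V / a * (1 / h ^ d * I) + C₁ ^ 2 * h ^ 2 * m₂ / M + (C * h ^ β * mβ) ^ 2) =
      2 * (V * I * (1 / (a * h ^ d)) + C₁ ^ 2 * m₂ * (h ^ 2 / M) + (C * mβ) ^ 2 * h ^ (2 * β)) := by
    rw [e]; field_simp
  rw [e1]
  generalize 1 / (a * h ^ d) = v₁ at *
  generalize h ^ 2 / M = v₂ at *
  generalize h ^ (2 * β) = v₃ at *
  generalize V * I = A₁ at *
  generalize C₁ ^ 2 * m₂ = A₂ at *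
  generalize (C * mβ) ^ 2 = A₃ at *
  have := mul_nonneg hA₁ u₂
  have := mul_nonneg hA₁ u₃
  have := mul_nonneg hA₂ u₁
  have := mul_nonneg hA₂ u₃
  have := mul_nonneg hA₃ u₁
  have := mul_nonneg hA₃ u₂
  linarith

/-- At the balancing bandwidth `q` both terms equal the left side; a larger `h` makes the second
term larger, a smaller one the first. -/
lemma rpow_le_tree_rate {a h : ℝ} (ha : 0 < a) (hh : 0 < h) :
    a ^ (-2 / ((d : ℝ) + 2)) ≤ 1 / (a * h ^ d) + h ^ 2 := by
  have hD : (0 : ℝ) < d + 2 := by positivity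
  set q := a ^ (-1 / ((d : ℝ) + 2)) with hq
  have hq0 : 0 < q := Real.rpow_pos_of_pos ha _
  rcases le_total q h with hqh | hqh
  · have e : a ^ (-2 / ((d : ℝ) + 2)) = q ^ 2 := by
      rw [hq, ← Real.rpow_mul_natCast ha.le]; congr 1; push_cast; ring
    rw [e]
    have : q ^ 2 ≤ h ^ 2 := by gcongr
    have : 0 ≤ 1 / (a * h ^ d) := by positivity
    linarith
  · have e : a ^ (-2 / ((d : ℝ) + 2)) = 1 / (a * q ^ d) := by
      rw [hq, ← Real.rpow_mul_natCast ha.le, one_div, ← Real.rpow_one_add' ha.le,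
        ← Real.rpow_neg ha.le]
      · congr 1; field_simp; ring
      · rw [show (1 : ℝ) + -1 / (d + 2) * d = 2 / (d + 2) by field_simp; ring]
        positivity
    rw [e]
    have : 1 / (a * q ^ d) ≤ 1 / (a * h ^ d) := by gcongr
    have : 0 ≤ h ^ 2 := by positivity
    linarith

lemma tendsto_div_minimax_rate (hd : 1 ≤ d) (hβ1 : 1 < β) (ha : ∀ n, 0 < a n)
    (hh : ∀ n, 0 < h n) (hat : Tendsto a atTop atTop) {c : ℝ} (hc : 0 < c) {F : ℕ → ENNReal}
    (hF : ∀ᶠ n in atTop, ENNReal.ofReal (c * (1 / (a n * h n ^ d) + h n ^ 2)) ≤ F n) :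
    Tendsto (fun n => F n / ENNReal.ofReal (a n ^ (-(2 * β) / (d + 2 * β)))) atTop (𝓝 ⊤) := by
  have hd' : (1 : ℝ) ≤ d := by exact_mod_cast hd
  -- The gap between the exponents is a positive multiple of `d (β - 1)`, so both `d ≥ 1` and `β >
  -- 1` enter.
  have hexp : 0 < -2 / ((d : ℝ) + 2) - -(2 * β) / (d + 2 * β) := by
    have h1 : 0 < (d : ℝ) * (β - 1) := by
      have : 0 < β - 1 := by linarith
      positivity
    have h2 : -2 / ((d : ℝ) + 2) - -(2 * β) / (d + 2 * β) =
        2 * (d * (β - 1)) / ((d + 2) * (d + 2 * β)) := by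
      have : (d : ℝ) + 2 * β ≠ 0 := by positivity
      field_simp
      ring
    rw [h2]
    positivity
  have hlim : Tendsto (fun n => ENNReal.ofReal
      (c * a n ^ (-2 / ((d : ℝ) + 2) - -(2 * β) / (d + 2 * β)))) atTop (𝓝 ⊤) :=
    ENNReal.tendsto_ofReal_atTop.comp
      (((tendsto_rpow_atTop hexp).comp hat).const_mul_atTop hc)
  refine tendsto_nhds_top_mono hlim ?_
  filter_upwards [hF] with n hn
  have han := ha n
  rw [Real.rpow_sub han, ← mul_div_assoc, ENNReal.ofReal_div_of_pos (by positivity)]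
  gcongr
  refine le_trans ?_ hn
  gcongr
  exact rpow_le_tree_rate han (hh n)

end

/-! ### The mean squared error of the forest and of a tree -/

lemma measurable_treeDeviation_comp {d : ℕ} {Ω : Type*} [MeasurableSpace Ω] (a : ℝ)
    {W : Set (E d)} (hW : MeasurableSet W) {lam : E d → ℝ} (hlam : Measurable lam)
    {X : Ω → PointConfig d} (hX : Measurable X) {Z : Ω → NonemptyCompacts (E d)}
    (hZ : Measurable Z) : Measurable fun ω => treeDeviation a W lam (X ω) (Z ω) := by
  have h : Measurable fun ω => (X ω, Z ω) := hX.prodMk hZ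
  have h1 := (measurable_treeDeviation a hW hlam).comp h
  exact h1

section

variable {d : ℕ} {Ω : Type*} [MeasurableSpace Ω] {P : Measure Ω} [IsProbabilityMeasure P]
  {ν : Measure (NonemptyCompacts (E d))} [IsProbabilityMeasure ν] {x : E d} {h a : ℕ → ℝ}
  {W : ℕ → Set (E d)} {lam : E d → ℝ} {Λ r C₁ C₂ β : ℝ} {X : ℕ → Ω → PointConfig d}
  {g : ℕ → E d × E d → ℝ} {G : E d} {Z : ℕ → ℕ → Ω → NonemptyCompacts (E d)}

omit [IsProbabilityMeasure ν] in
lemma exists_lintegral_forest_sq_le (hW : ∀ n, MeasurableSet (W n)) (hr : 0 < r)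
    (hWr : ∀ n, Metric.closedBall x r ⊆ W n) (hm : Measurable lam) (h0 : ∀ u, 0 ≤ lam u)
    (hΛ : ∀ u, lam u ≤ Λ) (ha : ∀ n, 0 < a n) (hh : ∀ n, 0 < h n)
    (hh0 : Tendsto h atTop (𝓝 0)) (hC₁ : 0 < C₁) (hC₂ : 0 < C₂) (hβ : 1 < β)
    (h1 : ∀ u, |lam u - lam x| ≤ C₁ * ‖u - x‖)
    (h2 : ∀ u, ‖u - x‖ ≤ r → |lam u - lam x - inner ℝ G (u - x)| ≤ C₂ * ‖u - x‖ ^ β)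
    (hX : ∀ n, Measurable (X n)) (hX1 : ∀ n, HasIntensity P (X n) (fun u => a n * lam u))
    (hX2 : ∀ n, HasPairCorrelation P (X n) (fun u => a n * lam u) (g n))
    (hg : ∃ c : ℝ, 0 < c ∧ ∀ n, ∀ A ⊆ W n, MeasurableSet A →
      ENNReal.ofReal (a n) * ∫⁻ p in A ×ˢ A, ENNReal.ofReal |g n p - 1|
        ≤ ENNReal.ofReal c * volume A)
    (hν0 : ∀ᵐ K : NonemptyCompacts (E d) ∂ν, 0 ∈ interior (K : Set (E d)))
    (hI : ∀ ρ : ℝ, 0 < ρ →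
      ∫⁻ K : NonemptyCompacts (E d), (volume ((K : Set (E d)) ∩ Metric.closedBall 0 ρ))⁻¹ ∂ν ≠ ⊤)
    (hmom : ∀ k : ℝ, 0 ≤ k →
      ∫⁻ K : NonemptyCompacts (E d), ENNReal.ofReal (Metric.diam (K : Set (E d)) ^ k) ∂ν ≠ ⊤)
    (hcent : ∫⁻ K, ENNReal.ofReal (inner ℝ G (centroid K)) ∂ν =
      ∫⁻ K, ENNReal.ofReal (-inner ℝ G (centroid K)) ∂ν)
    (hZ : ∀ n i, Measurable (Z n i)) (hlaw : ∀ n i, P.map (Z n i) = ν.map (scaledCell x (h n)))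
    (hXZ : ∀ n i, IndepFun (X n) (Z n i) P) (hZZ : ∀ n, iIndepFun (Z n) P) :
    ∃ c : ℝ, 0 < c ∧ ∀ n, ∀ M : ℕ, 1 ≤ M →
      ∫⁻ ω, ENNReal.ofReal (((1 / (M : ℝ)) * ∑ i ∈ Finset.range M,
        (treeDeviation (a n) (W n) lam (X n ω) (Z n i ω) +
          treeBias (W n) x lam (Z n i ω))) ^ 2) ∂P ≤
        ENNReal.ofReal (c * (1 / (a n * h n ^ d) + h n ^ 2 / M + h n ^ (2 * β))) := by
  obtain ⟨c, hc, hg⟩ := hg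
  obtain ⟨H, hH, hHh⟩ := exists_bound_of_tendsto_zero hh hh0
  have hΛ0 : 0 ≤ Λ := (h0 x).trans (hΛ x)
  -- With `h n ≤ H` the radius `r / H` works for all `n` simultaneously, which makes the constant
  -- uniform from the first index on.
  obtain ⟨I, hI0, hI⟩ : ∃ I : ℝ, 0 ≤ I ∧ ∫⁻ K : NonemptyCompacts (E d),
      (volume ((K : Set (E d)) ∩ Metric.closedBall 0 (r / H)))⁻¹ ∂ν ≤ ENNReal.ofReal I :=
    ⟨_, ENNReal.toReal_nonneg, (ENNReal.ofReal_toReal (hI _ (by positivity))).ge⟩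
  have hmom' : ∀ k : ℝ, 0 ≤ k → ∃ m : ℝ, 0 ≤ m ∧ ∫⁻ K : NonemptyCompacts (E d),
      ENNReal.ofReal (Metric.diam (K : Set (E d)) ^ k) ∂ν ≤ ENNReal.ofReal m := fun k hk =>
    ⟨_, ENNReal.toReal_nonneg, (ENNReal.ofReal_toReal (hmom k hk)).ge⟩
  obtain ⟨m₁, -, hm₁⟩ := hmom' 1 zero_le_one
  obtain ⟨m₂, hm₂0, hm₂⟩ := hmom' 2 zero_le_two
  obtain ⟨mβ, hmβ0, hmβ⟩ := hmom' β (by positivity)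
  simp only [Real.rpow_two] at hm₂
  refine ⟨2 * ((Λ + Λ ^ 2 * c) * I + C₁ ^ 2 * m₂ +
    ((C₂ + (C₁ + ‖G‖) / r ^ (β - 1)) * mβ) ^ 2) + 1, by positivity, fun n M hM => ?_⟩
  have han := ha n
  have hhn := hh n
  have hM0 : (0 : ℝ) < M := by exact_mod_cast hM
  have hρ : h n * (r / H) ≤ r := by
    rw [mul_div_assoc', div_le_iff₀ hH, mul_comm]
    exact mul_le_mul_of_nonneg_left (hHh n) hr.le
  have ht : ∀ i, ∫⁻ ω, ENNReal.ofReal (treeDeviation (a n) (W n) lam (X n ω) (Z n i ω) ^ 2) ∂P ≤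
      ENNReal.ofReal ((Λ + Λ ^ 2 * c) / a n * (1 / h n ^ d * I)) := fun i =>
    lintegral_treeDeviation_cell_le (hW n) hr (hWr n) hm h0 hΛ han hc (hX n) (hX1 n)
      (hX2 n) (hg n) hhn hρ hν0 hI (hZ n i) (hlaw n i) (hXZ n i)
  have hs : ∀ i, ∫⁻ ω, ENNReal.ofReal (treeBias (W n) x lam (Z n i ω) ^ 2) ∂P ≤
      ENNReal.ofReal (C₁ ^ 2 * h n ^ 2 * m₂) := fun i =>
    lintegral_treeBias_sq_le (hW n) hr (hWr n) hm h0 hΛ hC₁ h1 hhn hν0 hm₂ (hZ n i) (hlaw n i)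
  have hb : ∀ i, |∫ ω, treeBias (W n) x lam (Z n i ω) ∂P| ≤
      (C₂ + (C₁ + ‖G‖) / r ^ (β - 1)) * h n ^ β * mβ := fun i =>
    abs_integral_treeBias_le (hW n) hr (hWr n) hm h0 hΛ hC₁ hC₂ hβ h1 h2 hhn hν0 hcent
      hm₁ hmβ0 hmβ (hZ n i) (hlaw n i)
  have hDm : ∀ i, Measurable fun ω => treeDeviation (a n) (W n) lam (X n ω) (Z n i ω) := fun i =>
    measurable_treeDeviation_comp (a n) (hW n) hm (hX n) (hZ n i)
  have hYm : ∀ i, Measurable fun ω => treeBias (W n) x lam (Z n i ω) := fun i =>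
    (measurable_treeBias (hW n) x hm).comp (hZ n i)
  have hYi := (hZZ n).comp (fun _ => treeBias (W n) x lam) fun _ => measurable_treeBias (hW n) x hm
  refine (lintegral_forest_sq_le hDm hYm hYi (by positivity) (by positivity) ht hs hb hM).trans ?_
  exact ENNReal.ofReal_le_ofReal
    (two_mul_error_terms_le (by positivity) hm₂0 hI0 han hhn hM0)

omit [IsProbabilityMeasure ν] in
/-- There is a bound such that cells with at most this size and with a centroid off the
hyperplane orthogonal to `G` have positive probability. -/
lemma exists_measure_pos_of_not_ae (hG : ¬ ∀ᵐ K ∂ν, inner ℝ G (centroid K) = 0) :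
    ∃ R : ℝ, 0 < R ∧ ν {K : NonemptyCompacts (E d) | Metric.diam (K : Set (E d)) ≤ R ∧
      volume (K : Set (E d)) ≤ ENNReal.ofReal R ∧ 1 / R ≤ inner ℝ G (centroid K) ^ 2} ≠ 0 := by
  by_contra! hcon
  refine hG ?_
  have h1 : ∀ᵐ K : NonemptyCompacts (E d) ∂ν, ∀ k : ℕ, ¬ (Metric.diam (K : Set (E d)) ≤ (k : ℝ) + 1 ∧
      volume (K : Set (E d)) ≤ ENNReal.ofReal ((k : ℝ) + 1) ∧
      1 / ((k : ℝ) + 1) ≤ inner ℝ G (centroid K) ^ 2) := by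
    refine ae_all_iff.2 fun k => ?_
    rw [ae_iff]
    simpa only [not_not] using hcon ((k : ℝ) + 1) (by positivity)
  filter_upwards [h1] with K hK
  by_contra hne
  obtain ⟨k₁, hk₁⟩ := exists_nat_ge (Metric.diam (K : Set (E d)))
  obtain ⟨k₂, hk₂⟩ := exists_nat_ge (volume (K : Set (E d))).toReal
  obtain ⟨k₃, hk₃⟩ := exists_nat_one_div_lt (sq_pos_of_ne_zero hne)
  -- One index exceeds all three thresholds, and all three conditions weaken as `k` grows.
  set k := k₁ + k₂ + k₃
  have hk : (k : ℝ) = k₁ + k₂ + k₃ := by push_cast [k]; ring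
  have p₁ : (0 : ℝ) ≤ k₁ := by positivity
  have p₂ : (0 : ℝ) ≤ k₂ := by positivity
  have p₃ : (0 : ℝ) ≤ k₃ := by positivity
  refine hK k ⟨by linarith, ?_, le_trans ?_ hk₃.le⟩
  · rw [← ENNReal.ofReal_toReal (volume_coe_ne_top K)]
    exact ENNReal.ofReal_le_ofReal (by linarith)
  · exact one_div_le_one_div_of_le (by positivity) (by linarith)

/-- Only shapes from a fixed set of positive probability are kept; for them `h → 0` makes the cell
small and the Taylor remainder negligible against `h`. -/
lemma exists_le_lintegral_tree_sq (hW : ∀ n, MeasurableSet (W n)) (hr : 0 < r)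
    (hWr : ∀ n, Metric.closedBall x r ⊆ W n) (hm : Measurable lam) (h0 : ∀ u, 0 ≤ lam u)
    (hΛ : ∀ u, lam u ≤ Λ) (ha : ∀ n, 0 < a n) (hh : ∀ n, 0 < h n)
    (hh0 : Tendsto h atTop (𝓝 0)) (hC₂ : 0 < C₂) (hβ : 1 < β)
    (hcont : ContinuousAt lam x) (hx : 0 < lam x)
    (h2 : ∀ u, ‖u - x‖ ≤ r → |lam u - lam x - inner ℝ G (u - x)| ≤ C₂ * ‖u - x‖ ^ β)
    (hX : ∀ n, Measurable (X n)) (hX1 : ∀ n, HasIntensity P (X n) (fun u => a n * lam u))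
    (hX2 : ∀ n, HasPairCorrelation P (X n) (fun u => a n * lam u) (g n))
    (hg : ∀ n, ∀ u ∈ W n, ∀ v ∈ W n, 1 ≤ g n (u, v))
    (hν0 : ∀ᵐ K : NonemptyCompacts (E d) ∂ν, 0 ∈ interior (K : Set (E d)))
    (hG : ¬ ∀ᵐ K ∂ν, inner ℝ G (centroid K) = 0)
    {Z : ℕ → Ω → NonemptyCompacts (E d)}
    (hZ : ∀ n, Measurable (Z n)) (hlaw : ∀ n, P.map (Z n) = ν.map (scaledCell x (h n)))
    (hXZ : ∀ n, IndepFun (X n) (Z n) P) :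
    ∃ c : ℝ, 0 < c ∧ ∀ᶠ n in atTop,
      ENNReal.ofReal (c * (1 / (a n * h n ^ d) + h n ^ 2)) ≤
        ∫⁻ ω, ENNReal.ofReal ((treeDeviation (a n) (W n) lam (X n ω) (Z n ω) +
          treeBias (W n) x lam (Z n ω)) ^ 2) ∂P := by
  obtain ⟨R, hR, hpos⟩ := exists_measure_pos_of_not_ae hG
  set p := (ν {K : NonemptyCompacts (E d) | Metric.diam (K : Set (E d)) ≤ R ∧
    volume (K : Set (E d)) ≤ ENNReal.ofReal R ∧ 1 / R ≤ inner ℝ G (centroid K) ^ 2}).toReal with hp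
  have hp0 : 0 < p := ENNReal.toReal_pos hpos (measure_ne_top _ _)
  obtain ⟨δ, hδ, hδl⟩ := Metric.eventually_nhds_iff_ball.1
    (hcont.eventually (lt_mem_nhds (half_lt_self hx)))
  -- On this ball the Taylor bound holds and continuity keeps the intensity above half its value at
  -- `x`.
  set r₁ := min r (δ / 2)
  have hr₁ : 0 < r₁ := by positivity
  have hlow : ∀ u, ‖u - x‖ ≤ r₁ → lam x / 2 ≤ lam u := fun u hu => by
    refine (hδl u ?_).le
    rw [Metric.mem_ball, dist_eq_norm]
    exact (hu.trans (min_le_right _ _)).trans_lt (half_lt_self hδ)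
  have ev1 : ∀ᶠ n in atTop, h n * R ≤ r₁ := by
    have : Tendsto (fun n => h n * R) atTop (𝓝 0) := by simpa using hh0.mul_const R
    exact (this.eventually_lt_const hr₁).mono fun _ h => h.le
  have ev2 : ∀ᶠ n in atTop, C₂ ^ 2 * (h n * R) ^ (2 * β) ≤ h n ^ 2 / (4 * R) := by
    have t1 : Tendsto (fun n => C₂ ^ 2 * R ^ (2 * β) * h n ^ (2 * β - 2)) atTop (𝓝 0) := by
      have := (hh0.rpow_const (p := 2 * β - 2) (Or.inr (by linarith))).const_mul
        (C₂ ^ 2 * R ^ (2 * β))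
      rwa [Real.zero_rpow (by linarith), mul_zero] at this
    filter_upwards [t1.eventually_lt_const (show (0 : ℝ) < 1 / (4 * R) by positivity)] with n hn
    have hhn := hh n
    calc C₂ ^ 2 * (h n * R) ^ (2 * β)
        = C₂ ^ 2 * R ^ (2 * β) * h n ^ (2 * β - 2) * h n ^ 2 := by
          rw [Real.mul_rpow hhn.le hR.le, Real.rpow_sub hhn, ← Real.rpow_natCast (h n) 2]
          push_cast
          field_simp
      _ ≤ 1 / (4 * R) * h n ^ 2 := by gcongr
      _ = _ := by ring
  set c := min (lam x / (2 * R)) (1 / (4 * R))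
  have hc : 0 < c := by positivity
  refine ⟨c * p, by positivity, ?_⟩
  filter_upwards [ev1, ev2] with n e1 e2
  have han := ha n
  have hhn := hh n
  refine le_trans ?_ (le_lintegral_tree_cell_sq (hW n) hr₁
    ((Metric.closedBall_subset_closedBall (min_le_left _ _)).trans (hWr n)) hm h0 hΛ han hC₂ hβ
    (fun u hu => h2 u (hu.trans (min_le_left _ _))) hlow (hX n) (hX1 n) (hX2 n) (hg n) hhn hν0 hR
    e1 e2 (hZ n) (hlaw n) (hXZ n))
  rw [← ENNReal.ofReal_toReal (measure_ne_top ν _), ← hp,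
    ← ENNReal.ofReal_mul (by positivity)]
  refine ENNReal.ofReal_le_ofReal ?_
  calc c * p * (1 / (a n * h n ^ d) + h n ^ 2)
      = (c * (1 / (a n * h n ^ d)) + c * h n ^ 2) * p := by ring
    _ ≤ _ := by
        gcongr
        · exact min_le_left _ _
        · exact min_le_right _ _

end

end SpatialForest

/-! ### The theorem assembled -/

theorem mainTheorem5 {d : ℕ} (hd : 1 ≤ d)
    {Ω Ω₁ : Type*} [MeasurableSpace Ω] [MeasurableSpace Ω₁]
    (P : Measure Ω) [IsProbabilityMeasure P] (P₁ : Measure Ω₁) [IsProbabilityMeasure P₁]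
    (β : ℝ) (hβ1 : 1 < β) (hβ2 : β ≤ 2)
    -- the windows, the normalisations, the bandwidths and the point of estimation
    (W : ℕ → Set (E d)) (hW : ∀ n, MeasurableSet (W n))
    (a h : ℕ → ℝ) (ha : ∀ n, 0 < a n) (hh : ∀ n, 0 < h n)
    (x : E d) (hx : x ∈ interior (⋂ n, W n))
    -- the intensity
    (lam : E d → ℝ) (hlam_meas : Measurable lam) (hlam_nonneg : ∀ u, 0 ≤ lam u)
    (hlam_bdd : ∃ L : ℝ, ∀ u, lam u ≤ L) (hlam : ∃ L : ℝ, IsC1Holder (⋃ n, W n) β L lam)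
    -- the point processes and their pair correlation functions
    (X : ℕ → Ω → PointConfig d) (hX : ∀ n, Measurable (X n))
    (hX1 : ∀ n, HasIntensity P (X n) (fun u => a n * lam u))
    (g : ℕ → E d × E d → ℝ)
    (hX2 : ∀ n, HasPairCorrelation P (X n) (fun u => a n * lam u) (g n))
    (hg : ∃ c : ℝ, 0 < c ∧ ∀ n, ∀ A ⊆ W n, MeasurableSet A →
      ENNReal.ofReal (a n) * ∫⁻ p in A ×ˢ A, ENNReal.ofReal |g n p - 1|
        ≤ ENNReal.ofReal c * volume A)
    -- the partitions: i.i.d., independent of the point process, built from stationary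
    -- regular tessellations with intensity `h_n^{-d}` having the scaling property
    (T₁ : Ω₁ → Tessellation d) (hT₁ : IsStationaryTessellation P₁ T₁ 1)
    (π : ℕ → ℕ → Ω → Tessellation d)
    (hπ : ∀ n i, IsStationaryTessellation P (π n i) (h n ^ (-(d : ℝ))))
    (hπ_reg : ∀ n i, IsRegularTessellation P (π n i))
    (hπ_scal : ∀ n i, HasScaling P (π n i) (h n ^ (-(d : ℝ))) P₁ T₁)
    (hπ_indep : ∀ n, iIndepFun (π n) P)
    (hπ_ident : ∀ n i, IdentDistrib (π n i) (π n 0) P P)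
    (hπX : ∀ n, IndepFun (X n) (fun ω i => π n i ω) P)
    -- the diameter of the cell of `x` tends to zero in probability
    (hdiam : ∀ i, TendstoInMeasure P
      (fun n ω => Metric.diam (windowCell (W n) x (π n i ω))) atTop (fun _ => (0 : ℝ)))
    -- `𝔼 (1 / (a_n |A_n(x)|))` tends to zero
    (hvol : ∀ i, Tendsto (fun n =>
      ∫⁻ ω, (ENNReal.ofReal (a n) * volume (windowCell (W n) x (π n i ω)))⁻¹ ∂P)
      atTop (𝓝 0)) :
    -- the bound on the mean squared error of the forest
    (∃ c : ℝ, 0 < c ∧ ∀ n, ∀ M : ℕ, 1 ≤ M →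
      forestMSE P (a n) (W n) x lam (X n) (π n) M ≤
        ENNReal.ofReal (c * (1 / (a n * h n ^ d) + h n ^ 2 / M + h n ^ (2 * β)))) ∧
    -- a forest with more than `h_n^{2-2β}` trees attains the rate `a_n^{-2β/(d+2β)}`
    (Tendsto a atTop atTop →
      (h =Θ[atTop] fun n => a n ^ (-1 / (d + 2 * β))) →
      ∃ c : ℝ, 0 < c ∧ ∀ᶠ n in atTop, ∀ M : ℕ, h n ^ (2 - 2 * β) < M →
        forestMSE P (a n) (W n) x lam (X n) (π n) M ≤
          ENNReal.ofReal (c * a n ^ (-(2 * β) / (d + 2 * β)))) ∧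
    -- which is minimax over balls of `C^{1,β-1}`: no estimator has a better worst-case rate,
    -- even for Poisson point processes
    (Tendsto a atTop atTop → ∀ L : ℝ, 0 < L →
      ∃ c : ℝ, 0 < c ∧ ∀ᶠ n in atTop, ∀ S : PointConfig d → ℝ, Measurable S →
        ∃ f : E d → ℝ, Measurable f ∧ (∀ u, 0 ≤ f u ∧ f u ≤ L) ∧
          IsC1Holder (⋃ n, W n) β L f ∧
          ∀ Q : Measure (PointConfig d),
            IsPoissonLaw Q ((volume.restrict (W n)).withDensity
              (fun u => ENNReal.ofReal (a n * f u))) →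
            ENNReal.ofReal (c * a n ^ (-(2 * β) / (d + 2 * β))) ≤
              ∫⁻ ξ, ENNReal.ofReal ((S ξ - f x) ^ 2) ∂Q) ∧
    -- whereas, as soon as the intensity is positive and not flat at `x` and there is no
    -- repulsion (for instance for Poisson processes), the bound is sharp for a single tree,
    -- whose rate is strictly slower than `a_n^{-2β/(d+2β)}` whatever the bandwidths
    (0 < lam x → gradient lam x ≠ 0 →
      (∀ n, ∀ u ∈ W n, ∀ v ∈ W n, 1 ≤ g n (u, v)) →
      (∃ c : ℝ, 0 < c ∧ ∀ᶠ n in atTop,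
        ENNReal.ofReal (c * (1 / (a n * h n ^ d) + h n ^ 2)) ≤
          forestMSE P (a n) (W n) x lam (X n) (π n) 1) ∧
      (Tendsto a atTop atTop →
        Tendsto (fun n => forestMSE P (a n) (W n) x lam (X n) (π n) 1 /
          ENNReal.ofReal (a n ^ (-(2 * β) / (d + 2 * β)))) atTop (𝓝 ⊤))) := by
  obtain ⟨r, hr, hWr⟩ : ∃ r : ℝ, 0 < r ∧ ∀ n, Metric.closedBall x r ⊆ W n := by
    obtain ⟨r, hr, hrW⟩ := Metric.nhds_basis_closedBall.mem_iff.1 (mem_interior_iff_mem_nhds.1 hx)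
    exact ⟨r, hr, fun n => hrW.trans (iInter_subset W n)⟩
  obtain ⟨Λ, hΛ⟩ := hlam_bdd
  obtain ⟨L, hL⟩ := hlam
  obtain ⟨G, C₁, C₂, hC₁, hC₂, hgrad, h1, h2⟩ :=
    exists_taylor_bounds hβ1 hr ((hWr 0).trans (subset_iUnion W 0)) hL hlam_nonneg hΛ
  have hprob := hT₁.isProbabilityMeasure one_pos
  have hν0 : ∀ᵐ K : NonemptyCompacts (E d) ∂(zeroCellLaw P₁ T₁), 0 ∈ interior (K : Set (E d)) :=
    (hT₁.ae_zeroCellLaw one_pos).mono fun K hK => hK.2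
  have hZ : ∀ n i, Measurable fun ω => (π n i ω).cell x := fun n i =>
    (measurable_cell x).comp (hπ n i).measurable
  have hlaw : ∀ n i, P.map (fun ω => (π n i ω).cell x) =
      (zeroCellLaw P₁ T₁).map (scaledCell x (h n)) := fun n i =>
    map_cell_eq hd (hh n) hT₁ (hπ n i) (hπ_scal n i) x
  have hγ : ∀ n, 0 < h n ^ (-(d : ℝ)) := fun n => Real.rpow_pos_of_pos (hh n) _
  have hXZ : ∀ n i, IndepFun (X n) (fun ω => (π n i ω).cell x) P := fun n i =>
    (hπX n).comp measurable_id ((measurable_cell x).comp (measurable_pi_apply i))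
  have hZZ : ∀ n, iIndepFun (fun i ω => (π n i ω).cell x) P := fun n =>
    (hπ_indep n).comp (fun _ => Tessellation.cell x) fun _ => measurable_cell x
  have hh0 : Tendsto h atTop (𝓝 0) := by
    refine tendsto_bandwidth hd hν0 hr hWr hh (fun n => hZ n 0) (fun n => hlaw n 0) ?_
    refine (hdiam 0).congr' (Eventually.of_forall fun n => ?_) .rfl
    filter_upwards [(hπ n 0).ae_existsUnique (hγ n) x] with ω hω
    rw [windowCell, hω.2]
  obtain ⟨c, hc, hupper⟩ : ∃ c : ℝ, 0 < c ∧ ∀ n, ∀ M : ℕ, 1 ≤ M →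
      forestMSE P (a n) (W n) x lam (X n) (π n) M ≤
        ENNReal.ofReal (c * (1 / (a n * h n ^ d) + h n ^ 2 / M + h n ^ (2 * β))) := by
    obtain ⟨c, hc, hcb⟩ := exists_lintegral_forest_sq_le hW hr hWr hlam_meas hlam_nonneg hΛ ha hh
      hh0 hC₁ hC₂ hβ1 h1 h2 hX hX1 hX2 hg hν0 (fun ρ hρ => hT₁.lintegral_inv_volume hρ)
      -- All tessellations have the same rescaled zero cell, so regularity of a single one gives the
      -- moments for the unit intensity.
      (fun k hk => lintegral_diam_rpow_ne_top hd (hh 0) hT₁ (hπ 0 0) (hπ_reg 0 0) (hπ_scal 0 0) hk)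
      (hT₁.lintegral_inner_centroid one_pos G) hZ hlaw hXZ hZZ
    refine ⟨c, hc, fun n M hM => ?_⟩
    rw [forestMSE_eq (hγ n) (hπ n) (a n) (W n) x lam (X n) hM]
    exact hcb n M hM
  refine ⟨⟨c, hc, hupper⟩, fun _ hΘ => ?_,
    fun hat L hL => minimax_lower_bound hβ1 hβ2 W a ha x hat hL, fun hpos hne hrep => ?_⟩
  · obtain ⟨c', hc', hrate⟩ := exists_forest_rate_le hβ1 ha hh hΘ
    refine ⟨c * c', by positivity, hrate.mono fun n hn M hM => ?_⟩
    -- The threshold `h_n^(2-2β)` is positive, so exceeding it forces at least one tree and the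
    -- general bound applies.
    have hM0 : (0 : ℝ) < M := (Real.rpow_pos_of_pos (hh n) _).trans hM
    refine (hupper n M (by exact_mod_cast hM0)).trans (ENNReal.ofReal_le_ofReal ?_)
    rw [mul_assoc]
    exact mul_le_mul_of_nonneg_left (hn M hM) hc.le
  · obtain ⟨c', hc', hlower⟩ : ∃ c : ℝ, 0 < c ∧ ∀ᶠ n in atTop,
        ENNReal.ofReal (c * (1 / (a n * h n ^ d) + h n ^ 2)) ≤
          forestMSE P (a n) (W n) x lam (X n) (π n) 1 := by
      have hG : G ≠ 0 := hgrad.gradient ▸ hne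
      obtain ⟨c', hc', hcb⟩ := exists_le_lintegral_tree_sq hW hr hWr hlam_meas hlam_nonneg hΛ ha hh
        hh0 hC₂ hβ1 hgrad.continuousAt hpos h2 hX hX1 hX2 hrep hν0
        (hT₁.not_ae_inner_centroid_eq_zero one_pos hG) (fun n => hZ n 0) (fun n => hlaw n 0)
        (fun n => hXZ n 0)
      refine ⟨c', hc', hcb.mono fun n hn => ?_⟩
      rw [forestMSE_eq (hγ n) (hπ n) (a n) (W n) x lam (X n) le_rfl]
      simpa using hn
    exact ⟨⟨c', hc', hlower⟩, fun hat => tendsto_div_minimax_rate hd hβ1 ha hh hat hc' hlower⟩
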